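/- An instance of Budgeted-Additive Virtual Welfare Maximization (BAVWM) with $n$ bidders and $m$ items consists of budgets $b_i\ge 0$, values $v_{ij}\in[0,b_i]$, price multipliers $m_i\ge 0$ and virtual values $w_{ij}\in\mathbb{R}$ (for bidders $i$ and items $j$). Consider the linear program in the variables $\bar x_{ij},\hat x_{ij}\ge 0$: $$\text{maximize } \sum_{i,j} m_i\,\bar x_{ij}v_{ij}+\sum_{i,j}w_{ij}(\bar x_{ij}+\hat x_{ij})$$ $$\text{subject to } \sum_i(\bar x_{ij}+\hat x_{ij})\le 1 \text{ for all } j,\qquad \sum_j\bar x_{ij}v_{ij}\le b_i \text{ for all } i,$$ and let $\mathrm{OPT}$ be its value. **Theorem.** There is a polynomial-time algorithm that, given an instance and an optimal (fractional) solution $(\bar x,\hat x)$ of this linear program, outputs an integral assignment $\bar y_{ij},\hat y_{ij}\in\{0,1\}$ such that 1. $\sum_i(\bar y_{ij}+\hat y_{ij})\le 1$ for all $j$; 2. $\sum_j\bar y_{ij}v_{ij}\le 2b_i$ for all $i$; 3. $\sum_{i,j} m_i\,\bar y_{ij}v_{ij}+\sum_{i,j}w_{ij}(\bar y_{ij}+\hat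 y_{ij})\ge \mathrm{OPT}$. Here polynomial time means the following for one and the same random access machine program. On real data, with unit cost for each field operation and comparison of real numbers, its running time is at most a polynomial in the numbers of bidders and items. On rational data, with every operation charged the bit lengths of the numbers involved (logarithmic cost), its running time is at most a polynomial in $n+m$ plus the total bit length of the instance and of the fractional solution. -/

import Mathlib

namespace BAVWM

/-! ### The problem and its linear relaxation -/

/-- An input of budgeted-additive virtual welfare maximization with `n` bidders and `m` items, over
an ordered field `K` (the reals, or the rationals for bit complexity): budgets, values in
`[0, budget]`, nonnegative price multipliers and virtual values of arbitrary sign. -/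
structure Input (K : Type) [Field K] [LinearOrder K] (n m : ℕ) where
  budget : Fin n → K
  value : Fin n → Fin m → K
  mult : Fin n → K
  virt : Fin n → Fin m → K
  budget_nonneg : ∀ i, 0 ≤ budget i
  value_nonneg : ∀ i j, 0 ≤ value i j
  value_le_budget : ∀ i j, value i j ≤ budget i
  mult_nonneg : ∀ i, 0 ≤ mult i

/-- A (possibly fractional) split assignment: the bar part and the hat part of the fraction of
item `j` that is given to bidder `i`. -/
structure Assignment (K : Type) (n m : ℕ) where
  bar : Fin n → Fin m → K
  hat : Fin n → Fin m → K

variable {K : Type} [Field K] [LinearOrder K] {n m : ℕ}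

/-- The objective of the linear program. -/
def objective (I : Input K n m) (x : Assignment K n m) : K :=
  (∑ i, ∑ j, I.mult i * x.bar i j * I.value i j) +
    ∑ i, ∑ j, I.virt i j * (x.bar i j + x.hat i j)

/-- Feasible solutions of the linear program. The variables are fractions, hence nonnegative. -/
structure IsFeasible (I : Input K n m) (x : Assignment K n m) : Prop where
  bar_nonneg : ∀ i j, 0 ≤ x.bar i j
  hat_nonneg : ∀ i j, 0 ≤ x.hat i j
  item : ∀ j, ∑ i, (x.bar i j + x.hat i j) ≤ 1
  load : ∀ i, ∑ j, x.bar i j * I.value i j ≤ I.budget i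

/-- Optimal solutions of the linear program; the objective of such a solution is the value of the
linear program. -/
def IsOptimal (I : Input K n m) (x : Assignment K n m) : Prop :=
  IsFeasible I x ∧ ∀ z : Assignment K n m, IsFeasible I z → objective I z ≤ objective I x

/-- `y` is an integral assignment that gives each item at most once, exceeds no budget by more than
a factor of two in its bar part, and has objective at least `opt`. -/
structure IsRounding (I : Input K n m) (opt : K) (y : Assignment K n m) : Prop where
  integral : ∀ i j, (y.bar i j = 0 ∨ y.bar i j = 1) ∧ (y.hat i j = 0 ∨ y.hat i j = 1)
  item : ∀ j, ∑ i, (y.bar i j + y.hat i j) ≤ 1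
  load : ∀ i, ∑ j, y.bar i j * I.value i j ≤ 2 * I.budget i
  value : opt ≤ objective I y

/-! ### A random access machine

Programs are structured programs over finitely many random access arrays (a program mentions only
finitely many array names). There are arrays of natural numbers, for indices, and arrays of
numbers in `K`. Both are indexed by pairs of natural numbers. Numbers in `K` can only be combined
by the field operations and compared; in particular there is no rounding to an integer, and the
only constants of a program are natural numbers. -/

/-- Memory contents: entry `(i, j)` of array `a` is `idx a i j`, respectively `num a i j`. -/
structure State (K : Type) where
  idx : ℕ → ℕ → ℕ → ℕ
  num : ℕ → ℕ → ℕ → K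

/-- Index expressions. Subtraction is truncated. -/
inductive IdxExpr : Type
  | const (c : ℕ)
  | load (a : ℕ) (i j : IdxExpr)
  | add (e f : IdxExpr)
  | sub (e f : IdxExpr)
  | mul (e f : IdxExpr)

/-- Number expressions. -/
inductive NumExpr : Type
  | ofIdx (e : IdxExpr)
  | load (a : ℕ) (i j : IdxExpr)
  | add (e f : NumExpr)
  | sub (e f : NumExpr)
  | mul (e f : NumExpr)
  | div (e f : NumExpr)

/-- Tests. -/
inductive Test : Type
  | idxLe (e f : IdxExpr)
  | numLe (e f : NumExpr)
  | not (c : Test)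
  | and (c d : Test)

/-- Programs. -/
inductive Prog : Type
  | skip
  | setIdx (a : ℕ) (i j e : IdxExpr)
  | setNum (a : ℕ) (i j : IdxExpr) (e : NumExpr)
  | seq (P Q : Prog)
  | branch (c : Test) (P Q : Prog)
  | loop (c : Test) (P : Prog)

/-- Value of an index expression. -/
def IdxExpr.eval (s : State K) : IdxExpr → ℕ
  | .const c => c
  | .load a i j => s.idx a (i.eval s) (j.eval s)
  | .add e f => e.eval s + f.eval s
  | .sub e f => e.eval s - f.eval s
  | .mul e f => e.eval s * f.eval s

/-- Value of a number expression. -/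
def NumExpr.eval (s : State K) : NumExpr → K
  | .ofIdx e => (e.eval s : K)
  | .load a i j => s.num a (i.eval s) (j.eval s)
  | .add e f => e.eval s + f.eval s
  | .sub e f => e.eval s - f.eval s
  | .mul e f => e.eval s * f.eval s
  | .div e f => e.eval s / f.eval s

/-- Truth of a test. -/
def Test.Holds (s : State K) : Test → Prop
  | .idxLe e f => e.eval s ≤ f.eval s
  | .numLe e f => e.eval s ≤ f.eval s
  | .not c => ¬ c.Holds s
  | .and c d => c.Holds s ∧ d.Holds s

/-- Cost of an index expression: one plus the bit length of the result, for every operation in it;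
so an array access also pays for the bit length of its address. -/
def IdxExpr.cost (s : State K) : IdxExpr → ℕ
  | .const c => 1 + Nat.size c
  | .load a i j => i.cost s + j.cost s + 1 + Nat.size (s.idx a (i.eval s) (j.eval s))
  | .add e f => e.cost s + f.cost s + 1 + Nat.size (e.eval s + f.eval s)
  | .sub e f => e.cost s + f.cost s + 1 + Nat.size (e.eval s - f.eval s)
  | .mul e f => e.cost s + f.cost s + 1 + Nat.size (e.eval s * f.eval s)

/-- Cost of a number expression: one plus the length of the result, for every operation in it.
The length of a number is measured by `size`. -/
def NumExpr.cost (size : K → ℕ) (s : State K) : NumExpr → ℕ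
  | .ofIdx e => e.cost s + 1 + size (e.eval s : K)
  | .load a i j => i.cost s + j.cost s + 1 + size (s.num a (i.eval s) (j.eval s))
  | .add e f => e.cost size s + f.cost size s + 1 + size (e.eval s + f.eval s)
  | .sub e f => e.cost size s + f.cost size s + 1 + size (e.eval s - f.eval s)
  | .mul e f => e.cost size s + f.cost size s + 1 + size (e.eval s * f.eval s)
  | .div e f => e.cost size s + f.cost size s + 1 + size (e.eval s / f.eval s)

/-- Cost of a test. -/
def Test.cost (size : K → ℕ) (s : State K) : Test → ℕ
  | .idxLe e f => e.cost s + f.cost s + 1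
  | .numLe e f => e.cost size s + f.cost size s + 1
  | .not c => c.cost size s + 1
  | .and c d => c.cost size s + d.cost size s + 1

/-- Overwrite entry `(i, j)` of the index array `a`. -/
def State.setIdx (s : State K) (a i j v : ℕ) : State K :=
  { s with idx := fun a' i' j' => if a' = a ∧ i' = i ∧ j' = j then v else s.idx a' i' j' }

/-- Overwrite entry `(i, j)` of the number array `a`. -/
def State.setNum (s : State K) (a i j : ℕ) (v : K) : State K :=
  { s with num := fun a' i' j' => if a' = a ∧ i' = i ∧ j' = j then v else s.num a' i' j' }

/-- `Exec size P s s' t`: started in `s`, the program `P` halts in `s'` after time `t`, where the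
length of a number is measured by `size`. -/
inductive Exec (size : K → ℕ) : Prog → State K → State K → ℕ → Prop
  | skip (s : State K) : Exec size .skip s s 1
  | setIdx (s : State K) (a : ℕ) (i j e : IdxExpr) :
      Exec size (.setIdx a i j e) s (s.setIdx a (i.eval s) (j.eval s) (e.eval s))
        (i.cost s + j.cost s + e.cost s + 1)
  | setNum (s : State K) (a : ℕ) (i j : IdxExpr) (e : NumExpr) :
      Exec size (.setNum a i j e) s (s.setNum a (i.eval s) (j.eval s) (e.eval s))
        (i.cost s + j.cost s + e.cost size s + 1)
  | seq {P Q : Prog} {s₁ s₂ s₃ : State K} {t u : ℕ} (hP : Exec size P s₁ s₂ t)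
      (hQ : Exec size Q s₂ s₃ u) : Exec size (.seq P Q) s₁ s₃ (t + u + 1)
  | branch_true {c : Test} {P Q : Prog} {s s' : State K} {t : ℕ} (hc : c.Holds s)
      (hP : Exec size P s s' t) : Exec size (.branch c P Q) s s' (c.cost size s + t + 1)
  | branch_false {c : Test} {P Q : Prog} {s s' : State K} {t : ℕ} (hc : ¬ c.Holds s)
      (hQ : Exec size Q s s' t) : Exec size (.branch c P Q) s s' (c.cost size s + t + 1)
  | loop_true {c : Test} {P : Prog} {s₁ s₂ s₃ : State K} {t u : ℕ} (hc : c.Holds s₁)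
      (hP : Exec size P s₁ s₂ t) (hL : Exec size (.loop c P) s₂ s₃ u) :
      Exec size (.loop c P) s₁ s₃ (c.cost size s₁ + t + u + 1)
  | loop_false {c : Test} {P : Prog} {s : State K} (hc : ¬ c.Holds s) :
      Exec size (.loop c P) s s (c.cost size s + 1)

/-- Unit cost of real numbers: every arithmetic operation or comparison counts as one, up to a
constant factor. -/
def unitSize (_ : ℝ) : ℕ := 1

/-- Bit length of a rational number: sign, numerator and denominator in lowest terms, in binary. -/
def bitSize (q : ℚ) : ℕ := 1 + Nat.size q.num.natAbs + Nat.size q.den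

/-! ### Input and output conventions -/

/-- A matrix stored in an array, padded with zeros. -/
def padMatrix (f : Fin n → Fin m → K) (i j : ℕ) : K :=
  if h : i < n ∧ j < m then f ⟨i, h.1⟩ ⟨j, h.2⟩ else 0

/-- A vector stored in column `0` of an array, padded with zeros. -/
def padVector (f : Fin n → K) (i j : ℕ) : K :=
  if h : i < n ∧ j = 0 then f ⟨i, h.1⟩ else 0

/-- The initial memory on input `I` and `x`: `n` and `m` are entries `(0, 0)` of index arrays `0`
and `1`, the data are in number arrays `0` to `5`, everything else is zero. -/
def initialState (I : Input K n m) (x : Assignment K n m) : State K where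
  idx a i j := if i = 0 ∧ j = 0 then (if a = 0 then n else if a = 1 then m else 0) else 0
  num
    | 0 => padVector I.budget
    | 1 => padMatrix I.value
    | 2 => padVector I.mult
    | 3 => padMatrix I.virt
    | 4 => padMatrix x.bar
    | 5 => padMatrix x.hat
    | _ => fun _ _ => 0

/-- Length of the input `I` and `x`: the numbers of bidders and items plus the lengths of all the
numbers in it. -/
def inputLength (size : K → ℕ) (I : Input K n m) (x : Assignment K n m) : ℕ :=
  n + m + (∑ i, (size (I.budget i) + size (I.mult i))) +
    ∑ i, ∑ j, (size (I.value i j) + size (I.virt i j) + size (x.bar i j) + size (x.hat i j))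

/-- The assignment that a final memory holds: its bar part in index array `2` and its hat part in
index array `3`. -/
def output (s : State K) (n m : ℕ) : Assignment K n m where
  bar i j := (s.idx 2 i j : K)
  hat i j := (s.idx 3 i j : K)

end BAVWM

/-! The rounding is the one of Shmoys and Tardos for generalized assignment. For each bidder, lay
the items end to end in order of decreasing value, item `j` as an interval whose length is its bar
fraction, and cut the half-line into unit slots. The lengths `slot` form a fractional matching of
items and slots. Consider any integral matching within its support. The item placed in slot `s + 1`
is worth at most every item that meets slot `s`; slot `s` is full, so that item is worth at most the
fractional load of slot `s`. Only the item in slot 0 is not charged to an earlier slot, and it is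
worth at most the budget. Hence the load is at most the budget plus the fractional load, that is, at
most twice the budget (`sum_load_le`).

It remains to round this matching without loss of value. Index both rows and columns by the `m`
items and the `n * m` slots, put the fractions into the two off-diagonal blocks, and fill up the
diagonal; the result is symmetric and doubly stochastic (`complete_stochastic`). An entry between
item `j` and a slot of bidder `i` has weight `mult i * value i j + virt i j`, counted in one block
only. The diagonal entry of item `j` is the fraction not used by the bar part, and its weight is the
larger of zero and the best virtual value for `j`. All other weights vanish. The hat part of the
linear program fits into that fraction, so the total weight is at least the optimum
(`Computed.le_weight`), and a 0/1 matrix reads back as an assignment whose objective is its weight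
(`Computed.weight_eq_objective`).

As long as some entry is fractional, a walk that alternates between rows and columns through
positive entries can continue, because all sums are one; when it returns to a visited row it closes
to a circuit (`Walk.circuit`). Shifting mass along the circuit keeps all row and column sums and
changes the weight linearly, so one of the two directions loses nothing (`weight_shift`). Shifting
until an entry vanishes shrinks the support (`card_support_shift_lt`), so `N * N` rounds suffice for
`N = m + n * m`. No new positive entry ever appears, hence items stay in slots that contained a part
of them.

For the running time, every number that is stored is an integral combination of one, the bar
fractions, the virtual values and the numbers `mult i * value i j`. So all of them lie in a fixed
group of rationals with a common denominator and are bounded in absolute value, and their lengths do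
not grow from round to round (`bitSize_le_of_mem_denGrid`). `CostModel` covers this case and unit
cost on the reals; `Runs` proves correctness and time together, so the program is verified only
once. -/

set_option linter.unusedSectionVars false

namespace BAVWM

/-! ### Memory updates -/

section Memory

variable {K : Type}

/-- Overwrite one entry of a matrix. -/
def upd {α : Type} (f : ℕ → ℕ → α) (i j : ℕ) (v : α) : ℕ → ℕ → α :=
  fun i' j' => if i' = i ∧ j' = j then v else f i' j'

@[simp] theorem upd_self {α : Type} (f : ℕ → ℕ → α) (i j : ℕ) (v : α) : upd f i j v i j = v := by
  simp [upd]

theorem upd_apply {α : Type} (f : ℕ → ℕ → α) (i j : ℕ) (v : α) (i' j' : ℕ) :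
    upd f i j v i' j' = if i' = i ∧ j' = j then v else f i' j' := rfl

@[simp] theorem State.setIdx_num (s : State K) (a i j v : ℕ) : (s.setIdx a i j v).num = s.num := rfl

@[simp] theorem State.setNum_idx (s : State K) (a i j : ℕ) (v : K) :
    (s.setNum a i j v).idx = s.idx := rfl

@[simp] theorem State.setIdx_idx_self (s : State K) (a i j v : ℕ) :
    (s.setIdx a i j v).idx a = upd (s.idx a) i j v := by
  funext i' j'
  simp [State.setIdx, upd]

@[simp] theorem State.setNum_num_self (s : State K) (a i j : ℕ) (v : K) :
    (s.setNum a i j v).num a = upd (s.num a) i j v := by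
  funext i' j'
  simp [State.setNum, upd]

@[simp] theorem State.setIdx_idx_of_ne (s : State K) (a i j v : ℕ) {b : ℕ} (h : b ≠ a) :
    (s.setIdx a i j v).idx b = s.idx b := by
  funext i' j'
  simp [State.setIdx, h]

@[simp] theorem State.setNum_num_of_ne (s : State K) (a i j : ℕ) (v : K) {b : ℕ} (h : b ≠ a) :
    (s.setNum a i j v).num b = s.num b := by
  funext i' j'
  simp [State.setNum, h]

/-- Does the program write to the index array `a`? -/
def Prog.writesIdx (a : ℕ) : Prog → Bool
  | .skip => false
  | .setIdx b _ _ _ => a == b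
  | .setNum _ _ _ _ => false
  | .seq P Q => P.writesIdx a || Q.writesIdx a
  | .branch _ P Q => P.writesIdx a || Q.writesIdx a
  | .loop _ P => P.writesIdx a

/-- Does the program write to the number array `a`? -/
def Prog.writesNum (a : ℕ) : Prog → Bool
  | .skip => false
  | .setIdx _ _ _ _ => false
  | .setNum b _ _ _ => a == b
  | .seq P Q => P.writesNum a || Q.writesNum a
  | .branch _ P Q => P.writesNum a || Q.writesNum a
  | .loop _ P => P.writesNum a

/-- The states agree on all arrays that the program does not write to. -/
structure Agree (P : Prog) (s s' : State K) : Prop where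
  idx : ∀ a, P.writesIdx a = false → s'.idx a = s.idx a
  num : ∀ a, P.writesNum a = false → s'.num a = s.num a

theorem Agree.refl (P : Prog) (s : State K) : Agree P s s := ⟨fun _ _ => rfl, fun _ _ => rfl⟩

theorem Agree.trans {P : Prog} {s₁ s₂ s₃ : State K} (h : Agree P s₁ s₂) (h' : Agree P s₂ s₃) :
    Agree P s₁ s₃ :=
  ⟨fun a ha => (h'.idx a ha).trans (h.idx a ha), fun a ha => (h'.num a ha).trans (h.num a ha)⟩

theorem Agree.of_le {P Q : Prog} {s s' : State K} (h : Agree P s s')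
    (hi : ∀ a, Q.writesIdx a = false → P.writesIdx a = false)
    (hn : ∀ a, Q.writesNum a = false → P.writesNum a = false) : Agree Q s s' :=
  ⟨fun a ha => h.idx a (hi a ha), fun a ha => h.num a (hn a ha)⟩

end Memory

/-! ### Cost bounds for programs -/

/-- Weight of an index expression: its cost and the length of its value are at most the weight
times a bound for the lengths of all memory entries. -/
def IdxExpr.weight : IdxExpr → ℕ
  | .const c => 1 + Nat.size c
  | .load _ i j => i.weight + j.weight + 2
  | .add e f => 2 * e.weight + 2 * f.weight + 2
  | .sub e f => 2 * e.weight + 2 * f.weight + 2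
  | .mul e f => 2 * e.weight + 2 * f.weight + 2

/-- Weight of a number expression, see `IdxExpr.weight`. -/
def NumExpr.weight : NumExpr → ℕ
  | .ofIdx e => 2 * e.weight + 4
  | .load _ i j => i.weight + j.weight + 2
  | .add e f => 3 * e.weight + 3 * f.weight + 4
  | .sub e f => 3 * e.weight + 3 * f.weight + 4
  | .mul e f => 3 * e.weight + 3 * f.weight + 4
  | .div e f => 3 * e.weight + 3 * f.weight + 4

/-- Weight of a test, see `IdxExpr.weight`. -/
def Test.weight : Test → ℕ
  | .idxLe e f => e.weight + f.weight + 1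
  | .numLe e f => e.weight + f.weight + 1
  | .not c => c.weight + 1
  | .and c d => c.weight + d.weight + 1

/-- Bound for the running time of a program, in units of the maximal length of a memory entry, if
every loop in it is iterated at most `L` times. -/
def Prog.bound (L : ℕ) : Prog → ℕ
  | .skip => 1
  | .setIdx _ i j e => i.weight + j.weight + e.weight + 1
  | .setNum _ i j e => i.weight + j.weight + e.weight + 1
  | .seq P Q => P.bound L + Q.bound L + 1
  | .branch c P Q => c.weight + P.bound L + Q.bound L + 1
  | .loop c P => (L + 1) * (c.weight + P.bound L + 1)

/-- Each loop multiplies by `L + 1` and everything else contributes constants, so the nesting depth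
bounds the degree. -/
theorem Prog.exists_polynomial_bound (P : Prog) :
    ∃ p : Polynomial ℕ, ∀ L, P.bound L = p.eval L := by
  induction P with
  | skip => exact ⟨1, by simp [bound]⟩
  | setIdx a i j e => exact ⟨(Polynomial.C (i.weight + j.weight + e.weight + 1)), by simp [bound]⟩
  | setNum a i j e => exact ⟨(Polynomial.C (i.weight + j.weight + e.weight + 1)), by simp [bound]⟩
  | seq P Q hP hQ =>
    obtain ⟨p, hp⟩ := hP
    obtain ⟨q, hq⟩ := hQ
    exact ⟨p + q + 1, by simp [bound, hp, hq]⟩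
  | branch c P Q hP hQ =>
    obtain ⟨p, hp⟩ := hP
    obtain ⟨q, hq⟩ := hQ
    exact ⟨Polynomial.C c.weight + p + q + 1, by simp [bound, hp, hq]⟩
  | loop c P hP =>
    obtain ⟨p, hp⟩ := hP
    exact ⟨(Polynomial.X + 1) * (Polynomial.C c.weight + p + 1), by simp [bound, hp]⟩

/-- The length of numbers grows at most linearly in one operation. -/
structure SizeLaws {K : Type} [Field K] (size : K → ℕ) : Prop where
  natCast : ∀ k : ℕ, size (k : K) ≤ Nat.size k + 3
  add : ∀ a b, size (a + b) ≤ 2 * size a + 2 * size b + 3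
  sub : ∀ a b, size (a - b) ≤ 2 * size a + 2 * size b + 3
  mul : ∀ a b, size (a * b) ≤ 2 * size a + 2 * size b + 3
  div : ∀ a b, size (a / b) ≤ 2 * size a + 2 * size b + 3

/-- Parameters of the cost analysis: a length function, a bound `σ` for the lengths of memory
entries, a bound `L` for the number of iterations of a loop, and a grid whose elements of
absolute value at most `big` have length at most `σ`. -/
structure CostModel (K : Type) [Field K] [LinearOrder K] where
  size : K → ℕ
  σ : ℕ
  L : ℕ
  grid : AddSubgroup K
  big : K
  laws : SizeLaws size
  one_le : 1 ≤ σ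
  L_le : L ≤ σ
  size_le : ∀ q ∈ grid, |q| ≤ big → size q ≤ σ
  one_mem : 1 ∈ grid

variable {K : Type} [Field K] [LinearOrder K]

/-- All memory entries have length at most `κ.σ`. -/
def CostModel.Bounded (κ : CostModel K) (s : State K) : Prop :=
  (∀ a i j, Nat.size (s.idx a i j) ≤ κ.σ) ∧ ∀ a i j, κ.size (s.num a i j) ≤ κ.σ

theorem natSize_le_self (n : ℕ) : Nat.size n ≤ n := Nat.size_le.2 Nat.lt_two_pow_self

theorem natSize_mono {a b : ℕ} (h : a ≤ b) : Nat.size a ≤ Nat.size b := Nat.size_le_size h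

theorem natSize_mul_le (a b : ℕ) : Nat.size (a * b) ≤ Nat.size a + Nat.size b := by
  rcases Nat.eq_zero_or_pos b with rfl | hb
  · simp
  rw [Nat.size_le, pow_add]
  exact Nat.mul_lt_mul_of_lt_of_le (Nat.lt_size_self a) (Nat.lt_size_self b).le (by positivity)

theorem natSize_add_le (a b : ℕ) : Nat.size (a + b) ≤ Nat.size a + Nat.size b + 1 := by
  rw [Nat.size_le, pow_succ, pow_add]
  have ha := Nat.lt_size_self a
  have hb := Nat.lt_size_self b
  have := Nat.one_le_two_pow (n := Nat.size a)
  have := Nat.one_le_two_pow (n := Nat.size b)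
  nlinarith

/-- Cost and length of the value need a joint induction, since an operation is charged the length of
its result. Intermediate values may exceed `κ.σ` in length, but only by a factor that depends on the
expression alone. -/
theorem CostModel.idx_cost_le (κ : CostModel K) {s : State K} (hs : κ.Bounded s) (e : IdxExpr) :
    e.cost s ≤ e.weight * κ.σ ∧ Nat.size (e.eval s) ≤ e.weight * κ.σ := by
  have h1 := κ.one_le
  induction e with
  | const c =>
    simp only [IdxExpr.cost, IdxExpr.eval, IdxExpr.weight]
    constructor <;> nlinarith
  | load a i j hi hj =>
    simp only [IdxExpr.cost, IdxExpr.eval, IdxExpr.weight]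
    have := hs.1 a (i.eval s) (j.eval s)
    constructor <;> nlinarith [hi.1, hj.1]
  | add e f he hf =>
    simp only [IdxExpr.cost, IdxExpr.eval, IdxExpr.weight]
    have := natSize_add_le (e.eval s) (f.eval s)
    constructor <;> nlinarith [he.1, hf.1, he.2, hf.2]
  | sub e f he hf =>
    simp only [IdxExpr.cost, IdxExpr.eval, IdxExpr.weight]
    have := natSize_mono (Nat.sub_le (e.eval s) (f.eval s))
    constructor <;> nlinarith [he.1, hf.1, he.2, hf.2]
  | mul e f he hf =>
    simp only [IdxExpr.cost, IdxExpr.eval, IdxExpr.weight]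
    have := natSize_mul_le (e.eval s) (f.eval s)
    constructor <;> nlinarith [he.1, hf.1, he.2, hf.2]

theorem CostModel.num_cost_le (κ : CostModel K) {s : State K} (hs : κ.Bounded s) (e : NumExpr) :
    e.cost κ.size s ≤ e.weight * κ.σ ∧ κ.size (e.eval s) ≤ e.weight * κ.σ := by
  have h1 := κ.one_le
  induction e with
  | ofIdx e =>
    simp only [NumExpr.cost, NumExpr.eval, NumExpr.weight]
    have := κ.laws.natCast (e.eval s)
    have := κ.idx_cost_le hs e
    constructor <;> nlinarith [this.1, this.2]
  | load a i j =>
    simp only [NumExpr.cost, NumExpr.eval, NumExpr.weight]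
    have := hs.2 a (i.eval s) (j.eval s)
    have hi := κ.idx_cost_le hs i
    have hj := κ.idx_cost_le hs j
    constructor <;> nlinarith [hi.1, hj.1]
  | add e f he hf =>
    simp only [NumExpr.cost, NumExpr.eval, NumExpr.weight]
    have := κ.laws.add (e.eval s) (f.eval s)
    constructor <;> nlinarith [he.1, hf.1, he.2, hf.2]
  | sub e f he hf =>
    simp only [NumExpr.cost, NumExpr.eval, NumExpr.weight]
    have := κ.laws.sub (e.eval s) (f.eval s)
    constructor <;> nlinarith [he.1, hf.1, he.2, hf.2]
  | mul e f he hf =>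
    simp only [NumExpr.cost, NumExpr.eval, NumExpr.weight]
    have := κ.laws.mul (e.eval s) (f.eval s)
    constructor <;> nlinarith [he.1, hf.1, he.2, hf.2]
  | div e f he hf =>
    simp only [NumExpr.cost, NumExpr.eval, NumExpr.weight]
    have := κ.laws.div (e.eval s) (f.eval s)
    constructor <;> nlinarith [he.1, hf.1, he.2, hf.2]

theorem CostModel.test_cost_le (κ : CostModel K) {s : State K} (hs : κ.Bounded s) (c : Test) :
    c.cost κ.size s ≤ c.weight * κ.σ := by
  have h1 := κ.one_le
  induction c with
  | idxLe e f =>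
    simp only [Test.cost, Test.weight]
    nlinarith [(κ.idx_cost_le hs e).1, (κ.idx_cost_le hs f).1]
  | numLe e f =>
    simp only [Test.cost, Test.weight]
    nlinarith [(κ.num_cost_le hs e).1, (κ.num_cost_le hs f).1]
  | not c hc =>
    simp only [Test.cost, Test.weight]
    nlinarith
  | and c d hc hd =>
    simp only [Test.cost, Test.weight]
    nlinarith

/-! ### Total correctness -/

/-- The frame rule. The sets of written arrays are computed from the syntax, so for a concrete
program its side conditions hold by `rfl`. -/
theorem Exec.agree {size : K → ℕ} {P : Prog} {s s' : State K} {t : ℕ} (h : Exec size P s s' t) :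
    Agree P s s' := by
  induction h with
  | skip s => exact Agree.refl _ _
  | setIdx s a i j e =>
    exact ⟨fun b hb => State.setIdx_idx_of_ne _ _ _ _ _ (by simpa [Prog.writesIdx] using hb),
      fun _ _ => rfl⟩
  | setNum s a i j e =>
    exact ⟨fun _ _ => rfl,
      fun b hb => State.setNum_num_of_ne _ _ _ _ _ (by simpa [Prog.writesNum] using hb)⟩
  | seq hP hQ h1 h2 =>
    exact (h1.of_le (by simp +contextual [Prog.writesIdx]) (by simp +contextual [Prog.writesNum])).trans
      (h2.of_le (by simp +contextual [Prog.writesIdx]) (by simp +contextual [Prog.writesNum]))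
  | branch_true hc hP h1 =>
    exact h1.of_le (by simp +contextual [Prog.writesIdx]) (by simp +contextual [Prog.writesNum])
  | branch_false hc hP h1 =>
    exact h1.of_le (by simp +contextual [Prog.writesIdx]) (by simp +contextual [Prog.writesNum])
  | loop_true hc hP hL h1 h2 =>
    exact (h1.of_le (by simp [Prog.writesIdx]) (by simp [Prog.writesNum])).trans h2
  | loop_false hc => exact Agree.refl _ _

/-- Started in `s`, the program halts within the time `P.bound κ.L * κ.σ`, in a state that satisfies
`Q`; and if all entries of `s` have length at most `κ.σ`, then so have those of the final state. -/
def Runs (κ : CostModel K) (P : Prog) (s : State K) (Q : State K → Prop) : Prop :=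
  κ.Bounded s → ∃ s' t, Exec κ.size P s s' t ∧ t ≤ P.bound κ.L * κ.σ ∧ κ.Bounded s' ∧ Q s'

variable {κ : CostModel K} {P P' : Prog} {s : State K} {Q Q' : State K → Prop}

theorem Runs.mono (h : Runs κ P s Q) (hQ : ∀ s', Q s' → Q' s') : Runs κ P s Q' := by
  intro hs
  obtain ⟨s', t, h1, h2, h3, h4⟩ := h hs
  exact ⟨s', t, h1, h2, h3, hQ _ h4⟩

theorem Runs.agree (h : Runs κ P s Q) : Runs κ P s (fun s' => Agree P s s' ∧ Q s') := by
  intro hs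
  obtain ⟨s', t, h1, h2, h3, h4⟩ := h hs
  exact ⟨s', t, h1, h2, h3, h1.agree, h4⟩

theorem Runs.mono_agree (h : Runs κ P s Q) (hQ : ∀ s', Agree P s s' → Q s' → Q' s') :
    Runs κ P s Q' :=
  h.agree.mono fun s' h' => hQ s' h'.1 h'.2

theorem Runs.skip (h : Q s) : Runs κ .skip s Q := by
  intro hs
  refine ⟨s, 1, .skip s, ?_, hs, h⟩
  simpa [Prog.bound] using κ.one_le

/-- Indices are bounded by value and not just by length: all counters of the algorithm are
polynomially small, and a bound on the value is easier to propagate. -/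
theorem Runs.setIdx {a : ℕ} {i j e : IdxExpr} (hv : e.eval s ≤ κ.σ)
    (h : Q (s.setIdx a (i.eval s) (j.eval s) (e.eval s))) : Runs κ (.setIdx a i j e) s Q := by
  intro hs
  refine ⟨_, _, .setIdx s a i j e, ?_, ⟨?_, hs.2⟩, h⟩
  · have := (κ.idx_cost_le hs i).1
    have := (κ.idx_cost_le hs j).1
    have := (κ.idx_cost_le hs e).1
    have := κ.one_le
    simp only [Prog.bound]
    nlinarith
  · intro a' i' j'
    simp only [State.setIdx]
    split
    · exact (natSize_le_self _).trans hv
    · exact hs.1 _ _ _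

theorem Runs.setNum {a : ℕ} {i j : IdxExpr} {e : NumExpr} (hv : κ.size (e.eval s) ≤ κ.σ)
    (h : Q (s.setNum a (i.eval s) (j.eval s) (e.eval s))) : Runs κ (.setNum a i j e) s Q := by
  intro hs
  refine ⟨_, _, .setNum s a i j e, ?_, ⟨hs.1, ?_⟩, h⟩
  · have := (κ.idx_cost_le hs i).1
    have := (κ.idx_cost_le hs j).1
    have := (κ.num_cost_le hs e).1
    have := κ.one_le
    simp only [Prog.bound]
    nlinarith
  · intro a' i' j'
    simp only [State.setNum]
    split
    · exact hv
    · exact hs.2 _ _ _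

theorem Runs.seq (h : Runs κ P s fun s' => Runs κ P' s' Q) : Runs κ (.seq P P') s Q := by
  intro hs
  obtain ⟨s', t, h1, h2, h3, h4⟩ := h hs
  obtain ⟨s'', t', h1', h2', h3', h4'⟩ := h4 h3
  refine ⟨s'', _, .seq h1 h1', ?_, h3', h4'⟩
  have := κ.one_le
  simp only [Prog.bound]
  nlinarith

theorem Runs.branch {c : Test} (h1 : c.Holds s → Runs κ P s Q) (h2 : ¬ c.Holds s → Runs κ P' s Q) :
    Runs κ (.branch c P P') s Q := by
  intro hs
  have := κ.test_cost_le hs c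
  have h0 := κ.one_le
  have hb := Nat.zero_le (P.bound κ.L * κ.σ)
  have hb' := Nat.zero_le (P'.bound κ.L * κ.σ)
  by_cases hc : c.Holds s
  · obtain ⟨s', t, h1, h2, h3, h4⟩ := h1 hc hs
    refine ⟨s', _, .branch_true hc h1, ?_, h3, h4⟩
    simp only [Prog.bound]
    nlinarith
  · obtain ⟨s', t, h1, h2, h3, h4⟩ := h2 hc hs
    refine ⟨s', _, .branch_false hc h1, ?_, h3, h4⟩
    simp only [Prog.bound]
    nlinarith

/-- Rule for while loops; `Inv k` holds after `k` iterations. -/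
theorem Runs.loop {c : Test} (Inv : ℕ → State K → Prop) (h0 : Inv 0 s)
    (hstep : ∀ k s', Agree P s s' → Inv k s' → c.Holds s' → k < κ.L ∧ Runs κ P s' (Inv (k + 1)))
    (hQ : ∀ k s', Agree P s s' → Inv k s' → ¬ c.Holds s' → Q s') : Runs κ (.loop c P) s Q := by
  -- `d` is the number of iterations still allowed. At `d = 0` the test must fail, because `hstep`
  -- would give `k < κ.L`.
  have key : ∀ d k s', k + d = κ.L → Agree P s s' → Inv k s' → κ.Bounded s' →
      ∃ s'' t, Exec κ.size (.loop c P) s' s'' t ∧ t ≤ (d + 1) * (c.weight + P.bound κ.L + 1) * κ.σ ∧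
        κ.Bounded s'' ∧ Q s'' := by
    intro d
    have h1 := κ.one_le
    have hb := Nat.zero_le (P.bound κ.L * κ.σ)
    induction d with
    | zero =>
      intro k s' hk ha hi hs
      by_cases hc : c.Holds s'
      · have := (hstep k s' ha hi hc).1
        omega
      · have := κ.test_cost_le hs c
        refine ⟨s', _, .loop_false hc, ?_, hs, hQ k s' ha hi hc⟩
        nlinarith
    | succ d ih =>
      intro k s' hk ha hi hs
      have := κ.test_cost_le hs c
      by_cases hc : c.Holds s'
      · obtain ⟨s₂, t, h1, h2, h3, h4⟩ := (hstep k s' ha hi hc).2 hs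
        obtain ⟨s₃, u, h1', h2', h3', h4'⟩ := ih (k + 1) s₂ (by omega) (ha.trans h1.agree) h4 h3
        refine ⟨s₃, _, .loop_true hc h1 h1', ?_, h3', h4'⟩
        have e : (d + 1 + 1) * (c.weight + P.bound κ.L + 1) * κ.σ =
          (d + 1) * (c.weight + P.bound κ.L + 1) * κ.σ + (c.weight + P.bound κ.L + 1) * κ.σ := by ring
        rw [e]
        nlinarith
      · refine ⟨s', _, .loop_false hc, ?_, hs, hQ k s' ha hi hc⟩
        have e : (d + 1 + 1) * (c.weight + P.bound κ.L + 1) * κ.σ =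
          (d + 1) * (c.weight + P.bound κ.L + 1) * κ.σ + (c.weight + P.bound κ.L + 1) * κ.σ := by ring
        have := Nat.zero_le ((d + 1) * (c.weight + P.bound κ.L + 1) * κ.σ)
        rw [e]
        nlinarith
  intro hs
  exact key κ.L 0 s (by omega) (Agree.refl _ _) h0 hs

/-- Entry `(0, 0)` of an index array, used as a variable. -/
abbrev IdxExpr.var (a : ℕ) : IdxExpr := .load a (.const 0) (.const 0)

/-- Entry `(0, 0)` of a number array, used as a variable. -/
abbrev NumExpr.var (a : ℕ) : NumExpr := .load a (.const 0) (.const 0)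

/-- Assignment to an index variable. -/
abbrev Prog.letIdx (a : ℕ) (e : IdxExpr) : Prog := .setIdx a (.const 0) (.const 0) e

/-- Assignment to a number variable. -/
abbrev Prog.letNum (a : ℕ) (e : NumExpr) : Prog := .setNum a (.const 0) (.const 0) e

/-- Strict comparison of indices. -/
abbrev Test.idxLt (e f : IdxExpr) : Test := .not (.idxLe f e)

/-- Strict comparison of numbers. -/
abbrev Test.numLt (e f : NumExpr) : Test := .not (.numLe f e)

/-- Inequality of indices. -/
abbrev Test.idxNe (e f : IdxExpr) : Test := .not (.and (.idxLe e f) (.idxLe f e))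

/-- The program that runs `P` for `v = 0, …, e - 1`. -/
def Prog.forLoop (v : ℕ) (e : IdxExpr) (P : Prog) : Prog :=
  .seq (.letIdx v (.const 0)) (.loop (.idxLt (.var v) e)
    (.seq P (.letIdx v (.add (.var v) (.const 1)))))

/-- The counter is reset and incremented outside the body, so `hInv` asks that the invariant ignore
it. The limit `e` is evaluated anew at every test, whence `he` for all states that agree with the
first one. -/
theorem Runs.forLoop {v : ℕ} {e : IdxExpr} {N : ℕ} (Inv : ℕ → State K → Prop) (hN : N ≤ κ.L)
    (hv : P.writesIdx v = false) (hInv : ∀ k s x, Inv k s → Inv k (s.setIdx v 0 0 x))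
    (he : ∀ s', Agree (.forLoop v e P) s s' → e.eval s' = N) (h0 : Inv 0 s)
    (hstep : ∀ k s', k < N → Agree (.forLoop v e P) s s' → s'.idx v 0 0 = k → Inv k s' →
      Runs κ P s' (Inv (k + 1)))
    (hQ : ∀ s', Agree (.forLoop v e P) s s' → Inv N s' → Q s') :
    Runs κ (.forLoop v e P) s Q := by
  refine Runs.seq (Runs.setIdx (by simp [IdxExpr.eval]) ?_)
  have hA : ∀ s', Agree (.seq P (.letIdx v (.add (.var v) (.const 1)))) (s.setIdx v 0 0 0) s' →
      Agree (.forLoop v e P) s s' := by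
    intro s' h
    refine ⟨fun a ha => ?_, fun a ha => ?_⟩
    · have hav : a ≠ v := by
        rintro rfl
        simp [Prog.forLoop, Prog.writesIdx] at ha
      rw [h.idx a (by simpa [Prog.forLoop, Prog.writesIdx, hav] using ha),
        State.setIdx_idx_of_ne _ _ _ _ _ hav]
    · rw [h.num a (by simpa [Prog.forLoop, Prog.writesNum] using ha), State.setIdx_num]
  refine Runs.loop (fun k s' => k ≤ N ∧ s'.idx v 0 0 = k ∧ Inv k s') ?_ ?_ ?_
  · exact ⟨by omega, by simp [IdxExpr.eval], hInv _ _ _ h0⟩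
  · rintro k s' ha ⟨hk, hvk, hI⟩ hc
    have hA' := hA s' ha
    have hkN : k < N := by
      simpa [Test.Holds, IdxExpr.eval, he s' hA', hvk] using hc
    refine ⟨by omega, Runs.seq ((hstep k s' hkN hA' hvk hI).mono_agree ?_)⟩
    intro s₂ ha₂ hI₂
    have hv₂ : s₂.idx v 0 0 = k := by rw [ha₂.idx v hv, hvk]
    have hL := κ.L_le
    refine Runs.setIdx (by simp [IdxExpr.eval, hv₂]; omega) ⟨by omega, ?_, ?_⟩
    · simp [IdxExpr.eval, hv₂]
    · exact hInv _ _ _ hI₂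
  · rintro k s' ha ⟨hk, hvk, hI⟩ hc
    have hA' := hA s' ha
    have hkN : N ≤ k := by
      simpa [Test.Holds, IdxExpr.eval, he s' hA', hvk] using hc
    obtain rfl : k = N := by omega
    exact hQ s' hA' hI

end BAVWM

/-! ### Slots of one bidder and the bound for the load -/

namespace BAVWM

open Finset

section Slots

variable {K : Type} [LinearOrder K]

/-- Item `q` comes before item `j` in the order by decreasing value, with ties broken by index. -/
abbrev Before (v : ℕ → K) (q j : ℕ) : Prop := v j ≤ v q ∧ ¬ (v q ≤ v j ∧ j ≤ q)

theorem Before.trans {v : ℕ → K} {p q j : ℕ} (h : Before v p q) (h' : Before v q j) :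
    Before v p j := by
  refine ⟨h'.1.trans h.1, fun h'' => ?_⟩
  have h1 : v q ≤ v j := h.1.trans h''.1
  have h2 : ¬ j ≤ q := fun h3 => h'.2 ⟨h1, h3⟩
  have h3 : ¬ q ≤ p := fun h3 => h.2 ⟨h''.1.trans h'.1, h3⟩
  omega

theorem Before.irrefl {v : ℕ → K} {j : ℕ} (h : Before v j j) : False := h.2 ⟨h.1, le_rfl⟩

variable [Field K]

/-- Total fraction of the items in `A` that come before item `j`. -/
def prefixSum (x v : ℕ → K) (A : Finset ℕ) (j : ℕ) : K :=
  ∑ q ∈ A, if Before v q j then x q else 0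

/-- Projection to the interval `[s, s + 1]`. -/
def clip (s : ℕ) (t : K) : K := min (max t s) (s + 1)

/-- Fraction of item `j` in slot `s`: item `j` occupies an interval of length `x j` that starts at
the total fraction of the items before it, and slot `s` is the interval `[s, s + 1]`. -/
def slot (x v : ℕ → K) (m s j : ℕ) : K :=
  clip s (prefixSum x v (range m) j + x j) - clip s (prefixSum x v (range m) j)

theorem clip_le (s : ℕ) (t : K) : clip s t ≤ (s : K) + 1 := min_le_right _ _

theorem clip_mono (s : ℕ) {t u : K} (h : t ≤ u) : clip s t ≤ clip s u :=
  min_le_min_right _ (max_le_max_right _ h)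

variable [IsStrictOrderedRing K]

theorem le_clip (s : ℕ) (t : K) : (s : K) ≤ clip s t :=
  le_min (le_max_right _ _) (by linarith)

theorem clip_of_le {s : ℕ} {t : K} (h : t ≤ s) : clip s t = s := by
  rw [clip, max_eq_right h, min_eq_left (by linarith)]

theorem clip_of_ge {s : ℕ} {t : K} (h : (s : K) + 1 ≤ t) : clip s t = s + 1 := by
  rw [clip, max_eq_left (by linarith), min_eq_right h]

/-- `clip s t - s` is the length of the part of `[0, t]` in slot `s`, and the first `k` slots tile
`[0, k]`. -/
theorem sum_clip {t : K} (h : 0 ≤ t) (k : ℕ) :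
    ∑ s ∈ range k, (clip s t - s) = min t k := by
  induction k with
  | zero => simp [h]
  | succ k ih =>
    rw [sum_range_succ, ih, Nat.cast_succ]
    rcases le_total t k with h1 | h1
    · rw [clip_of_le h1, min_eq_left h1, min_eq_left (by linarith)]
      ring
    · rw [min_eq_right h1, clip, max_eq_left h1]
      ring

/-- In sorted order each interval starts where the previous one ends, so the sum telescopes for any
`F`. It is applied to `clip s`. -/
theorem sum_telescope_prefixSum (x v : ℕ → K) (F : K → K) (A : Finset ℕ) :
    ∑ j ∈ A, (F (prefixSum x v A j + x j) - F (prefixSum x v A j)) = F (∑ j ∈ A, x j) - F 0 := by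
  -- This key is increasing along `Before`, so the inserted item is the last one and the prefix sums
  -- of the others do not change.
  induction A using Finset.induction_on_max_value (fun j => toLex (-v j, j)) with
  | empty => simp
  | insert a A ha hmax ih =>
    have hb : ∀ q ∈ A, Before v q a ∧ ¬ Before v a q := by
      intro q hq
      have h := hmax q hq
      have hne : q ≠ a := fun h => ha (h ▸ hq)
      rw [Prod.Lex.toLex_le_toLex] at h
      rcases h with h | ⟨h, h'⟩
      · have h : v a < v q := by simpa using h
        exact ⟨⟨h.le, fun h' => h'.1.not_gt h⟩, fun h' => h'.1.not_gt h⟩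
      · have h : v q = v a := by simpa using h
        have h' : q ≤ a := h'
        exact ⟨⟨h.ge, fun h'' => by omega⟩, fun h'' => h''.2 ⟨h.ge, h'⟩⟩
    rw [sum_insert ha, sum_insert ha]
    have h1 : prefixSum x v (insert a A) a = ∑ j ∈ A, x j := by
      rw [prefixSum, sum_insert ha, if_neg (fun h => h.irrefl), zero_add]
      exact sum_congr rfl fun q hq => if_pos (hb q hq).1
    have h2 : ∀ j ∈ A, prefixSum x v (insert a A) j = prefixSum x v A j := by
      intro j hj
      rw [prefixSum, sum_insert ha, if_neg (hb j hj).2, zero_add, prefixSum]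
    have h3 : ∑ j ∈ A, (F (prefixSum x v (insert a A) j + x j) - F (prefixSum x v (insert a A) j)) =
        ∑ j ∈ A, (F (prefixSum x v A j + x j) - F (prefixSum x v A j)) :=
      sum_congr rfl fun j hj => by rw [h2 j hj]
    rw [h1, h3, ih, add_comm (x a)]
    ring

variable {x v : ℕ → K} {m : ℕ}

theorem prefixSum_nonneg (hx : ∀ j < m, 0 ≤ x j) (j : ℕ) : 0 ≤ prefixSum x v (range m) j :=
  sum_nonneg fun q hq => by
    split
    · exact hx q (mem_range.1 hq)
    · exact le_rfl

theorem prefixSum_add_le (hx : ∀ j < m, 0 ≤ x j) {j : ℕ} (hj : j < m) :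
    prefixSum x v (range m) j + x j ≤ ∑ q ∈ range m, x q := by
  have : ∀ q ∈ range m, (if Before v q j then x q else 0) + (if q = j then x q else 0) ≤ x q := by
    intro q hq
    have := hx q (mem_range.1 hq)
    split_ifs with h1 h2 h2
    · subst h2
      exact h1.irrefl.elim
    all_goals simp [this]
  have h := sum_le_sum this
  rw [sum_add_distrib, sum_ite_eq' (range m) j, if_pos (mem_range.2 hj)] at h
  exact h

theorem prefixSum_add_le_of_before (hx : ∀ j < m, 0 ≤ x j) {j p : ℕ} (hp : p < m)
    (h : Before v p j) :
    prefixSum x v (range m) p + x p ≤ prefixSum x v (range m) j := by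
  have : ∀ q ∈ range m, (if Before v q p then x q else 0) + (if q = p then x q else 0) ≤
      if Before v q j then x q else 0 := by
    intro q hq
    have := hx q (mem_range.1 hq)
    by_cases h2 : q = p
    · subst h2
      rw [if_neg fun h1 : Before v q q => h1.irrefl, if_pos rfl, if_pos h, zero_add]
    · by_cases h1 : Before v q p
      · simp only [if_pos h1, if_neg h2, if_pos (h1.trans h), add_zero, le_refl]
      · simp only [if_neg h1, if_neg h2, add_zero]
        split_ifs <;> simp [this]
  have h := sum_le_sum this
  rw [sum_add_distrib, sum_ite_eq' (range m) p, if_pos (mem_range.2 hp)] at h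
  exact h

theorem slot_nonneg (hx : ∀ j < m, 0 ≤ x j) (s : ℕ) {j : ℕ} (hj : j < m) : 0 ≤ slot x v m s j :=
  sub_nonneg.2 (clip_mono s (by linarith [hx j hj]))

/-- With all fractions at most one the total length is at most `m`, so `m` slots cover every
interval. -/
theorem sum_slot_slots (hx : ∀ j < m, 0 ≤ x j) (hx' : ∀ j < m, x j ≤ 1) {j : ℕ} (hj : j < m) :
    ∑ s ∈ range m, slot x v m s j = x j := by
  have h0 := prefixSum_nonneg (v := v) hx j
  have h1 := prefixSum_add_le (v := v) hx hj
  have h2 : ∑ q ∈ range m, x q ≤ m := by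
    simpa using sum_le_sum fun q hq => hx' q (mem_range.1 hq)
  have h3 := hx j hj
  have : ∀ s ∈ range m, slot x v m s j =
      (clip s (prefixSum x v (range m) j + x j) - s) - (clip s (prefixSum x v (range m) j) - s) :=
    fun s _ => by rw [slot]; ring
  rw [sum_congr rfl this, sum_sub_distrib, sum_clip (by linarith), sum_clip h0,
    min_eq_left (by linarith), min_eq_left (by linarith)]
  ring

theorem sum_slot_items (x v : ℕ → K) (m s : ℕ) :
    ∑ j ∈ range m, slot x v m s j = clip s (∑ j ∈ range m, x j) - s := by
  have := sum_telescope_prefixSum x v (clip s) (range m)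
  rw [clip_of_le (Nat.cast_nonneg s)] at this
  exact this

theorem sum_slot_items_le (x v : ℕ → K) (m s : ℕ) : ∑ j ∈ range m, slot x v m s j ≤ 1 := by
  rw [sum_slot_items]
  linarith [clip_le s (∑ j ∈ range m, x j)]

theorem lt_of_slot_pos {s j : ℕ} (h : 0 < slot x v m s j) :
    (s : K) < prefixSum x v (range m) j + x j := by
  by_contra! h'
  rw [slot, clip_of_le h'] at h
  linarith [le_clip s (prefixSum x v (range m) j)]

theorem prefixSum_lt_of_slot_pos {s j : ℕ} (h : 0 < slot x v m s j) :
    prefixSum x v (range m) j < s + 1 := by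
  by_contra! h'
  rw [slot, clip_of_ge h'] at h
  linarith [clip_le s (prefixSum x v (range m) j + x j)]

/-- If `j'` were worth more, its interval would end before that of `j` begins. But it ends after `s
+ 1`, while that of `j` begins before `s + 1`. -/
theorem value_le_of_slot_pos (hx : ∀ j < m, 0 ≤ x j) {s j j' : ℕ} (hj' : j' < m)
    (h : 0 < slot x v m s j) (h' : 0 < slot x v m (s + 1) j') : v j' ≤ v j := by
  by_contra! hv
  have h1 := prefixSum_add_le_of_before hx hj' (⟨hv.le, fun h => h.1.not_gt hv⟩ : Before v j' j)
  have h2 := lt_of_slot_pos h'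
  have h3 := prefixSum_lt_of_slot_pos h
  push_cast at h2
  linarith

/-- An item that reaches into slot `s + 1` pushes the total length beyond `s + 1`, so slot `s` is
full. -/
theorem sum_slot_items_eq_one (hx : ∀ j < m, 0 ≤ x j) {s j : ℕ} (hj : j < m)
    (h : 0 < slot x v m (s + 1) j) : ∑ j ∈ range m, slot x v m s j = 1 := by
  have h1 := lt_of_slot_pos h
  have h2 := prefixSum_add_le (v := v) hx hj
  push_cast at h1
  rw [sum_slot_items, clip_of_ge (by linarith)]
  ring

/-- An integral assignment of items to slots that fractionally contain them exceeds the fractional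
load by at most the largest value. -/
theorem sum_load_le {b : K} {y : ℕ → ℕ → K} (hx : ∀ j < m, 0 ≤ x j) (hx' : ∀ j < m, x j ≤ 1)
    (hb : 0 ≤ b) (hv : ∀ j < m, 0 ≤ v j) (hv' : ∀ j < m, v j ≤ b)
    (hy : ∀ s < m, ∀ j < m, y s j = 0 ∨ y s j = 1) (hy' : ∀ s < m, ∑ j ∈ range m, y s j ≤ 1)
    (hyz : ∀ s < m, ∀ j < m, 0 < y s j → 0 < slot x v m s j) :
    ∑ j ∈ range m, (∑ s ∈ range m, y s j) * v j ≤ b + ∑ j ∈ range m, x j * v j := by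
  set u : ℕ → K := fun s => ∑ j ∈ range m, slot x v m s j * v j with hu
  have hu0 : ∀ s, 0 ≤ u s := fun s => sum_nonneg fun j hj =>
    mul_nonneg (slot_nonneg hx s (mem_range.1 hj)) (hv j (mem_range.1 hj))
  -- The value of the item in slot `s + 1` is spread over the full slot `s` and compared with each
  -- item there; `u s` is the fractional load of slot `s`.
  have hstep : ∀ s, s + 1 < m → ∑ j ∈ range m, y (s + 1) j * v j ≤ u s := by
    intro s hs
    have h1 : ∀ j ∈ range m, y (s + 1) j * v j ≤ y (s + 1) j * u s := by
      intro j hj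
      have hj := mem_range.1 hj
      rcases hy _ hs j hj with h | h
      · simp [h]
      · have hz := hyz _ hs j hj (by rw [h]; exact one_pos)
        rw [h, one_mul, one_mul, ← one_mul (v j), ← sum_slot_items_eq_one hx hj hz, sum_mul]
        refine sum_le_sum fun q hq => ?_
        have hq := mem_range.1 hq
        rcases (slot_nonneg (v := v) hx s hq).eq_or_lt with h0 | h0
        · simp [← h0]
        · exact mul_le_mul_of_nonneg_left (value_le_of_slot_pos hx hj h0 hz) h0.le
    refine (sum_le_sum h1).trans ?_
    rw [← sum_mul]
    exact mul_le_of_le_one_left (hu0 s) (hy' _ hs)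
  -- Slot 0 has no predecessor to be charged to; this is the source of the factor two.
  have hzero : 0 < m → ∑ j ∈ range m, y 0 j * v j ≤ b := by
    intro hm
    refine (sum_le_sum fun j hj => (?_ : _ ≤ y 0 j * b)).trans ?_
    · refine mul_le_mul_of_nonneg_left (hv' j (mem_range.1 hj)) ?_
      rcases hy 0 hm j (mem_range.1 hj) with h | h <;> simp [h]
    · rw [← sum_mul]
      exact mul_le_of_le_one_left hb (hy' _ hm)
  have hsum : ∑ s ∈ range m, ∑ j ∈ range m, y s j * v j ≤ b + ∑ s ∈ range m, u s := by
    rcases m with _ | k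
    · simpa using hb
    · rw [sum_range_succ', sum_range_succ u]
      have h1 := hzero (Nat.succ_pos k)
      have h2 : ∑ s ∈ range k, ∑ j ∈ range (k + 1), y (s + 1) j * v j ≤ ∑ s ∈ range k, u s :=
        sum_le_sum fun s hs => hstep s (by simpa using hs)
      linarith [hu0 k]
  have hux : ∑ s ∈ range m, u s = ∑ j ∈ range m, x j * v j := by
    rw [sum_comm]
    refine sum_congr rfl fun j hj => ?_
    rw [← sum_mul, sum_slot_slots hx hx' (mem_range.1 hj)]
  rw [← hux]
  refine le_trans (le_of_eq ?_) hsum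
  rw [sum_comm]
  exact sum_congr rfl fun j _ => sum_mul _ _ _

end Slots

end BAVWM

/-! ### Circuits and shifts in doubly stochastic matrices -/

namespace BAVWM

open Finset

section Rounding

variable {K : Type} [Field K] [LinearOrder K]

/-- The leading `N × N` block of the matrix is doubly stochastic. -/
structure DoublyStochastic (N : ℕ) (A : ℕ → ℕ → K) : Prop where
  nonneg : ∀ r < N, ∀ c < N, 0 ≤ A r c
  row : ∀ r < N, ∑ c ∈ range N, A r c = 1
  col : ∀ c < N, ∑ r ∈ range N, A r c = 1

/-- Number of positive entries of the leading `N × N` block. -/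
def support (N : ℕ) (A : ℕ → ℕ → K) : Finset (ℕ × ℕ) :=
  (range N ×ˢ range N).filter fun p => 0 < A p.1 p.2

/-- The total of the entries of `A`, weighted by `C`. -/
def weight (N : ℕ) (C A : ℕ → ℕ → K) : K :=
  ∑ r ∈ range N, ∑ c ∈ range N, C r c * A r c

/-- A circuit through positive entries of `A`: in the distinct rows `R k`, the columns `P k` and
`Q k`, such that every column occurs as often among the `P k` as among the `Q k`. -/
structure Circuit (N : ℕ) (A : ℕ → ℕ → K) (l : ℕ) (R P Q : ℕ → ℕ) : Prop where
  row_lt : ∀ k < l, R k < N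
  fst_lt : ∀ k < l, P k < N
  snd_lt : ∀ k < l, Q k < N
  inj : ∀ k < l, ∀ k' < l, R k = R k' → k = k'
  fst_pos : ∀ k < l, 0 < A (R k) (P k)
  snd_pos : ∀ k < l, 0 < A (R k) (Q k)
  balance : ∀ c, ∑ k ∈ range l, (if c = P k then (1 : K) else 0) =
    ∑ k ∈ range l, (if c = Q k then (1 : K) else 0)
  exists_ne : ∃ k < l, P k ≠ Q k

/-- Shift `t` from the entries `(R k, Q k)` to the entries `(R k, P k)`. -/
def shift (A : ℕ → ℕ → K) (t : K) (R P Q : ℕ → ℕ) (l : ℕ) (r c : ℕ) : K :=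
  A r c + t * ∑ k ∈ range l,
    if r = R k then (if c = P k then (1 : K) else 0) - (if c = Q k then 1 else 0) else 0

/-- Positivity is required on both sides exactly so that a circuit can be used in either direction.
-/
theorem Circuit.swap {N : ℕ} {A : ℕ → ℕ → K} {l : ℕ} {R P Q : ℕ → ℕ} (h : Circuit N A l R P Q) :
    Circuit N A l R Q P :=
  ⟨h.row_lt, h.snd_lt, h.fst_lt, h.inj, h.snd_pos, h.fst_pos, fun c => (h.balance c).symm,
    h.exists_ne.imp fun _ hk => ⟨hk.1, hk.2.symm⟩⟩

variable {N : ℕ} {A C : ℕ → ℕ → K} {l : ℕ} {R P Q : ℕ → ℕ} {t : K}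

theorem shift_row (h : Circuit N A l R P Q) {k : ℕ} (hk : k < l) (c : ℕ) :
    shift A t R P Q l (R k) c =
      A (R k) c + t * ((if c = P k then (1 : K) else 0) - (if c = Q k then 1 else 0)) := by
  rw [shift, sum_eq_single k]
  · rw [if_pos rfl]
  · intro k' hk' hne
    exact if_neg fun h' => hne (h.inj k hk k' (mem_range.1 hk') h').symm
  · intro h'
    exact absurd (mem_range.2 hk) h'

theorem shift_of_forall_ne {r : ℕ} (h : ∀ k < l, r ≠ R k) (c : ℕ) :
    shift A t R P Q l r c = A r c := by
  rw [shift, sum_eq_zero fun k hk => if_neg (h k (mem_range.1 hk)), mul_zero, add_zero]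

theorem shift_succ (A : ℕ → ℕ → K) (t : K) (R P Q : ℕ → ℕ) (l r c : ℕ) :
    shift A t R P Q (l + 1) r c = shift A t R P Q l r c +
      t * if r = R l then (if c = P l then (1 : K) else 0) - (if c = Q l then 1 else 0) else 0 := by
  rw [shift, shift, sum_range_succ]
  ring

theorem shift_eq_zero (h : Circuit N A l R P Q) {k : ℕ} (hk : k < l) (hne : P k ≠ Q k) :
    shift A (A (R k) (Q k)) R P Q l (R k) (Q k) = 0 := by
  rw [shift_row h hk, if_neg hne.symm, if_pos rfl]
  ring

/-- The change is linear in `t` with a slope that `Circuit.swap` negates, so one of the two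
directions does not lose weight. -/
theorem weight_shift (h : Circuit N A l R P Q) :
    weight N C (shift A t R P Q l) =
      weight N C A + t * ∑ k ∈ range l, (C (R k) (P k) - C (R k) (Q k)) := by
  have h1 : ∀ r c, C r c * shift A t R P Q l r c = C r c * A r c + t * ∑ k ∈ range l,
      if r = R k then C r c * ((if c = P k then (1 : K) else 0) - (if c = Q k then 1 else 0))
        else 0 := by
    intro r c
    have : ∀ k ∈ range l,
        (if r = R k then C r c * ((if c = P k then (1 : K) else 0) - (if c = Q k then 1 else 0))
          else 0) =
        C r c * if r = R k then (if c = P k then (1 : K) else 0) - (if c = Q k then 1 else 0)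
          else 0 := fun k _ => by split_ifs <;> simp
    rw [sum_congr rfl this, ← mul_sum, shift]
    ring
  simp only [weight, h1, sum_add_distrib, ← mul_sum]
  congr 2
  rw [sum_congr rfl fun r _ => sum_comm, sum_comm]
  refine sum_congr rfl fun k hk => ?_
  have hk := mem_range.1 hk
  rw [sum_comm]
  simp only [sum_ite_eq', mem_range, h.row_lt k hk, if_true]
  simp only [mul_sub, sum_sub_distrib, mul_ite, mul_one, mul_zero, sum_ite_eq', mem_range,
    h.fst_lt k hk, h.snd_lt k hk, if_true]

variable [IsStrictOrderedRing K]

theorem DoublyStochastic.le_one (h : DoublyStochastic N A) {r c : ℕ} (hr : r < N) (hc : c < N) :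
    A r c ≤ 1 := by
  rw [← h.row r hr]
  exact single_le_sum (f := A r) (fun c hc => h.nonneg r hr c (mem_range.1 hc)) (mem_range.2 hc)

theorem DoublyStochastic.transpose (h : DoublyStochastic N A) :
    DoublyStochastic N fun r c => A c r :=
  ⟨fun r hr c hc => h.nonneg c hc r hr, h.col, h.row⟩

theorem DoublyStochastic.add_le_one (h : DoublyStochastic N A) {r c c' : ℕ} (hr : r < N)
    (hc : c < N) (hc' : c' < N) (hne : c' ≠ c) : A r c + A r c' ≤ 1 := by
  rw [← h.row r hr, ← sum_pair (f := A r) hne.symm]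
  refine sum_le_sum_of_subset_of_nonneg ?_ fun q hq _ => h.nonneg r hr q (mem_range.1 hq)
  intro q hq
  rcases mem_insert.1 hq with rfl | hq
  · exact mem_range.2 hc
  · rw [mem_singleton.1 hq]
    exact mem_range.2 hc'

theorem DoublyStochastic.exists_col_ne (h : DoublyStochastic N A) {r c : ℕ} (hr : r < N)
    (hc : c < N) (h1 : A r c < 1) : ∃ c' < N, c' ≠ c ∧ 0 < A r c' := by
  by_contra! h'
  have := h.row r hr
  rw [sum_eq_single c] at this
  · exact h1.ne this
  · intro c' hc' hne
    exact le_antisymm (h' c' (mem_range.1 hc') hne) (h.nonneg r hr c' (mem_range.1 hc'))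
  · intro h'
    exact absurd (mem_range.2 hc) h'

theorem DoublyStochastic.exists_row_ne (h : DoublyStochastic N A) {r c : ℕ} (hr : r < N)
    (hc : c < N) (h1 : A r c < 1) : ∃ r' < N, r' ≠ r ∧ 0 < A r' c :=
  h.transpose.exists_col_ne hc hr h1

/-- In a row the gain and the loss cancel; in a column they cancel by `balance`. The rows are
distinct, so an entry loses `t` at most once, and where `P k = Q k` nothing changes, so no bound is
needed there. -/
theorem DoublyStochastic.shift (hA : DoublyStochastic N A) (h : Circuit N A l R P Q) (ht : 0 ≤ t)
    (ht' : ∀ k < l, P k ≠ Q k → t ≤ A (R k) (Q k)) : DoublyStochastic N (shift A t R P Q l) := by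
  refine ⟨fun r hr c hc => ?_, fun r hr => ?_, fun c hc => ?_⟩
  · by_cases hk : ∃ k < l, r = R k
    · obtain ⟨k, hk, rfl⟩ := hk
      have := hA.nonneg _ hr c hc
      have ht' := ht' k hk
      rw [shift_row h hk]
      split_ifs with h1 h2 h2
      · simpa
      · simp only [sub_zero, mul_one]
        linarith
      · subst h2
        have := ht' fun h => h1 h.symm
        linarith
      · simpa
    · push Not at hk
      rw [shift_of_forall_ne hk]
      exact hA.nonneg r hr c hc
  · simp only [BAVWM.shift, sum_add_distrib, hA.row r hr, ← mul_sum]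
    rw [sum_comm, sum_eq_zero, mul_zero, add_zero]
    intro k hk
    have hk := mem_range.1 hk
    split_ifs with h1
    · simp [sum_sub_distrib, h.fst_lt k hk, h.snd_lt k hk]
    · simp
  · simp only [BAVWM.shift, sum_add_distrib, hA.col c hc, ← mul_sum]
    rw [sum_comm]
    have : ∀ k ∈ range l, ∑ r ∈ range N, (if r = R k then
        (if c = P k then (1 : K) else 0) - (if c = Q k then 1 else 0) else 0) =
        (if c = P k then (1 : K) else 0) - (if c = Q k then 1 else 0) := by
      intro k hk
      rw [sum_ite_eq', if_pos (mem_range.2 (h.row_lt k (mem_range.1 hk)))]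
    rw [sum_congr rfl this, sum_sub_distrib, h.balance c, sub_self, mul_zero, add_zero]

/-- Only entries `(R k, P k)` can grow, and these are positive already. -/
theorem pos_of_shift_pos (h : Circuit N A l R P Q) (ht : 0 ≤ t) {r c : ℕ} (h' : 0 < shift A t R P Q l r c) : 0 < A r c := by
  by_cases hk : ∃ k < l, r = R k
  · obtain ⟨k, hk, rfl⟩ := hk
    rw [shift_row h hk] at h'
    by_cases h1 : c = P k
    · rw [h1]
      exact h.fst_pos k hk
    · rw [if_neg h1] at h'
      split_ifs at h' <;> linarith
  · push Not at hk
    rwa [shift_of_forall_ne hk] at h'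

theorem support_shift_subset (h : Circuit N A l R P Q) (ht : 0 ≤ t) :
    support N (shift A t R P Q l) ⊆ support N A := by
  intro p hp
  simp only [support, mem_filter, mem_product, mem_range] at hp ⊢
  exact ⟨hp.1, pos_of_shift_pos h ht hp.2⟩

/-- The shift by the entry `(R k, Q k)` itself removes that entry and creates no other. This is the
progress measure of the rounding. -/
theorem card_support_shift_lt (h : Circuit N A l R P Q) {k : ℕ}
    (hk : k < l) (hne : P k ≠ Q k) :
    (support N (shift A (A (R k) (Q k)) R P Q l)).card < (support N A).card := by
  have h0 := h.snd_pos k hk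
  refine card_lt_card ⟨support_shift_subset h h0.le, fun h' => ?_⟩
  have hmem : (R k, Q k) ∈ support N A := by
    simpa [support, h.row_lt k hk, h.snd_lt k hk] using h0
  have := h' hmem
  simp [support, shift_eq_zero h hk hne] at this

/-- The entries of the leading block are integral. -/
def Integral (N : ℕ) (A : ℕ → ℕ → K) : Prop := ∀ r < N, ∀ c < N, A r c = 0 ∨ A r c = 1

/-- Limits the number of rounds: the support cannot shrink to nothing while row sums are one. -/
theorem DoublyStochastic.support_nonempty (hA : DoublyStochastic N A) {r : ℕ} (hr : r < N) :
    (support N A).Nonempty := by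
  by_contra! h
  have h1 := hA.row r hr
  rw [sum_eq_zero] at h1
  · exact zero_ne_one h1
  intro c hc
  by_contra hne
  have hpos := (hA.nonneg r hr c (mem_range.1 hc)).lt_of_ne' hne
  have : (r, c) ∈ support N A := by simp [support, hr, mem_range.1 hc, hpos]
  simp [h] at this

end Rounding

/-! ### Walks through the positive entries -/

section Walk

variable {K : Type} [Field K] [LinearOrder K]

/-- A walk of `k` steps through positive entries of `A` that visits distinct rows `R 0, …, R (k - 1)`
and arrives at `(r, c)`. Row `R i` is entered in column `I i` and left in column `O i`; the number
`T r` is zero for unvisited rows, and one plus the time of the visit for the others. -/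
structure Walk (N : ℕ) (A : ℕ → ℕ → K) (k r c : ℕ) (R O I T : ℕ → ℕ) : Prop where
  row_lt : r < N
  col_lt : c < N
  pos : 0 < A r c
  lt_one : A r c < 1
  rows_lt : ∀ i < k, R i < N
  out_lt : ∀ i < k, O i < N
  in_lt : ∀ i < k, I i < N
  ne : ∀ i < k, O i ≠ I i
  out_pos : ∀ i < k, 0 < A (R i) (O i)
  in_pos : ∀ i < k, 0 < A (R i) (I i)
  time : ∀ i < k, T (R i) = i + 1
  visited : ∀ q, T q ≠ 0 → T q ≤ k ∧ R (T q - 1) = q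
  step : ∀ i, i + 1 < k → I (i + 1) = O i
  last : ∀ i, i + 1 = k → c = O i ∧ r ≠ R i

variable {N : ℕ} {A : ℕ → ℕ → K} {k r c : ℕ} {R O I T : ℕ → ℕ}

theorem Walk.start {r c : ℕ} (hr : r < N) (hc : c < N) (h0 : 0 < A r c) (h1 : A r c < 1)
    (hT : ∀ q, T q = 0) : Walk N A 0 r c R O I T where
  row_lt := hr
  col_lt := hc
  pos := h0
  lt_one := h1
  rows_lt := by simp
  out_lt := by simp
  in_lt := by simp
  ne := by simp
  out_pos := by simp
  in_pos := by simp
  time := by simp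
  visited := fun q hq => absurd (hT q) hq
  step := by simp
  last := by simp

theorem Walk.injOn (h : Walk N A k r c R O I T) {i i' : ℕ} (hi : i < k) (hi' : i' < k)
    (he : R i = R i') : i = i' := by
  have h1 := h.time i hi
  have h2 := h.time i' hi'
  rw [he] at h1
  omega

/-- The visited rows are distinct. This bounds the number of iterations of the walk. -/
theorem Walk.le (h : Walk N A k r c R O I T) : k ≤ N := by
  have := card_le_card_of_injOn (s := range k) (t := range N) R
    (fun i hi => by simpa using h.rows_lt i (by simpa using hi))
    (fun i hi i' hi' he => h.injOn (by simpa using hi) (by simpa using hi') he)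
  simpa using this

/-- One step leaves row `r` in another column `c'` and enters another row `r'` there. The primed
functions are the arrays after the step, of which only the values at the new time and row are
prescribed beyond the old ones. -/
theorem Walk.next [IsStrictOrderedRing K] (hA : DoublyStochastic N A) (h : Walk N A k r c R O I T)
    (hr : T r = 0) {R' O' I' T' : ℕ → ℕ} {r' c' : ℕ} (hR : ∀ i < k, R' i = R i)
    (hO : ∀ i < k, O' i = O i) (hI : ∀ i < k, I' i = I i) (hRk : R' k = r) (hOk : O' k = c')
    (hIk : I' k = c) (hTr : T' r = k + 1) (hT : ∀ q, q ≠ r → T' q = T q)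
    (hc' : c' < N) (hcc : c' ≠ c) (hrc : 0 < A r c') (hr' : r' < N) (hrr : r' ≠ r)
    (hrc' : 0 < A r' c') : Walk N A (k + 1) r' c' R' O' I' T' where
  row_lt := hr'
  col_lt := hc'
  pos := hrc'
  -- Column `c'` sums to one and is positive in the two rows `r` and `r'`, so the new entry is again
  -- fractional.
  lt_one := by
    have := hA.transpose.add_le_one hc' h.row_lt hr' hrr
    linarith
  rows_lt i hi := by
    rcases Nat.lt_succ_iff_lt_or_eq.1 hi with hi | rfl
    · rw [hR i hi]
      exact h.rows_lt i hi
    · rw [hRk]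
      exact h.row_lt
  out_lt i hi := by
    rcases Nat.lt_succ_iff_lt_or_eq.1 hi with hi | rfl
    · rw [hO i hi]
      exact h.out_lt i hi
    · rwa [hOk]
  in_lt i hi := by
    rcases Nat.lt_succ_iff_lt_or_eq.1 hi with hi | rfl
    · rw [hI i hi]
      exact h.in_lt i hi
    · rw [hIk]
      exact h.col_lt
  ne i hi := by
    rcases Nat.lt_succ_iff_lt_or_eq.1 hi with hi | rfl
    · rw [hI i hi, hO i hi]
      exact h.ne i hi
    · rwa [hIk, hOk]
  out_pos i hi := by
    rcases Nat.lt_succ_iff_lt_or_eq.1 hi with hi | rfl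
    · rw [hR i hi, hO i hi]
      exact h.out_pos i hi
    · rwa [hRk, hOk]
  in_pos i hi := by
    rcases Nat.lt_succ_iff_lt_or_eq.1 hi with hi | rfl
    · rw [hR i hi, hI i hi]
      exact h.in_pos i hi
    · rw [hRk, hIk]
      exact h.pos
  time i hi := by
    rcases Nat.lt_succ_iff_lt_or_eq.1 hi with hi | rfl
    · have h1 := h.time i hi
      rw [hR i hi, hT _ fun h' => by rw [h', hr] at h1; omega, h1]
    · rw [hRk, hTr]
  visited q hq := by
    by_cases hqr : q = r
    · rw [hqr, hTr]
      exact ⟨le_rfl, hRk⟩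
    · rw [hT q hqr] at hq ⊢
      obtain ⟨h1, h2⟩ := h.visited q hq
      exact ⟨by omega, by rw [hR _ (by omega), h2]⟩
  step i hi := by
    rw [hO i (by omega)]
    rcases Nat.lt_succ_iff_lt_or_eq.1 hi with hi | hi
    · rw [hI _ hi, h.step i hi]
    · rw [hi, hIk]
      exact (h.last i hi).1
  last i hi := by
    obtain rfl : i = k := by omega
    rw [hOk, hRk]
    exact ⟨rfl, hrr⟩

/-- A walk that returns to a visited row closes to a circuit. -/
theorem Walk.circuit (h : Walk N A k r c R O I T) {a : ℕ} (ha : T r = a + 1) {I' : ℕ → ℕ}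
    (hI : ∀ i, i ≠ a → I' i = I i) (hIa : I' a = c) :
    Circuit N A (k - a) (fun i => R (a + i)) (fun i => O (a + i)) (fun i => I' (a + i)) := by
  obtain ⟨h1, h2⟩ := h.visited r (by omega)
  rw [ha] at h1 h2
  rw [Nat.add_sub_cancel] at h2
  -- The last step moved to a different row, so the row returned to is not the last visited one and
  -- the circuit has at least two rows.
  have hk : a + 1 < k := by
    rcases h1.eq_or_lt with h1 | h1
    · exact absurd h2.symm (h.last a h1).2
    · exact h1
  have hI' : ∀ i < k, I' i < N ∧ 0 < A (R i) (I' i) := by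
    intro i hi
    by_cases hia : i = a
    · rw [hia, hIa, h2]
      exact ⟨h.col_lt, h.pos⟩
    · rw [hI i hia]
      exact ⟨h.in_lt i hi, h.in_pos i hi⟩
  refine ⟨fun i hi => h.rows_lt _ (by omega), fun i hi => h.out_lt _ (by omega),
    fun i hi => (hI' _ (by omega)).1, fun i hi i' hi' he => ?_,
    fun i hi => h.out_pos _ (by omega), fun i hi => (hI' _ (by omega)).2, fun q => ?_,
    ⟨1, by omega, ?_⟩⟩
  · have := h.injOn (by omega) (by omega) he
    omega
  -- Each row is entered in the column in which its predecessor was left, and the first one now in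
  -- the column in which the last was left. So the two sums differ by a cyclic rotation.
  · obtain ⟨l, rfl⟩ : ∃ l, k = a + l + 1 := ⟨k - a - 1, by omega⟩
    rw [show a + l + 1 - a = l + 1 by omega, sum_range_succ, sum_range_succ', add_zero, hIa,
      (h.last (a + l) rfl).1]
    congr 1
    refine sum_congr rfl fun i hi => ?_
    have hi := mem_range.1 hi
    rw [hI _ (by omega), ← add_assoc, h.step _ (by omega)]
  -- The witness is the second row of the circuit: the first has a new entering column `c`, which
  -- may equal its leaving column.
  · rw [hI _ (by omega)]
    exact h.ne _ hk

end Walk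

end BAVWM

namespace BAVWM

open Finset

/-! ### The rounding program -/

/-- Search for an index `v < e` that passes the test, and store it in the variable `w`. -/
def Prog.search (v w : ℕ) (e : IdxExpr) (c : Test) : Prog :=
  .forLoop v e (.branch c (.letIdx w (.var v)) .skip)

namespace Algorithm

/-- Entry of the matrix that is being rounded. -/
abbrev mat (i j : IdxExpr) : NumExpr := .load 6 i j

/-- Entry of the weight matrix. -/
abbrev wt (i j : IdxExpr) : NumExpr := .load 7 i j

/-- A natural number as a number expression. -/
abbrev lit (k : ℕ) : NumExpr := .ofIdx (.const k)

/-- Find a fractional entry. -/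
def findFractional : Prog :=
  .seq (.letIdx 21 (.const 0)) <|
  .forLoop 26 (.var 10) <| .forLoop 27 (.var 10) <|
    .branch (.and (.numLt (lit 0) (mat (.var 26) (.var 27)))
        (.numLt (mat (.var 26) (.var 27)) (lit 1)))
      (.seq (.letIdx 21 (.const 1)) (.seq (.letIdx 22 (.var 26)) (.letIdx 23 (.var 27)))) .skip

/-- One step of the walk. -/
def walkStep : Prog :=
  .seq (.setIdx 5 (.var 20) (.var 22) (.add (.var 24) (.const 1))) <|
  .seq (.setIdx 6 (.var 24) (.const 0) (.var 22)) <|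
  .seq (.setIdx 7 (.const 1) (.var 24) (.var 23)) <|
  .seq (.search 26 25 (.var 10)
    (.and (.numLt (lit 0) (mat (.var 22) (.var 26))) (.idxNe (.var 26) (.var 23)))) <|
  .seq (.setIdx 7 (.const 0) (.var 24) (.var 25)) <|
  .seq (.letIdx 23 (.var 25)) <|
  .seq (.search 26 25 (.var 10)
    (.and (.numLt (lit 0) (mat (.var 26) (.var 23))) (.idxNe (.var 26) (.var 22)))) <|
  .seq (.letIdx 22 (.var 25)) (.letIdx 24 (.add (.var 24) (.const 1)))

/-- Walk until a row is visited for the second time, and close the circuit. -/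
def findCircuit : Prog :=
  .seq (.letIdx 24 (.const 0)) <|
  .seq (.loop (.idxLe (.load 5 (.var 20) (.var 22)) (.const 0)) walkStep) <|
  .seq (.letIdx 28 (.sub (.load 5 (.var 20) (.var 22)) (.const 1))) <|
  .seq (.setIdx 7 (.const 1) (.var 28) (.var 23)) <|
    .letIdx 24 (.sub (.var 24) (.var 28))

/-- Row number `k` of the circuit, where `k` is the value of variable `26`. -/
abbrev rowOf : IdxExpr := .load 6 (.add (.var 28) (.var 26)) (.const 0)

/-- Column number `k` of the circuit on side `d`, where `k` is the value of variable `26`. -/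
abbrev colOf (d : IdxExpr) : IdxExpr := .load 7 d (.add (.var 28) (.var 26))

/-- Determine the direction of the shift. -/
def findDirection : Prog :=
  .seq (.letNum 12 (lit 0)) <|
  .seq (.forLoop 26 (.var 24) (.letNum 12 (.add (.var 12)
    (.sub (wt rowOf (colOf (.const 0))) (wt rowOf (colOf (.const 1))))))) <|
    .branch (.numLe (lit 0) (.var 12)) (.letIdx 29 (.const 0)) (.letIdx 29 (.const 1))

/-- The column that gains. -/
abbrev gainCol : IdxExpr := colOf (.var 29)

/-- The column that loses. -/
abbrev loseCol : IdxExpr := colOf (.sub (.const 1) (.var 29))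

/-- Determine the amount of the shift. -/
def findAmount : Prog :=
  .seq (.letNum 13 (lit 1)) <| .forLoop 26 (.var 24) <|
    .branch (.and (.idxNe gainCol loseCol) (.numLe (mat rowOf loseCol) (.var 13)))
      (.letNum 13 (mat rowOf loseCol)) .skip

/-- Shift along the circuit. -/
def applyShift : Prog :=
  .forLoop 26 (.var 24) <|
  .seq (.setNum 6 rowOf gainCol (.add (mat rowOf gainCol) (.var 13)))
    (.setNum 6 rowOf loseCol (.sub (mat rowOf loseCol) (.var 13)))

/-- One step of the rounding. -/
def roundStep : Prog :=
  .seq findFractional <|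
  .branch (.idxLe (.const 1) (.var 21))
    (.seq findCircuit (.seq findDirection (.seq findAmount applyShift))) .skip

/-- Rounding of a doubly stochastic matrix to a permutation matrix. -/
def roundAll : Prog := .forLoop 20 (.mul (.var 10) (.var 10)) roundStep

end Algorithm

variable {K : Type} [Field K] [LinearOrder K] {κ : CostModel K} {s : State K}

/-- The loop runs to its end and keeps the last hit. The invariant is conditional on a hit so far,
hence says nothing about the initial content of `w`. -/
theorem Runs.search {v w : ℕ} {e : IdxExpr} {c : Test} {N : ℕ} (p : ℕ → Prop) (hN : N ≤ κ.L)
    (hvw : v ≠ w)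
    (he : ∀ s', Agree (.search v w e c) s s' → e.eval s' = N)
    (hc : ∀ s', Agree (.search v w e c) s s' → (c.Holds s' ↔ p (s'.idx v 0 0)))
    (hp : ∃ q < N, p q) :
    Runs κ (.search v w e c) s fun s' => s'.idx w 0 0 < N ∧ p (s'.idx w 0 0) := by
  refine Runs.forLoop (N := N)
    (fun k s' => (∃ q < k, p q) → s'.idx w 0 0 < N ∧ p (s'.idx w 0 0)) hN ?_ ?_ he ?_ ?_ ?_
  · simp [Prog.writesIdx, hvw]
  · intro k s' x h
    simpa [hvw.symm] using h
  · simp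
  · intro k s' hk ha hvk hI
    have hL := κ.L_le
    refine Runs.branch (fun h => Runs.setIdx ?_ ?_) (fun h => Runs.skip ?_)
    · simp [IdxExpr.eval, hvk]
      omega
    · rintro -
      rw [hc s' ha, hvk] at h
      simp [IdxExpr.eval, hvk, hk, h]
    · rintro ⟨q, hq, hpq⟩
      rw [hc s' ha, hvk] at h
      rcases Nat.lt_succ_iff_lt_or_eq.1 hq with hq | rfl
      · exact hI ⟨q, hq, hpq⟩
      · exact absurd hpq h
  · intro s' _ h
    exact h hp

namespace Algorithm

/-- Entry `(r, c)` is fractional. -/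
def Fractional (A : ℕ → ℕ → K) (r c : ℕ) : Prop := 0 < A r c ∧ A r c < 1

theorem runs_findFractional {N : ℕ} (hN : N ≤ κ.L) (h1 : 1 ≤ κ.σ) (hs : s.idx 10 0 0 = N) :
    Runs κ findFractional s fun s' =>
      (s'.idx 21 0 0 = 0 ∧ ∀ r < N, ∀ c < N, ¬ Fractional (s.num 6) r c) ∨
      (s'.idx 21 0 0 = 1 ∧ s'.idx 22 0 0 < N ∧ s'.idx 23 0 0 < N ∧
        Fractional (s.num 6) (s'.idx 22 0 0) (s'.idx 23 0 0)) := by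
  have hL := κ.L_le
  -- Entries before `(k, l)` in lexicographic order have been inspected. A later find overwrites an
  -- earlier one, which preserves the second alternative.
  let Inv (k l : ℕ) (s' : State K) : Prop :=
      (s'.idx 21 0 0 = 0 ∧ ∀ r < N, ∀ c < N, r < k ∨ (r = k ∧ c < l) → ¬ Fractional (s.num 6) r c) ∨
      (s'.idx 21 0 0 = 1 ∧ s'.idx 22 0 0 < N ∧ s'.idx 23 0 0 < N ∧
        Fractional (s.num 6) (s'.idx 22 0 0) (s'.idx 23 0 0))
  refine Runs.seq (Runs.setIdx (by simp [IdxExpr.eval]) ?_)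
  refine Runs.forLoop (N := N) (fun k => Inv k 0) hN rfl ?_ ?_ ?_ ?_ ?_
  · intro k s' x h
    simpa [Inv] using h
  · intro s' h
    simp [IdxExpr.eval, h.idx 10 rfl, hs]
  · simp [Inv, IdxExpr.eval]
  · intro k s₁ hk ha hvk hI
    refine Runs.forLoop (N := N) (fun l => Inv k l) hN rfl ?_ ?_ hI ?_ ?_
    · intro k s' x h
      simpa [Inv] using h
    · intro s' h
      simp [IdxExpr.eval, h.idx 10 rfl, ha.idx 10 rfl, hs]
    · intro l s₂ hl ha₂ hvl hI₂
      have e6 : s₂.num 6 = s.num 6 := by rw [ha₂.num 6 rfl, ha.num 6 rfl]; rfl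
      have e26 : s₂.idx 26 0 0 = k := by rw [ha₂.idx 26 rfl, hvk]
      refine Runs.branch (fun h => ?_) (fun h => Runs.skip ?_)
      · refine Runs.seq (Runs.setIdx ?_ (Runs.seq (Runs.setIdx ?_ (Runs.setIdx ?_ (Or.inr ?_)))))
        · simpa [IdxExpr.eval]
        · simp [IdxExpr.eval, e26]
          omega
        · simp [IdxExpr.eval, hvl]
          omega
        · simpa [Test.Holds, NumExpr.eval, IdxExpr.eval, e6, e26, hvl, hk, hl, Fractional] using h
      · rcases hI₂ with ⟨h0, hI₂⟩ | hI₂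
        · refine Or.inl ⟨h0, fun r hr c hc hrc => ?_⟩
          by_cases hrc' : r = k ∧ c = l
          · rw [hrc'.1, hrc'.2]
            simpa [Test.Holds, NumExpr.eval, IdxExpr.eval, e6, e26, hvl, hk, hl, Fractional] using h
          · exact hI₂ r hr c hc (by omega)
        · exact Or.inr hI₂
    · rintro s' - (⟨h0, h⟩ | h)
      · refine Or.inl ⟨h0, fun r hr c hc hrc => h r hr c hc (by omega)⟩
      · exact Or.inr h
  · rintro s' - (⟨h0, h⟩ | h)
    · exact Or.inl ⟨h0, fun r hr c hc => h r hr c hc (by omega)⟩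
    · exact Or.inr h

end Algorithm

end BAVWM

/-! ### Verification of the walk, the circuit and the shift -/

namespace BAVWM

open Finset

namespace Algorithm

variable {K : Type} [Field K] [LinearOrder K] {κ : CostModel K} {s : State K}

/-- The memory holds a walk of `k` steps through the matrix `A`, with visiting times in row `it` of
index array `5`. -/
def HoldsWalk (N : ℕ) (A : ℕ → ℕ → K) (it k : ℕ) (s : State K) : Prop :=
  s.idx 24 0 0 = k ∧ Walk N A k (s.idx 22 0 0) (s.idx 23 0 0) (fun i => s.idx 6 i 0)
    (fun i => s.idx 7 0 i) (fun i => s.idx 7 1 i) (s.idx 5 it)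

variable [IsStrictOrderedRing K]

/-- Every round `it` uses its own row of index array `5` for the visiting times, so old marks need
not be erased; therefore the other rows must be shown to be untouched. -/
theorem runs_walkStep {N it k : ℕ} {A : ℕ → ℕ → K} (hA : DoublyStochastic N A) (hN : N + 1 ≤ κ.L)
    (h6 : s.num 6 = A) (h10 : s.idx 10 0 0 = N) (h20 : s.idx 20 0 0 = it)
    (hw : HoldsWalk N A it k s) (hT : s.idx 5 it (s.idx 22 0 0) = 0) :
    Runs κ walkStep s fun s' => HoldsWalk N A it (k + 1) s' ∧
      ∀ i ≠ it, s'.idx 5 i = s.idx 5 i := by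
  obtain ⟨h24, hw⟩ := hw
  set r := s.idx 22 0 0 with hr
  set c := s.idx 23 0 0 with hc
  have hL := κ.L_le
  have hk := hw.le
  have hrN := hw.row_lt
  have hcN := hw.col_lt
  refine Runs.seq (Runs.setIdx (by simp [IdxExpr.eval, h24]; omega) ?_)
  refine Runs.seq (Runs.setIdx (by simp [IdxExpr.eval, ← hr]; omega) ?_)
  refine Runs.seq (Runs.setIdx (by simp [IdxExpr.eval, ← hc]; omega) ?_)
  simp only [IdxExpr.eval, h20, h24, ← hr, ← hc, ne_eq, not_false_eq_true,
    State.setIdx_idx_of_ne, Nat.reduceEqDiff]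
  refine Runs.seq ((Runs.search (N := N) (fun q => q ≠ c ∧ 0 < A r q) (by omega) (by decide)
    ?_ ?_ ?_).mono_agree ?_)
  · intro s' h
    simp [IdxExpr.eval, h.idx 10 rfl, h10]
  · intro s' h
    have : s'.num 6 = A := by rw [h.num 6 rfl]; exact h6
    simp [Test.Holds, NumExpr.eval, IdxExpr.eval, h.idx 22 rfl, h.idx 23 rfl, this, ← hr, ← hc]
    grind
  · obtain ⟨q, hq, h⟩ := hA.exists_col_ne hrN hcN hw.lt_one
    exact ⟨q, hq, h⟩
  rintro s₁ ha₁ ⟨hcn, hcc, hrc⟩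
  set c' := s₁.idx 25 0 0 with hc'
  have h6₁ : s₁.num 6 = A := by rw [ha₁.num 6 rfl]; exact h6
  refine Runs.seq (Runs.setIdx (by simp [IdxExpr.eval, ← hc']; omega) ?_)
  refine Runs.seq (Runs.setIdx (by simp [IdxExpr.eval, ← hc']; omega) ?_)
  simp only [IdxExpr.eval, ← hc', ne_eq, not_false_eq_true,
    State.setIdx_idx_of_ne, Nat.reduceEqDiff, ha₁.idx 24 rfl, h24]
  -- Since `A r c` is positive as well, the entry `(r, c')` is below one, so column `c'` has a
  -- positive entry in another row.
  have hlt : A r c' < 1 := by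
    have := hA.add_le_one hrN hcN hcn hcc
    have := hw.pos
    linarith
  refine Runs.seq ((Runs.search (N := N) (fun q => q ≠ r ∧ 0 < A q c') (by omega) (by decide)
    ?_ ?_ ?_).mono_agree ?_)
  · intro s' h
    simp [IdxExpr.eval, h.idx 10 rfl, ha₁.idx 10 rfl, h10]
  · intro s' h
    have : s'.num 6 = A := by rw [h.num 6 rfl]; exact h6₁
    simp [Test.Holds, NumExpr.eval, IdxExpr.eval, h.idx 22 rfl, h.idx 23 rfl, ha₁.idx 22 rfl, this,
      ← hr]
    grind
  · obtain ⟨q, hq, h⟩ := hA.exists_row_ne hrN hcn hlt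
    exact ⟨q, hq, h⟩
  rintro s₂ ha₂ ⟨hrn, hrr, hrc'⟩
  set r' := s₂.idx 25 0 0 with hr'
  refine Runs.seq (Runs.setIdx (by simp [IdxExpr.eval, ← hr']; omega) ?_)
  refine Runs.setIdx ?_ ?_
  · simp [IdxExpr.eval, ha₂.idx 24 rfl, ha₁.idx 24 rfl, h24]
    omega
  have e5 : s₂.idx 5 = upd (s.idx 5) it r (k + 1) := by
    rw [ha₂.idx 5 rfl]
    simp [ha₁.idx 5 rfl]
  have e6 : s₂.idx 6 = upd (s.idx 6) k 0 r := by
    rw [ha₂.idx 6 rfl]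
    simp [ha₁.idx 6 rfl]
  have e7 : s₂.idx 7 = upd (upd (s.idx 7) 1 k c) 0 k c' := by
    rw [ha₂.idx 7 rfl]
    simp [ha₁.idx 7 rfl]
  refine ⟨⟨by simp [IdxExpr.eval, ha₂.idx 24 rfl, ha₁.idx 24 rfl, h24], ?_⟩, ?_⟩
  · simp only [IdxExpr.eval, ne_eq, not_false_eq_true, ← hr',
      State.setIdx_idx_of_ne, Nat.reduceEqDiff, State.setIdx_idx_self, upd_self, ha₂.idx 23 rfl,
      e5, e6, e7]
    refine hw.next hA hT ?_ ?_ ?_ ?_ ?_ ?_ ?_ ?_ hcn hcc hrc hrn hrr hrc'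
    · intro i hi
      simp [upd_apply, hi.ne]
    · intro i hi
      simp [upd_apply, hi.ne]
    · intro i hi
      simp [upd_apply, hi.ne]
    · simp
    · simp
    · simp [upd_apply]
    · simp
    · intro q hq
      simp [upd_apply, hq]
  · intro i hi
    funext q
    simp [e5, upd_apply, hi]

theorem runs_findCircuit {N it : ℕ} {A : ℕ → ℕ → K} (hA : DoublyStochastic N A)
    (hN : N + 1 ≤ κ.L) (h6 : s.num 6 = A) (h10 : s.idx 10 0 0 = N) (h20 : s.idx 20 0 0 = it)
    (hT : ∀ q, s.idx 5 it q = 0) (h22 : s.idx 22 0 0 < N) (h23 : s.idx 23 0 0 < N)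
    (hf : Fractional A (s.idx 22 0 0) (s.idx 23 0 0)) :
    Runs κ findCircuit s fun s' => s'.idx 24 0 0 ≤ N ∧
      Circuit N A (s'.idx 24 0 0) (fun i => s'.idx 6 (s'.idx 28 0 0 + i) 0)
        (fun i => s'.idx 7 0 (s'.idx 28 0 0 + i)) (fun i => s'.idx 7 1 (s'.idx 28 0 0 + i)) ∧
      ∀ i ≠ it, s'.idx 5 i = s.idx 5 i := by
  have hL := κ.L_le
  refine Runs.seq (Runs.setIdx (by simp [IdxExpr.eval]) (Runs.seq ?_))
  refine Runs.loop (fun k s' => HoldsWalk N A it k s' ∧ ∀ i ≠ it, s'.idx 5 i = s.idx 5 i) ?_ ?_ ?_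
  · refine ⟨⟨by simp [IdxExpr.eval], ?_⟩, by simp⟩
    simp only [IdxExpr.eval, ne_eq, not_false_eq_true,
      State.setIdx_idx_of_ne, Nat.reduceEqDiff]
    exact Walk.start h22 h23 hf.1 hf.2 hT
  · rintro k s₁ ha ⟨hw, h5⟩ hc
    have e20 : s₁.idx 20 0 0 = it := by rw [ha.idx 20 rfl]; simpa
    have hc : s₁.idx 5 it (s₁.idx 22 0 0) = 0 := by
      simpa [Test.Holds, IdxExpr.eval, e20] using hc
    refine ⟨by have := hw.2.le; omega, ?_⟩
    refine (runs_walkStep hA hN ?_ ?_ e20 hw hc).mono ?_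
    · rw [ha.num 6 rfl]
      exact h6
    · rw [ha.idx 10 rfl]
      simpa
    · rintro s' ⟨hw', h5'⟩
      exact ⟨hw', fun i hi => (h5' i hi).trans (h5 i hi)⟩
  · rintro k s₁ ha ⟨⟨h24, hw⟩, h5⟩ hc
    have e20 : s₁.idx 20 0 0 = it := by rw [ha.idx 20 rfl]; simpa
    have hc : s₁.idx 5 it (s₁.idx 22 0 0) ≠ 0 := by
      simpa [Test.Holds, IdxExpr.eval, e20] using hc
    obtain ⟨a, hTa⟩ := Nat.exists_eq_succ_of_ne_zero hc
    have hak := (hw.visited _ hc).1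
    have hk := hw.le
    have hcN := hw.col_lt
    refine Runs.seq (Runs.setIdx (by simp [IdxExpr.eval, e20, hTa]; omega) ?_)
    -- The row visited at time `a` was entered from outside the circuit; its entering column is
    -- replaced by the one in which the walk has returned.
    refine Runs.seq (Runs.setIdx (by simp [IdxExpr.eval]; omega) ?_)
    refine Runs.setIdx (by simp [IdxExpr.eval, h24]; omega) ?_
    simp only [IdxExpr.eval, ne_eq, not_false_eq_true, e20, hTa,
      Nat.succ_eq_add_one, Nat.add_sub_cancel, State.setIdx_idx_self, upd_self, h24,
      State.setIdx_idx_of_ne, Nat.reduceEqDiff]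
    refine ⟨by omega, ?_, h5⟩
    have := hw.circuit hTa (I' := fun i => upd (s₁.idx 7) 1 a (s₁.idx 23 0 0) 1 i)
      (fun i hi => by simp [upd_apply, hi]) (by simp)
    convert this using 2
    simp [upd_apply]

/-- The costs of the rounding of an `N × N` matrix with weights `C` are within the bounds. -/
structure Fits (κ : CostModel K) (N : ℕ) (C : ℕ → ℕ → K) (cmax : K) : Prop where
  loop_le : N * N + N + 2 ≤ κ.L
  le_big : (2 * N + 2 : K) ≤ κ.big
  wt_le_big : (2 * N + 2) * cmax ≤ κ.big
  wt_grid : ∀ r < N, ∀ c < N, C r c ∈ κ.grid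
  wt_le : ∀ r < N, ∀ c < N, |C r c| ≤ cmax

theorem Fits.big_nonneg {N : ℕ} {C : ℕ → ℕ → K} {cmax : K} (h : Fits κ N C cmax) : 0 ≤ κ.big :=
  le_trans (by positivity) h.le_big

theorem Fits.two_le {N : ℕ} {C : ℕ → ℕ → K} {cmax : K} (h : Fits κ N C cmax) : 2 ≤ κ.big :=
  le_trans (by have : (0 : K) ≤ N := Nat.cast_nonneg N; linarith) h.le_big

/-- Row 0 of index array `7` holds the leaving columns and row 1 the entering ones. Variable `29`
names the row that gains, so the circuit is reversed without copying. -/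
theorem runs_findDirection {N l : ℕ} {A C : ℕ → ℕ → K} {cmax : K} (hκ : Fits κ N C cmax)
    (h7 : s.num 7 = C) (h24 : s.idx 24 0 0 = l) (hl : l ≤ N)
    (hc : Circuit N A l (fun i => s.idx 6 (s.idx 28 0 0 + i) 0)
        (fun i => s.idx 7 0 (s.idx 28 0 0 + i)) (fun i => s.idx 7 1 (s.idx 28 0 0 + i))) :
    Runs κ findDirection s fun s' => s'.idx 29 0 0 ≤ 1 ∧
      Circuit N A l (fun i => s.idx 6 (s.idx 28 0 0 + i) 0)
        (fun i => s.idx 7 (s'.idx 29 0 0) (s.idx 28 0 0 + i))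
        (fun i => s.idx 7 (1 - s'.idx 29 0 0) (s.idx 28 0 0 + i)) ∧
      0 ≤ ∑ k ∈ range l, (C (s.idx 6 (s.idx 28 0 0 + k) 0)
          (s.idx 7 (s'.idx 29 0 0) (s.idx 28 0 0 + k)) -
        C (s.idx 6 (s.idx 28 0 0 + k) 0) (s.idx 7 (1 - s'.idx 29 0 0) (s.idx 28 0 0 + k))) := by
  have hL := κ.L_le
  have hloop := hκ.loop_le
  set R : ℕ → ℕ := fun i => s.idx 6 (s.idx 28 0 0 + i) 0 with hR
  set O : ℕ → ℕ := fun i => s.idx 7 0 (s.idx 28 0 0 + i) with hO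
  set I : ℕ → ℕ := fun i => s.idx 7 1 (s.idx 28 0 0 + i) with hI
  have hlK : (l : K) ≤ N := by exact_mod_cast hl
  refine Runs.seq (Runs.setNum ?_ ?_)
  · exact κ.size_le _ (by simp [NumExpr.eval, IdxExpr.eval])
      (by simpa [NumExpr.eval, IdxExpr.eval] using hκ.big_nonneg)
  refine Runs.seq (Runs.forLoop (N := l) (fun k s' =>
    s'.num 12 0 0 = ∑ i ∈ range k, (C (R i) (O i) - C (R i) (I i)) ∧ s'.num 12 0 0 ∈ κ.grid ∧
      |s'.num 12 0 0| ≤ 2 * k * cmax) (by nlinarith) rfl ?_ ?_ ?_ ?_ ?_)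
  · intro k s' x h
    exact h
  · intro s' h
    simp [IdxExpr.eval, h.idx 24 rfl, h24]
  · simp [NumExpr.eval, IdxExpr.eval]
  · rintro k s₁ hk ha hvk ⟨h1, h2, h3⟩
    have hRk := hc.row_lt k hk
    have hOk := hc.fst_lt k hk
    have hIk := hc.snd_lt k hk
    have e : NumExpr.eval s₁ (.add (.var 12)
        (.sub (wt rowOf (colOf (.const 0))) (wt rowOf (colOf (.const 1))))) =
        s₁.num 12 0 0 + (C (R k) (O k) - C (R k) (I k)) := by
      simp [NumExpr.eval, IdxExpr.eval, ha.num 7 rfl, h7, ha.idx 6 rfl, ha.idx 7 rfl,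
        ha.idx 28 rfl, hvk, hR, hO, hI]
    have hg : s₁.num 12 0 0 + (C (R k) (O k) - C (R k) (I k)) ∈ κ.grid :=
      κ.grid.add_mem h2 (κ.grid.sub_mem (hκ.wt_grid _ hRk _ hOk) (hκ.wt_grid _ hRk _ hIk))
    have hb : |s₁.num 12 0 0 + (C (R k) (O k) - C (R k) (I k))| ≤ 2 * (k + 1 : ℕ) * cmax := by
      refine (abs_add_le _ _).trans ?_
      have h4 := abs_sub (C (R k) (O k)) (C (R k) (I k))
      have h5 := hκ.wt_le _ hRk _ hOk
      have h6 := hκ.wt_le _ hRk _ hIk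
      push_cast
      linarith
    refine Runs.setNum ?_ ?_
    · rw [e]
      refine κ.size_le _ hg (hb.trans (le_trans ?_ hκ.wt_le_big))
      have h0 : 0 ≤ cmax := (abs_nonneg _).trans (hκ.wt_le _ hRk _ hOk)
      have h4 : ((k + 1 : ℕ) : K) ≤ N := by exact_mod_cast (by omega : k + 1 ≤ N)
      gcongr
      linarith
    · rw [e]
      refine ⟨?_, ?_, ?_⟩
      · simp only [IdxExpr.eval, State.setNum_num_self, upd_self, sum_range_succ, h1]
      · simpa [IdxExpr.eval] using hg
      · simpa [IdxExpr.eval] using hb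
  · rintro s₁ ha ⟨h1, -⟩
    refine Runs.branch (fun h => Runs.setIdx (by simp [IdxExpr.eval]) ?_)
      (fun h => Runs.setIdx (by simp [IdxExpr.eval]; omega) ?_)
    · simp only [IdxExpr.eval, State.setIdx_idx_self, upd_self]
      exact ⟨by omega, hc, by simpa [Test.Holds, NumExpr.eval, IdxExpr.eval, h1] using h⟩
    · simp only [IdxExpr.eval, State.setIdx_idx_self, upd_self]
      refine ⟨by omega, hc.swap, ?_⟩
      have h : ∑ i ∈ range l, (C (R i) (O i) - C (R i) (I i)) < 0 := by
        simpa [Test.Holds, NumExpr.eval, IdxExpr.eval, h1] using h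
      have : ∑ k ∈ range l, (C (R k) (I k) - C (R k) (O k)) =
          -∑ i ∈ range l, (C (R i) (O i) - C (R i) (I i)) := by
        rw [← sum_neg_distrib]
        exact sum_congr rfl fun _ _ => by ring
      exact (neg_pos.2 h).le.trans this.ge

theorem runs_findAmount {N l : ℕ} {A C : ℕ → ℕ → K} {cmax : K} {R P Q : ℕ → ℕ}
    (hκ : Fits κ N C cmax) (hA : DoublyStochastic N A) (hg : ∀ r < N, ∀ c < N, A r c ∈ κ.grid)
    (h6 : s.num 6 = A) (h24 : s.idx 24 0 0 = l) (hl : l ≤ N) (hc : Circuit N A l R P Q)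
    (hR : ∀ k, s.idx 6 (s.idx 28 0 0 + k) 0 = R k)
    (hP : ∀ k, s.idx 7 (s.idx 29 0 0) (s.idx 28 0 0 + k) = P k)
    (hQ : ∀ k, s.idx 7 (1 - s.idx 29 0 0) (s.idx 28 0 0 + k) = Q k) :
    Runs κ findAmount s fun s' =>
      (∃ k < l, P k ≠ Q k ∧ s'.num 13 0 0 = A (R k) (Q k)) ∧
      ∀ k < l, P k ≠ Q k → s'.num 13 0 0 ≤ A (R k) (Q k) := by
  have hL := κ.L_le
  have hloop := hκ.loop_le
  have h2 := hκ.two_le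
  refine Runs.seq (Runs.setNum ?_ ?_)
  · refine κ.size_le _ (by simpa [NumExpr.eval, IdxExpr.eval] using κ.one_mem) ?_
    simp [NumExpr.eval, IdxExpr.eval]
    linarith
  -- The initial value one stands for an empty minimum. All entries are at most one, so the first
  -- row with `P i ≠ Q i` replaces it, and `exists_ne` provides such a row.
  refine Runs.forLoop (N := l) (fun k s' =>
    ((∃ i < k, P i ≠ Q i ∧ s'.num 13 0 0 = A (R i) (Q i)) ∨
      ((∀ i < k, P i = Q i) ∧ s'.num 13 0 0 = 1)) ∧
    ∀ i < k, P i ≠ Q i → s'.num 13 0 0 ≤ A (R i) (Q i)) (by nlinarith) rfl ?_ ?_ ?_ ?_ ?_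
  · intro k s' x h
    exact h
  · intro s' h
    simp [IdxExpr.eval, h.idx 24 rfl, h24]
  · simp [NumExpr.eval, IdxExpr.eval]
  · rintro k s₁ hk ha hvk ⟨hI1, hI2⟩
    have e : NumExpr.eval s₁ (mat rowOf loseCol) = A (R k) (Q k) := by
      simp [NumExpr.eval, IdxExpr.eval, ha.num 6 rfl, h6, ha.idx 6 rfl, ha.idx 7 rfl,
        ha.idx 28 rfl, ha.idx 29 rfl, hvk, hR, hQ]
    have ht : Test.Holds s₁ (.and (.idxNe gainCol loseCol) (.numLe (mat rowOf loseCol) (.var 13))) ↔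
        P k ≠ Q k ∧ A (R k) (Q k) ≤ s₁.num 13 0 0 := by
      simp only [Test.Holds, e]
      simp [NumExpr.eval, IdxExpr.eval, ha.idx 7 rfl,
        ha.idx 28 rfl, ha.idx 29 rfl, hvk, hP, hQ]
      grind
    have hle := hA.le_one (hc.row_lt k hk) (hc.snd_lt k hk)
    have hpos := hc.snd_pos k hk
    refine Runs.branch (fun h => ?_) (fun h => Runs.skip ?_)
    · rw [ht] at h
      refine Runs.setNum ?_ ?_
      · rw [e]
        refine κ.size_le _ (hg _ (hc.row_lt k hk) _ (hc.snd_lt k hk)) ?_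
        rw [abs_of_pos hpos]
        linarith
      · rw [e]
        simp only [IdxExpr.eval, State.setNum_num_self, upd_self]
        refine ⟨Or.inl ⟨k, by omega, h.1, rfl⟩, fun i hi hne => ?_⟩
        rcases Nat.lt_succ_iff_lt_or_eq.1 hi with hi | rfl
        · exact h.2.trans (hI2 i hi hne)
        · exact le_rfl
    · rw [ht] at h
      refine ⟨?_, fun i hi hne => ?_⟩
      · rcases hI1 with ⟨i, hi, h'⟩ | ⟨h', h''⟩
        · exact Or.inl ⟨i, by omega, h'⟩
        · refine Or.inr ⟨fun i hi => ?_, h''⟩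
          rcases Nat.lt_succ_iff_lt_or_eq.1 hi with hi | rfl
          · exact h' i hi
          · by_contra hne
            exact h ⟨hne, by rwa [h'']⟩
      · rcases Nat.lt_succ_iff_lt_or_eq.1 hi with hi | rfl
        · exact hI2 i hi hne
        · by_contra hlt
          exact h ⟨hne, (not_le.1 hlt).le⟩
  · rintro s' - ⟨h1, h2⟩
    refine ⟨h1.resolve_right fun h => ?_, h2⟩
    obtain ⟨k, hk, hne⟩ := hc.exists_ne
    exact hne (h.1 k hk)

theorem runs_applyShift {N l : ℕ} {A C : ℕ → ℕ → K} {cmax t : K} {R P Q : ℕ → ℕ}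
    (hκ : Fits κ N C cmax) (hA : DoublyStochastic N A) (hg : ∀ r < N, ∀ c < N, A r c ∈ κ.grid)
    (h6 : s.num 6 = A) (h13 : s.num 13 0 0 = t) (h24 : s.idx 24 0 0 = l) (hl : l ≤ N)
    (hc : Circuit N A l R P Q) (hR : ∀ k, s.idx 6 (s.idx 28 0 0 + k) 0 = R k)
    (hP : ∀ k, s.idx 7 (s.idx 29 0 0) (s.idx 28 0 0 + k) = P k)
    (hQ : ∀ k, s.idx 7 (1 - s.idx 29 0 0) (s.idx 28 0 0 + k) = Q k)
    (ht0 : 0 ≤ t) (ht1 : t ≤ 1) (htg : t ∈ κ.grid) :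
    Runs κ applyShift s fun s' => s'.num 6 = shift A t R P Q l ∧
      ∀ r < N, ∀ c < N, s'.num 6 r c ∈ κ.grid := by
  have hL := κ.L_le
  have hloop := hκ.loop_le
  -- A partly applied shift need not be doubly stochastic, so entries are bounded crudely: two
  -- updates per iteration, each by at most one.
  refine Runs.forLoop (N := l) (fun k s' => s'.num 6 = shift A t R P Q k ∧
    ∀ r < N, ∀ c < N, s'.num 6 r c ∈ κ.grid ∧ |s'.num 6 r c| ≤ 1 + 2 * k) (by nlinarith)
    rfl ?_ ?_ ?_ ?_ ?_
  · intro k s' x h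
    exact h
  · intro s' h
    simp [IdxExpr.eval, h.idx 24 rfl, h24]
  · rw [h6]
    refine ⟨by funext r c; simp [shift], fun r hr c hc => ⟨hg r hr c hc, ?_⟩⟩
    rw [abs_of_nonneg (hA.nonneg r hr c hc)]
    simpa using hA.le_one hr hc
  · rintro k s₁ hk ha hvk ⟨hI1, hI2⟩
    have hRk := hc.row_lt k hk
    have hPk := hc.fst_lt k hk
    have hQk := hc.snd_lt k hk
    have hkN : ((k : K) + 1) ≤ N := by exact_mod_cast (by omega : k + 1 ≤ N)
    have hbig := hκ.le_big
    have e1 : IdxExpr.eval s₁ rowOf = R k := by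
      simp [IdxExpr.eval, ha.idx 6 rfl, ha.idx 28 rfl, hvk, hR]
    have e2 : IdxExpr.eval s₁ gainCol = P k := by
      simp [IdxExpr.eval, ha.idx 7 rfl, ha.idx 28 rfl, ha.idx 29 rfl, hvk, hP]
    have e3 : IdxExpr.eval s₁ loseCol = Q k := by
      simp [IdxExpr.eval, ha.idx 7 rfl, ha.idx 28 rfl, ha.idx 29 rfl, hvk, hQ]
    have e4 : s₁.num 13 0 0 = t := by rw [ha.num 13 rfl, h13]
    set B := s₁.num 6 with hB
    have g1 : B (R k) (P k) + t ∈ κ.grid := κ.grid.add_mem (hI2 _ hRk _ hPk).1 htg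
    have b1 : |B (R k) (P k) + t| ≤ 1 + 2 * k + 1 := by
      have := abs_add_le (B (R k) (P k)) t
      rw [abs_of_nonneg ht0] at this
      linarith [(hI2 _ hRk _ hPk).2]
    -- The subtraction reads the matrix after the addition, so in a row with `P k = Q k` the two
    -- updates cancel.
    set B' := upd B (R k) (P k) (B (R k) (P k) + t) with hB'
    have hI3 : ∀ r < N, ∀ c < N, B' r c ∈ κ.grid ∧ |B' r c| ≤ 1 + 2 * k + 1 := by
      intro r hr c hc
      rw [hB', upd_apply]
      split_ifs with h
      · exact ⟨g1, b1⟩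
      · exact ⟨(hI2 r hr c hc).1, by linarith [(hI2 r hr c hc).2]⟩
    have g2 : B' (R k) (Q k) - t ∈ κ.grid := κ.grid.sub_mem (hI3 _ hRk _ hQk).1 htg
    have b2 : |B' (R k) (Q k) - t| ≤ 1 + 2 * ((k + 1 : ℕ) : K) := by
      have := abs_sub (B' (R k) (Q k)) t
      rw [abs_of_nonneg ht0] at this
      push_cast
      linarith [(hI3 _ hRk _ hQk).2]
    refine Runs.seq (Runs.setNum ?_ (Runs.setNum ?_ ?_))
    · simp only [NumExpr.eval, e1, e2, ← hB]
      simp only [IdxExpr.eval, e4]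
      exact κ.size_le _ g1 (b1.trans (by linarith))
    · have f1 : ∀ i j v, IdxExpr.eval (s₁.setNum 6 i j v) rowOf = R k := fun _ _ _ => e1
      have f3 : ∀ i j v, IdxExpr.eval (s₁.setNum 6 i j v) loseCol = Q k := fun _ _ _ => e3
      simp only [NumExpr.eval, f1, f3, e1, e2, State.setNum_num_self, ← hB, ne_eq,
        not_false_eq_true, State.setNum_num_of_ne, Nat.reduceEqDiff]
      simp only [IdxExpr.eval, e4, ← hB']
      refine κ.size_le _ g2 (b2.trans ?_)
      push_cast
      linarith
    · have f1 : ∀ i j v, IdxExpr.eval (s₁.setNum 6 i j v) rowOf = R k := fun _ _ _ => e1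
      have f3 : ∀ i j v, IdxExpr.eval (s₁.setNum 6 i j v) loseCol = Q k := fun _ _ _ => e3
      simp only [NumExpr.eval, f1, f3, e1, e2, State.setNum_num_self, ← hB, ne_eq,
        not_false_eq_true, State.setNum_num_of_ne, Nat.reduceEqDiff]
      simp only [IdxExpr.eval, e4, ← hB']
      refine ⟨?_, fun r hr c hc => ?_⟩
      · funext r c
        rw [shift_succ, ← hI1]
        simp only [hB', upd_apply]
        by_cases h1 : r = R k
        · subst h1
          by_cases h2 : c = P k
          · subst h2
            by_cases h3 : P k = Q k
            · simp [← h3]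
            · simp [h3]
          · by_cases h3 : c = Q k
            · subst h3
              simp [h2]
              ring
            · simp [h2, h3]
        · simp [h1]
      · rw [upd_apply]
        split_ifs with h
        · exact ⟨g2, b2⟩
        · refine ⟨(hI3 r hr c hc).1, (hI3 r hr c hc).2.trans ?_⟩
          push_cast
          linarith
  · rintro s' - ⟨h1, h2⟩
    exact ⟨h1, fun r hr c hc => (h2 r hr c hc).1⟩

end Algorithm

end BAVWM

/-! ### Iteration of the rounding until the matrix is integral -/

namespace BAVWM

open Finset

namespace Algorithm

variable {K : Type} [Field K] [LinearOrder K] {κ : CostModel K} {s : State K}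

/-- What the rounding of `A₀` maintains: the matrix `A` is still doubly stochastic and no worse. -/
structure Improves (κ : CostModel K) (N : ℕ) (C A₀ A : ℕ → ℕ → K) : Prop where
  stochastic : DoublyStochastic N A
  grid : ∀ r < N, ∀ c < N, A r c ∈ κ.grid
  weight_le : weight N C A₀ ≤ weight N C A
  pos : ∀ r < N, ∀ c < N, 0 < A r c → 0 < A₀ r c

variable [IsStrictOrderedRing K]

theorem runs_roundStep {N it : ℕ} {C A₀ A : ℕ → ℕ → K} {cmax : K} (hκ : Fits κ N C cmax)
    (h7 : s.num 7 = C) (h6 : s.num 6 = A) (h10 : s.idx 10 0 0 = N) (h20 : s.idx 20 0 0 = it)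
    (hT : ∀ i ≥ it, ∀ q, s.idx 5 i q = 0) (hI : Improves κ N C A₀ A) :
    Runs κ roundStep s fun s' => Improves κ N C A₀ (s'.num 6) ∧
      (∀ i ≥ it + 1, ∀ q, s'.idx 5 i q = 0) ∧
      ((s'.num 6 = A ∧ Integral N A) ∨
        ¬ Integral N A ∧ (support N (s'.num 6)).card < (support N A).card) := by
  have hA := hI.stochastic
  have hloop := hκ.loop_le
  have hNL : N + 1 ≤ κ.L := by nlinarith
  refine Runs.seq ((runs_findFractional (N := N) (by omega) κ.one_le h10).mono_agree ?_)
  intro s₁ ha₁ h₁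
  have e6 : s₁.num 6 = A := by rw [ha₁.num 6 rfl, h6]
  have e5 : s₁.idx 5 = s.idx 5 := ha₁.idx 5 rfl
  rw [h6] at h₁
  refine Runs.branch (fun h => ?_) (fun h => Runs.skip ?_)
  · have h : 1 ≤ s₁.idx 21 0 0 := h
    obtain ⟨-, h22, h23, hf⟩ := h₁.resolve_left fun h' => by omega
    refine Runs.seq ((runs_findCircuit hA hNL e6 (by rw [ha₁.idx 10 rfl, h10])
      (by rw [ha₁.idx 20 rfl, h20]) (by rw [e5]; exact hT it le_rfl) h22 h23 hf).mono_agree ?_)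
    rintro s₂ ha₂ ⟨hl, hc, h5⟩
    refine Runs.seq ((runs_findDirection (N := N) (C := C) hκ
      (by rw [ha₂.num 7 rfl, ha₁.num 7 rfl, h7]) rfl hl hc).mono_agree ?_)
    rintro s₃ ha₃ ⟨-, hc, hgain⟩
    have f6 : s₃.num 6 = A := by rw [ha₃.num 6 rfl, ha₂.num 6 rfl, e6]
    refine Runs.seq ((runs_findAmount hκ hA hI.grid f6 (ha₃.idx 24 rfl ▸ rfl) hl hc
      (by simp [ha₃.idx 6 rfl, ha₃.idx 28 rfl]) (by simp [ha₃.idx 7 rfl, ha₃.idx 28 rfl])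
      (by simp [ha₃.idx 7 rfl, ha₃.idx 28 rfl])).mono_agree ?_)
    rintro s₄ ha₄ ⟨⟨k, hk, hne, ht⟩, ht'⟩
    have hpos := hc.snd_pos k hk
    have hle := hA.le_one (hc.row_lt k hk) (hc.snd_lt k hk)
    have hg := hI.grid _ (hc.row_lt k hk) _ (hc.snd_lt k hk)
    rw [← ht] at hpos hle hg
    refine (runs_applyShift hκ hA hI.grid (by rw [ha₄.num 6 rfl, f6]) rfl
      (by rw [ha₄.idx 24 rfl, ha₃.idx 24 rfl]) hl hc
      (by simp [ha₄.idx 6 rfl, ha₄.idx 28 rfl, ha₃.idx 6 rfl, ha₃.idx 28 rfl])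
      (by simp [ha₄.idx 7 rfl, ha₄.idx 28 rfl, ha₄.idx 29 rfl, ha₃.idx 7 rfl, ha₃.idx 28 rfl])
      (by simp [ha₄.idx 7 rfl, ha₄.idx 28 rfl, ha₄.idx 29 rfl, ha₃.idx 7 rfl, ha₃.idx 28 rfl])
      hpos.le hle hg).mono_agree ?_
    rintro s₅ ha₅ ⟨h6', hg'⟩
    refine ⟨⟨?_, hg', ?_, ?_⟩, ?_, Or.inr ⟨fun hint => ?_, ?_⟩⟩
    · rw [h6']
      exact hA.shift hc hpos.le ht'
    · rw [h6', weight_shift hc]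
      exact hI.weight_le.trans (le_add_of_nonneg_right (mul_nonneg hpos.le hgain))
    · intro r hr c hc'
      rw [h6']
      exact fun h => hI.pos r hr c hc' (pos_of_shift_pos hc hpos.le h)
    · intro i hi q
      rw [ha₅.idx 5 rfl, ha₄.idx 5 rfl, ha₃.idx 5 rfl, h5 i (by omega), e5]
      exact hT i (by omega) q
    · rcases hint _ h22 _ h23 with h' | h'
      · exact hf.1.ne' h'
      · exact hf.2.ne h'
    · rw [h6', ht]
      exact card_support_shift_lt hc hk hne
  · have h : ¬ 1 ≤ s₁.idx 21 0 0 := h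
    obtain ⟨-, hf⟩ := h₁.resolve_right fun h' => by omega
    rw [e6, e5]
    refine ⟨hI, fun i hi => hT i (by omega), Or.inl ⟨rfl, fun r hr c hc => ?_⟩⟩
    by_contra! hne
    exact hf r hr c hc ⟨(hA.nonneg r hr c hc).lt_of_ne' hne.1, (hA.le_one hr hc).lt_of_ne hne.2⟩

/-- Each round on a nonintegral matrix removes a positive entry, and rounds on an integral one do
nothing. A matrix still not integral after `N * N` rounds would have empty support, contrary to its
row sums. -/
theorem runs_roundAll {N : ℕ} {C A₀ : ℕ → ℕ → K} {cmax : K} (hκ : Fits κ N C cmax)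
    (h7 : s.num 7 = C) (h6 : s.num 6 = A₀) (h10 : s.idx 10 0 0 = N)
    (hT : ∀ i q, s.idx 5 i q = 0) (hA : DoublyStochastic N A₀)
    (hg : ∀ r < N, ∀ c < N, A₀ r c ∈ κ.grid) :
    Runs κ roundAll s fun s' => Improves κ N C A₀ (s'.num 6) ∧ Integral N (s'.num 6) := by
  have hloop := hκ.loop_le
  refine Runs.forLoop (N := N * N) (fun k s' => Improves κ N C A₀ (s'.num 6) ∧
    (∀ i ≥ k, ∀ q, s'.idx 5 i q = 0) ∧
    (Integral N (s'.num 6) ∨ (support N (s'.num 6)).card + k ≤ N * N)) (by omega) rfl ?_ ?_ ?_ ?_ ?_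
  · intro k s' x h
    simpa using h
  · intro s' h
    simp [IdxExpr.eval, h.idx 10 rfl, h10]
  · rw [h6]
    refine ⟨⟨hA, hg, le_rfl, fun _ _ _ _ h => h⟩, fun i _ => hT i, Or.inr ?_⟩
    simpa [support] using card_filter_le (range N ×ˢ range N) fun p => 0 < A₀ p.1 p.2
  · rintro k s₁ hk ha hvk ⟨hI, hT, h⟩
    refine (runs_roundStep hκ (by rw [ha.num 7 rfl, h7]) rfl (by rw [ha.idx 10 rfl, h10]) hvk hT
      hI).mono ?_
    rintro s' ⟨hI', hT', h'⟩
    refine ⟨hI', hT', ?_⟩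
    rcases h' with ⟨he, hint⟩ | ⟨hint, hlt⟩
    · rw [he]
      exact Or.inl hint
    · exact Or.inr (by have := h.resolve_left hint; omega)
  · rintro s' - ⟨hI, -, h⟩
    refine ⟨hI, h.elim id fun hcard r hr => ?_⟩
    have := (hI.stochastic.support_nonempty hr).card_pos
    omega

end Algorithm

end BAVWM

namespace BAVWM

open Finset

/-! ### Construction of the doubly stochastic matrix -/

namespace Algorithm

/-- Index of the row and column that belong to slot `s` of bidder `i`, after those of the items. -/
abbrev slotIdx (m i s : ℕ) : ℕ := m + (i * m + s)

theorem slotIdx_inj {m i s i' s' : ℕ} (hs : s < m) (hs' : s' < m)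
    (h : slotIdx m i s = slotIdx m i' s') : i = i' ∧ s = s' := by
  have h : i * m + s = i' * m + s' := Nat.add_left_cancel h
  have : i = i' := by
    rcases lt_trichotomy i i' with h1 | h1 | h1
    · nlinarith
    · exact h1
    · nlinarith
  subst this
  exact ⟨rfl, by omega⟩

theorem slotIdx_lt {n m i s : ℕ} (hi : i < n) (hs : s < m) : slotIdx m i s < m + n * m := by
  rw [slotIdx]
  nlinarith

theorem exists_slotIdx {n m r : ℕ} (h : m ≤ r) (h' : r < m + n * m) :
    ∃ i < n, ∃ s < m, r = slotIdx m i s := by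
  have hm : 0 < m := by
    by_contra h0
    obtain rfl : m = 0 := by omega
    omega
  refine ⟨(r - m) / m, ?_, (r - m) % m, Nat.mod_lt _ hm, ?_⟩
  · rw [Nat.div_lt_iff_lt_mul hm]
    omega
  · have := Nat.div_add_mod' (r - m) m
    rw [slotIdx]
    omega

/-- Set number variable `d` to the projection of the value of `e` to `[k, k + 1]`, where `k` is the
value of index variable `14`. -/
def clipTo (d : ℕ) (e : NumExpr) : Prog :=
  .seq (.letNum d e) <|
  .seq (.branch (.numLe (.var d) (.ofIdx (.var 14))) (.letNum d (.ofIdx (.var 14))) .skip) <|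
    .branch (.numLe (.add (.ofIdx (.var 14)) (lit 1)) (.var d))
      (.letNum d (.add (.ofIdx (.var 14)) (lit 1))) .skip

/-- Set number variable `10` to the total fraction of the items before the current one. -/
def findPrefix : Prog :=
  .seq (.letNum 10 (lit 0)) <| .forLoop 13 (.var 1) <|
    .branch (.and (.numLe (.load 1 (.var 11) (.var 12)) (.load 1 (.var 11) (.var 13)))
        (.not (.and (.numLe (.load 1 (.var 11) (.var 13)) (.load 1 (.var 11) (.var 12)))
          (.idxLe (.var 12) (.var 13)))))
      (.letNum 10 (.add (.var 10) (.load 4 (.var 11) (.var 13)))) .skip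

/-- Fill in the entries that belong to one bidder, item and slot. -/
def fillStep : Prog :=
  .seq (.letIdx 17 (.add (.var 1) (.add (.mul (.var 11) (.var 1)) (.var 14)))) <|
  .seq (clipTo 11 (.add (.var 10) (.load 4 (.var 11) (.var 12)))) <|
  .seq (clipTo 12 (.var 10)) <|
  .seq (.setNum 6 (.var 12) (.var 17) (.sub (.var 11) (.var 12))) <|
  .seq (.setNum 6 (.var 17) (.var 12) (.sub (.var 11) (.var 12))) <|
    .setNum 7 (.var 12) (.var 17) (.add (.mul (.load 2 (.var 11) (.const 0))
      (.load 1 (.var 11) (.var 12))) (.load 3 (.var 11) (.var 12)))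

/-- Fill in the entries between items and slots. -/
def fillAll : Prog :=
  .forLoop 11 (.var 0) <| .forLoop 12 (.var 1) <| .seq findPrefix <| .forLoop 14 (.var 1) fillStep

variable {K : Type} [Field K] [LinearOrder K] {κ : CostModel K} {s : State K}

/-- Weight of an item in the slots of a bidder. -/
abbrev slotWeight (mu v w : ℕ → ℕ → K) (i j : ℕ) : K := mu i 0 * v i j + w i j

/-- The data of an instance and a fractional solution are within the bounds. -/
structure DataBounds (κ : CostModel K) (n m : ℕ) (mu v w x : ℕ → ℕ → K) (cmax : K) : Prop where
  loop_le : (m + n * m) * (m + n * m) + (m + n * m) + n + 2 ≤ κ.L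
  le_big : (2 * (m + n * m : ℕ) + 2 : K) ≤ κ.big
  wt_le_big : (2 * (m + n * m : ℕ) + 2) * cmax ≤ κ.big
  cmax_nonneg : 0 ≤ cmax
  x_nonneg : ∀ i < n, ∀ j < m, 0 ≤ x i j
  item : ∀ j < m, ∑ i ∈ range n, x i j ≤ 1
  x_grid : ∀ i < n, ∀ j < m, x i j ∈ κ.grid
  slot_grid : ∀ i < n, ∀ j < m, slotWeight mu v w i j ∈ κ.grid
  slot_le : ∀ i < n, ∀ j < m, |slotWeight mu v w i j| ≤ cmax
  virt_grid : ∀ i < n, ∀ j < m, w i j ∈ κ.grid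
  virt_le : ∀ i < n, ∀ j < m, |w i j| ≤ cmax

/-- The entries for slot `s'` of bidder `i'` and item `j'` are filled in for all `(i', j', s')` before
`(i, j, s)`, where `z` are the fractions and `p` the weights; and the other blocks are zero. -/
structure Filled (m : ℕ) (z : ℕ → ℕ → ℕ → K) (p : ℕ → ℕ → K) (i j s : ℕ) (A C : ℕ → ℕ → K) :
    Prop where
  entry : ∀ i' j' s', j' < m → s' < m → (i' < i ∨ i' = i ∧ (j' < j ∨ j' = j ∧ s' < s)) →
    A j' (slotIdx m i' s') = z i' s' j' ∧ A (slotIdx m i' s') j' = z i' s' j' ∧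
      C j' (slotIdx m i' s') = p i' j'
  item : ∀ r < m, ∀ c < m, A r c = 0
  slot : ∀ r ≥ m, ∀ c ≥ m, A r c = 0
  wt_item : ∀ r, ∀ c < m, C r c = 0
  wt_slot : ∀ r ≥ m, ∀ c, C r c = 0

/-- Distinct triples own distinct cells by `slotIdx_inj`, and item indices lie below `m` while slot
indices do not, so the two symmetric cells never collide. -/
theorem Filled.step {m : ℕ} {z : ℕ → ℕ → ℕ → K} {p : ℕ → ℕ → K} {i j s : ℕ} {A C : ℕ → ℕ → K}
    (h : Filled m z p i j s A C) (hj : j < m) (hs : s < m) :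
    Filled m z p i j (s + 1)
      (upd (upd A j (slotIdx m i s) (z i s j)) (slotIdx m i s) j (z i s j))
      (upd C j (slotIdx m i s) (p i j)) := by
  have hle : m ≤ slotIdx m i s := Nat.le_add_right _ _
  refine ⟨?_, ?_, ?_, ?_, ?_⟩
  · intro i' j' s' hj' hs' hd
    have hle' : m ≤ slotIdx m i' s' := Nat.le_add_right _ _
    by_cases he : i' = i ∧ j' = j ∧ s' = s
    · obtain ⟨rfl, rfl, rfl⟩ := he
      have h1 : j' ≠ slotIdx m i' s' := by omega
      simp [upd_apply, h1]
    · have hne : ¬ (j' = j ∧ slotIdx m i' s' = slotIdx m i s) := by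
        rintro ⟨rfl, h'⟩
        obtain ⟨rfl, rfl⟩ := slotIdx_inj hs' hs h'
        exact he ⟨rfl, rfl, rfl⟩
      have h1 : j' ≠ slotIdx m i s := by omega
      have h2 : slotIdx m i' s' ≠ j := by omega
      have h3 : ¬ (slotIdx m i' s' = slotIdx m i s ∧ j' = j) := fun h => hne h.symm
      simp only [upd_apply, hne, h1, h2, h3, false_and, if_false]
      exact h.entry i' j' s' hj' hs' (by omega)
  · intro r hr c hc
    have h1 : r ≠ slotIdx m i s := by omega
    have h2 : c ≠ slotIdx m i s := by omega
    simp only [upd_apply, h1, h2, and_false, false_and, if_false]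
    exact h.item r hr c hc
  · intro r hr c hc
    have h1 : r ≠ j := by omega
    have h2 : c ≠ j := by omega
    simp only [upd_apply, h1, h2, and_false, false_and, if_false]
    exact h.slot r hr c hc
  · intro r c hc
    have h2 : c ≠ slotIdx m i s := by omega
    simp only [upd_apply, h2, and_false, if_false]
    exact h.wt_item r c hc
  · intro r hr c
    have h1 : r ≠ j := by omega
    simp only [upd_apply, h1, false_and, if_false]
    exact h.wt_slot r hr c

/-- For the carry at the end of an inner loop, from `(i, j, m)` to `(i, j + 1, 0)` and from `(i, m,
0)` to `(i + 1, 0, 0)`. -/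
theorem Filled.congr {m : ℕ} {z : ℕ → ℕ → ℕ → K} {p : ℕ → ℕ → K} {i j s i' j' s' : ℕ}
    {A C : ℕ → ℕ → K} (h : Filled m z p i j s A C)
    (hd : ∀ a b c, b < m → c < m → (a < i' ∨ a = i' ∧ (b < j' ∨ b = j' ∧ c < s')) →
      (a < i ∨ a = i ∧ (b < j ∨ b = j ∧ c < s))) : Filled m z p i' j' s' A C :=
  ⟨fun a b c hb hc h' => h.entry a b c hb hc (hd a b c hb hc h'), h.item, h.slot, h.wt_item,
    h.wt_slot⟩

variable [IsStrictOrderedRing K]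

theorem natCast_mem_grid (κ : CostModel K) (k : ℕ) : (k : K) ∈ κ.grid := by
  simpa using κ.grid.nsmul_mem κ.one_mem k

theorem runs_clipTo {d k : ℕ} {e : NumExpr} {t : K} (h14 : s.idx 14 0 0 = k) (he : e.eval s = t)
    (ht0 : 0 ≤ t) (ht : t ∈ κ.grid) (htb : t ≤ κ.big) (hk : (k : K) + 1 ≤ κ.big) :
    Runs κ (clipTo d e) s fun s' => s'.num d 0 0 = clip k t ∧ s'.num d 0 0 ∈ κ.grid := by
  have hk0 : (0 : K) ≤ k := Nat.cast_nonneg k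
  have hkg := natCast_mem_grid κ k
  refine Runs.seq (Runs.setNum ?_ ?_)
  · rw [he]
    exact κ.size_le _ ht (by rwa [abs_of_nonneg ht0])
  have e1 : (NumExpr.var d).eval (s.setNum d 0 0 t) = t := by simp [NumExpr.eval, IdxExpr.eval]
  have e2 : (s.setNum d 0 0 t).num d 0 0 = t := by simp
  have e3 : (s.setNum d 0 0 t).idx 14 0 0 = k := h14
  rw [he]
  simp only [IdxExpr.eval]
  generalize s.setNum d 0 0 t = s₁ at e1 e2 e3
  refine Runs.seq (Runs.mono_agree (Q := fun s' => s'.num d 0 0 = max t k ∧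
    s'.num d 0 0 ∈ κ.grid) ?_ ?_)
  · refine Runs.branch (fun h => Runs.setNum ?_ ?_) (fun h => Runs.skip ?_)
    · simp only [NumExpr.eval, IdxExpr.eval, e3]
      exact κ.size_le _ hkg (by rw [abs_of_nonneg hk0]; linarith)
    · have h : t ≤ k := by simpa [Test.Holds, NumExpr.eval, IdxExpr.eval, e2, e3] using h
      simp [NumExpr.eval, IdxExpr.eval, e3, h, hkg]
    · have h : ¬ t ≤ k := by simpa [Test.Holds, NumExpr.eval, IdxExpr.eval, e2, e3] using h
      simp [e2, ht, (not_le.1 h).le]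
  · rintro s₂ ha ⟨h2, h2g⟩
    have e4 : s₂.idx 14 0 0 = k := by rw [ha.idx 14 rfl, e3]
    refine Runs.branch (fun h => Runs.setNum ?_ ?_) (fun h => Runs.skip ?_)
    · have : (k : K) + 1 ∈ κ.grid := κ.grid.add_mem hkg κ.one_mem
      simp only [NumExpr.eval, IdxExpr.eval, e4, Nat.cast_one]
      exact κ.size_le _ this (by rw [abs_of_nonneg (by linarith)]; linarith)
    · have h : (k : K) + 1 ≤ max t k := by
        simpa [Test.Holds, NumExpr.eval, IdxExpr.eval, e4, h2] using h
      have : (k : K) + 1 ∈ κ.grid := κ.grid.add_mem hkg κ.one_mem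
      simp only [NumExpr.eval, IdxExpr.eval, e4, Nat.cast_one, State.setNum_num_self, upd_self]
      exact ⟨(min_eq_right h).symm, this⟩
    · have h : ¬ (k : K) + 1 ≤ max t k := by
        simpa [Test.Holds, NumExpr.eval, IdxExpr.eval, e4, h2] using h
      exact ⟨h2.trans (min_eq_left (not_le.1 h).le).symm, h2g⟩

variable {n m : ℕ} {mu v w x : ℕ → ℕ → K} {cmax : K}

theorem DataBounds.x_le_one (h : DataBounds κ n m mu v w x cmax) {i j : ℕ} (hi : i < n)
    (hj : j < m) : x i j ≤ 1 :=
  (single_le_sum (f := fun i => x i j) (fun i hi => h.x_nonneg i (mem_range.1 hi) j hj)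
    (mem_range.2 hi)).trans (h.item j hj)

theorem DataBounds.m_le (h : DataBounds κ n m mu v w x cmax) : (2 * m + 2 : K) ≤ κ.big := by
  refine le_trans ?_ h.le_big
  have : (m : K) ≤ (m + n * m : ℕ) := by exact_mod_cast Nat.le_add_right _ _
  linarith

theorem runs_findPrefix {i j : ℕ} (hκ : DataBounds κ n m mu v w x cmax) (hi : i < n)
    (h1 : s.idx 1 0 0 = m) (hv : s.num 1 = v) (hx : s.num 4 = x) (h11 : s.idx 11 0 0 = i)
    (h12 : s.idx 12 0 0 = j) :
    Runs κ findPrefix s fun s' => s'.num 10 0 0 = prefixSum (x i) (v i) (range m) j ∧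
      s'.num 10 0 0 ∈ κ.grid ∧ s'.num 10 0 0 ≤ m := by
  have hL := κ.L_le
  have hloop := hκ.loop_le
  have hm := hκ.m_le
  have hm0 : (0 : K) ≤ m := Nat.cast_nonneg m
  refine Runs.seq (Runs.setNum ?_ ?_)
  · refine κ.size_le _ (by simp [NumExpr.eval, IdxExpr.eval]) ?_
    simp only [NumExpr.eval, IdxExpr.eval, Nat.cast_zero, abs_zero]
    linarith
  refine Runs.forLoop (N := m) (fun k s' => s'.num 10 0 0 = prefixSum (x i) (v i) (range k) j ∧
    s'.num 10 0 0 ∈ κ.grid ∧ 0 ≤ s'.num 10 0 0 ∧ s'.num 10 0 0 ≤ k) (by nlinarith) rfl ?_ ?_ ?_ ?_ ?_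
  · intro k s' y h
    exact h
  · intro s' h
    simp [IdxExpr.eval, h.idx 1 rfl, h1]
  · simp [NumExpr.eval, IdxExpr.eval, prefixSum]
  · rintro k s₁ hk ha hvk ⟨hI1, hI2, hI3, hI4⟩
    have hkm : ((k + 1 : ℕ) : K) ≤ m := by exact_mod_cast hk
    have hx0 := hκ.x_nonneg i hi k hk
    have hx1 := hκ.x_le_one hi hk
    have e1 : s₁.num 1 = v := by rw [ha.num 1 rfl]; exact hv
    have e4 : s₁.num 4 = x := by rw [ha.num 4 rfl]; exact hx
    have e11 : s₁.idx 11 0 0 = i := by rw [ha.idx 11 rfl]; exact h11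
    have e12 : s₁.idx 12 0 0 = j := by rw [ha.idx 12 rfl]; exact h12
    push_cast at hkm
    refine Runs.branch (fun h => Runs.setNum ?_ ?_) (fun h => Runs.skip ?_)
    · simp only [NumExpr.eval, IdxExpr.eval, e4, e11, hvk]
      refine κ.size_le _ (κ.grid.add_mem hI2 (hκ.x_grid i hi k hk)) ?_
      rw [abs_of_nonneg (by linarith)]
      linarith
    · have h : Before (v i) k j := by
        simpa [Test.Holds, NumExpr.eval, IdxExpr.eval, e1, e11, e12, hvk, Before] using h
      simp only [NumExpr.eval, IdxExpr.eval, e4, e11, hvk, State.setNum_num_self, upd_self]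
      refine ⟨?_, κ.grid.add_mem hI2 (hκ.x_grid i hi k hk), by linarith, by push_cast; linarith⟩
      rw [prefixSum, sum_range_succ, if_pos h, hI1, prefixSum]
    · have h : ¬ Before (v i) k j := by
        simpa [Test.Holds, NumExpr.eval, IdxExpr.eval, e1, e11, e12, hvk, Before] using h
      refine ⟨?_, hI2, hI3, by push_cast; linarith⟩
      rw [prefixSum, sum_range_succ, if_neg h, hI1, prefixSum, add_zero]
  · rintro s' - ⟨h1, h2, -, h4⟩
    exact ⟨h1, h2, h4⟩

/-- Fraction of item `j` in slot `s` of bidder `i`. -/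
abbrev slotOf (m : ℕ) (x v : ℕ → ℕ → K) (i s j : ℕ) : K := slot (x i) (v i) m s j

theorem DataBounds.slot_le_one (h : DataBounds κ n m mu v w x cmax) {i j q : ℕ} (hi : i < n)
    (hj : j < m) : slotOf m x v i q j ≤ 1 :=
  (single_le_sum (f := slotOf m x v i q) (fun _ hj => slot_nonneg (h.x_nonneg i hi) q
    (mem_range.1 hj)) (mem_range.2 hj)).trans (sum_slot_items_le (x i) (v i) m q)

theorem runs_fillStep {i j q : ℕ} (hκ : DataBounds κ n m mu v w x cmax) (hi : i < n) (hj : j < m)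
    (hq : q < m) (h1 : s.idx 1 0 0 = m) (hmu : s.num 2 = mu) (hv : s.num 1 = v) (hw : s.num 3 = w)
    (hx : s.num 4 = x) (h11 : s.idx 11 0 0 = i) (h12 : s.idx 12 0 0 = j) (h14 : s.idx 14 0 0 = q)
    (h10 : s.num 10 0 0 = prefixSum (x i) (v i) (range m) j) (h10g : s.num 10 0 0 ∈ κ.grid)
    (h10m : s.num 10 0 0 ≤ m)
    (hF : Filled m (slotOf m x v) (slotWeight mu v w) i j q (s.num 6) (s.num 7)) :
    Runs κ fillStep s fun s' =>
      Filled m (slotOf m x v) (slotWeight mu v w) i j (q + 1) (s'.num 6) (s'.num 7) := by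
  have hL := κ.L_le
  have hloop := hκ.loop_le
  have hm := hκ.m_le
  have hm0 : (0 : K) ≤ m := Nat.cast_nonneg m
  have hqm : (q : K) + 1 ≤ m := by exact_mod_cast hq
  have hx0 := hκ.x_nonneg i hi j hj
  have hx1 := hκ.x_le_one hi hj
  have hp0 := prefixSum_nonneg (v := v i) (hκ.x_nonneg i hi) j
  have hlt := slotIdx_lt hi hq
  have hz0 := slot_nonneg (v := v i) (hκ.x_nonneg i hi) q hj
  have hz1 := hκ.slot_le_one (q := q) hi hj
  rw [← h10] at hp0
  refine Runs.seq (Runs.setIdx ?_ ?_)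
  · simp only [IdxExpr.eval, h1, h11, h14]
    nlinarith
  refine Runs.seq ((runs_clipTo (k := q) (t := s.num 10 0 0 + x i j) ?_ ?_ (by linarith)
    (κ.grid.add_mem h10g (hκ.x_grid i hi j hj)) (by linarith) (by linarith)).mono_agree ?_)
  · simpa using h14
  · simp [NumExpr.eval, IdxExpr.eval, hx, h11, h12]
  rintro s₁ ha₁ ⟨h₁, h₁g⟩
  refine Runs.seq ((runs_clipTo (k := q) (t := s.num 10 0 0) ?_ ?_ hp0 h10g
    (by linarith) (by linarith)).mono_agree ?_)
  · rw [ha₁.idx 14 rfl]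
    simpa using h14
  · simp [NumExpr.eval, IdxExpr.eval, ha₁.num 10 rfl]
  rintro s₂ ha₂ ⟨h₂, h₂g⟩
  have e11 : s₂.num 11 0 0 = clip q (s.num 10 0 0 + x i j) := by rw [ha₂.num 11 rfl, h₁]
  have e12 : s₂.idx 12 0 0 = j := by rw [ha₂.idx 12 rfl, ha₁.idx 12 rfl]; simpa using h12
  have e17 : s₂.idx 17 0 0 = slotIdx m i q := by
    rw [ha₂.idx 17 rfl, ha₁.idx 17 rfl]
    simp [IdxExpr.eval, h1, h11, h14, slotIdx]
  have ez : s₂.num 11 0 0 - s₂.num 12 0 0 = slotOf m x v i q j := by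
    rw [e11, h₂, h10, slotOf, slot]
  have e11i : s₂.idx 11 0 0 = i := by rw [ha₂.idx 11 rfl, ha₁.idx 11 rfl]; simpa using h11
  have e1 : s₂.num 1 = v := by rw [ha₂.num 1 rfl, ha₁.num 1 rfl]; exact hv
  have e2 : s₂.num 2 = mu := by rw [ha₂.num 2 rfl, ha₁.num 2 rfl]; exact hmu
  have e3 : s₂.num 3 = w := by rw [ha₂.num 3 rfl, ha₁.num 3 rfl]; exact hw
  have e6 : s₂.num 6 = s.num 6 := by rw [ha₂.num 6 rfl, ha₁.num 6 rfl]; rfl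
  have e7 : s₂.num 7 = s.num 7 := by rw [ha₂.num 7 rfl, ha₁.num 7 rfl]; rfl
  have hzs : κ.size (slotOf m x v i q j) ≤ κ.σ := by
    refine κ.size_le _ ?_ ?_
    · rw [← ez, ha₂.num 11 rfl]
      exact κ.grid.sub_mem h₁g h₂g
    · rw [abs_of_nonneg hz0]
      linarith
  refine Runs.seq (Runs.setNum ?_ (Runs.seq (Runs.setNum ?_ (Runs.setNum ?_ ?_))))
  · simpa only [NumExpr.eval, IdxExpr.eval, ez] using hzs
  · simpa [NumExpr.eval, IdxExpr.eval, ez] using hzs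
  · simp only [NumExpr.eval, IdxExpr.eval, ne_eq, not_false_eq_true, State.setNum_num_of_ne,
      Nat.reduceEqDiff, State.setNum_idx, e11i, e12, e1, e2, e3]
    refine κ.size_le _ (hκ.slot_grid i hi j hj) ((hκ.slot_le i hi j hj).trans ?_)
    refine le_trans ?_ hκ.wt_le_big
    refine le_mul_of_one_le_left hκ.cmax_nonneg ?_
    have : (0 : K) ≤ (m + n * m : ℕ) := Nat.cast_nonneg _
    linarith
  · have := hF.step hj hq
    simpa [NumExpr.eval, IdxExpr.eval, e11i, e12, e1, e2, e3, e6, e7, e17, ez] using this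

theorem runs_fillAll (hκ : DataBounds κ n m mu v w x cmax) (h0 : s.idx 0 0 0 = n)
    (h1 : s.idx 1 0 0 = m) (hmu : s.num 2 = mu) (hv : s.num 1 = v) (hw : s.num 3 = w)
    (hx : s.num 4 = x) (h6 : ∀ r c, s.num 6 r c = 0) (h7 : ∀ r c, s.num 7 r c = 0) :
    Runs κ fillAll s fun s' =>
      Filled m (slotOf m x v) (slotWeight mu v w) n 0 0 (s'.num 6) (s'.num 7) := by
  have hloop := hκ.loop_le
  have hmL : m ≤ κ.L := by nlinarith
  refine Runs.forLoop (N := n) (fun i s' =>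
    Filled m (slotOf m x v) (slotWeight mu v w) i 0 0 (s'.num 6) (s'.num 7)) (by omega) rfl
    (fun _ _ _ h => h) ?_ ?_ ?_ (fun _ _ h => h)
  · intro s' h
    simp [IdxExpr.eval, h.idx 0 rfl, h0]
  · exact ⟨fun i j q _ _ h => by omega, fun r _ c _ => h6 r c, fun r _ c _ => h6 r c,
      fun r c _ => h7 r c, fun r _ c => h7 r c⟩
  intro i s₁ hi ha₁ h11 hI
  refine Runs.forLoop (N := m) (fun j s' =>
    Filled m (slotOf m x v) (slotWeight mu v w) i j 0 (s'.num 6) (s'.num 7)) hmL rfl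
    (fun _ _ _ h => h) ?_ hI ?_ (fun _ _ h => h.congr (by omega))
  · intro s' h
    simp [IdxExpr.eval, h.idx 1 rfl, ha₁.idx 1 rfl, h1]
  intro j s₂ hj ha₂ h12 hI
  have e11 : s₂.idx 11 0 0 = i := by rw [ha₂.idx 11 rfl, h11]
  refine Runs.seq ((runs_findPrefix (j := j) hκ hi (by rw [ha₂.idx 1 rfl, ha₁.idx 1 rfl, h1])
    (by rw [ha₂.num 1 rfl, ha₁.num 1 rfl, hv]) (by rw [ha₂.num 4 rfl, ha₁.num 4 rfl, hx])
    e11 h12).mono_agree ?_)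
  rintro s₃ ha₃ ⟨h10, h10g, h10m⟩
  refine Runs.forLoop (N := m) (fun q s' =>
    Filled m (slotOf m x v) (slotWeight mu v w) i j q (s'.num 6) (s'.num 7)) hmL rfl
    (fun _ _ _ h => h) ?_ ?_ ?_ (fun _ _ h => h.congr (by omega))
  · intro s' h
    simp [IdxExpr.eval, h.idx 1 rfl, ha₃.idx 1 rfl, ha₂.idx 1 rfl, ha₁.idx 1 rfl, h1]
  · rwa [ha₃.num 6 rfl, ha₃.num 7 rfl]
  intro q s₄ hq ha₄ h14 hI
  have e10 : s₄.num 10 = s₃.num 10 := ha₄.num 10 rfl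
  refine runs_fillStep hκ hi hj hq ?_ ?_ ?_ ?_ ?_ ?_ ?_ h14 (e10 ▸ h10) (e10 ▸ h10g) (e10 ▸ h10m) hI
  · rw [ha₄.idx 1 rfl, ha₃.idx 1 rfl, ha₂.idx 1 rfl, ha₁.idx 1 rfl, h1]
  · rw [ha₄.num 2 rfl, ha₃.num 2 rfl, ha₂.num 2 rfl, ha₁.num 2 rfl, hmu]
  · rw [ha₄.num 1 rfl, ha₃.num 1 rfl, ha₂.num 1 rfl, ha₁.num 1 rfl, hv]
  · rw [ha₄.num 3 rfl, ha₃.num 3 rfl, ha₂.num 3 rfl, ha₁.num 3 rfl, hw]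
  · rw [ha₄.num 4 rfl, ha₃.num 4 rfl, ha₂.num 4 rfl, ha₁.num 4 rfl, hx]
  · rw [ha₄.idx 11 rfl, ha₃.idx 11 rfl, e11]
  · rw [ha₄.idx 12 rfl, ha₃.idx 12 rfl, h12]

end Algorithm

end BAVWM

/-! ### The diagonal, the weights for the hat part, and the output -/

namespace BAVWM

open Finset

namespace Algorithm

/-- Complete the rows of the matrix by diagonal entries. -/
def fillDiagonal : Prog :=
  .forLoop 11 (.var 10) <|
  .seq (.letNum 11 (lit 1)) <|
  .seq (.forLoop 12 (.var 10) (.letNum 11 (.sub (.var 11) (mat (.var 11) (.var 12))))) <|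
    .setNum 6 (.var 11) (.var 11) (.var 11)

/-- Set the weights of the diagonal entries of the items to the largest virtual values, or to zero if
these are negative; index array `4` holds one plus a bidder of largest virtual value, or zero. -/
def fillWeights : Prog :=
  .forLoop 12 (.var 1) <| .forLoop 11 (.var 0) <|
    .branch (.numLe (wt (.var 12) (.var 12)) (.load 3 (.var 11) (.var 12)))
      (.seq (.setNum 7 (.var 12) (.var 12) (.load 3 (.var 11) (.var 12)))
        (.setIdx 4 (.var 12) (.const 0) (.add (.var 11) (.const 1)))) .skip

/-- Read off the bar part of the assignment. -/
def readBar : Prog :=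
  .forLoop 11 (.var 0) <| .forLoop 12 (.var 1) <| .forLoop 14 (.var 1) <|
    .branch (.numLe (lit 1)
        (mat (.var 12) (.add (.var 1) (.add (.mul (.var 11) (.var 1)) (.var 14)))))
      (.setIdx 2 (.var 11) (.var 12) (.add (.load 2 (.var 11) (.var 12)) (.const 1))) .skip

/-- Read off the hat part of the assignment. -/
def readHat : Prog :=
  .forLoop 12 (.var 1) <|
    .branch (.and (.numLe (lit 1) (mat (.var 12) (.var 12)))
        (.idxLe (.const 1) (.load 4 (.var 12) (.const 0))))
      (.setIdx 3 (.sub (.load 4 (.var 12) (.const 0)) (.const 1)) (.var 12) (.const 1)) .skip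

/-- The rounding algorithm. -/
def main : Prog :=
  .seq (.letIdx 10 (.add (.var 1) (.mul (.var 0) (.var 1)))) <|
  .seq fillAll <| .seq fillDiagonal <| .seq fillWeights <| .seq roundAll <| .seq readBar readHat

variable {K : Type} [Field K] [LinearOrder K] {κ : CostModel K} {s : State K}

/-- Complete the rows of the leading `N × N` block by diagonal entries. -/
def complete (N : ℕ) (A : ℕ → ℕ → K) (r c : ℕ) : K :=
  if r = c then 1 - ∑ c ∈ range N, A r c else A r c

variable [IsStrictOrderedRing K]

theorem runs_fillDiagonal {N : ℕ} {A : ℕ → ℕ → K} (hN : N ≤ κ.L) (hb : (N + 1 : K) ≤ κ.big)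
    (h10 : s.idx 10 0 0 = N) (h6 : s.num 6 = A) (hg : ∀ r < N, ∀ c < N, A r c ∈ κ.grid)
    (hA : ∀ r < N, ∀ c < N, |A r c| ≤ 1) :
    Runs κ fillDiagonal s fun s' =>
      ∀ r c, s'.num 6 r c = if r < N then complete N A r c else A r c := by
  -- Row `k` is altered only in its diagonal entry and only after its sum has been formed, so every
  -- sum is one of original entries.
  refine Runs.forLoop (N := N) (fun k s' =>
    ∀ r c, s'.num 6 r c = if r < k then complete N A r c else A r c) hN rfl (fun _ _ _ h => h) ?_
    (by simp [h6]) ?_ (fun _ _ h => h)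
  · intro s' h
    simp [IdxExpr.eval, h.idx 10 rfl, h10]
  intro k s₁ hk ha₁ h11 hI
  have hN0 : (0 : K) ≤ N := Nat.cast_nonneg N
  refine Runs.seq (Runs.setNum ?_ ?_)
  · refine κ.size_le _ (by simpa [NumExpr.eval, IdxExpr.eval] using κ.one_mem) ?_
    simp [NumExpr.eval, IdxExpr.eval]
    linarith
  refine Runs.seq (Runs.forLoop (N := N) (fun l s' => s'.num 11 0 0 = 1 - ∑ c ∈ range l, A k c ∧
    s'.num 11 0 0 ∈ κ.grid ∧ |s'.num 11 0 0| ≤ 1 + l) hN rfl (fun _ _ _ h => h) ?_ ?_ ?_ ?_)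
  · intro s' h
    simp [IdxExpr.eval, h.idx 10 rfl, ha₁.idx 10 rfl, h10]
  · simpa [NumExpr.eval, IdxExpr.eval] using κ.one_mem
  · rintro l s₂ hl ha₂ h12 ⟨h1, h2, h3⟩
    have e : NumExpr.eval s₂ (.sub (.var 11) (mat (.var 11) (.var 12))) =
        s₂.num 11 0 0 - A k l := by
      have e6 : s₂.num 6 = s₁.num 6 := by rw [ha₂.num 6 rfl]; rfl
      have e11 : s₂.idx 11 0 0 = k := by rw [ha₂.idx 11 rfl]; exact h11
      simp [NumExpr.eval, IdxExpr.eval, e6, e11, h12, hI]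
    have hg' : s₂.num 11 0 0 - A k l ∈ κ.grid := κ.grid.sub_mem h2 (hg k hk l hl)
    have hb' : |s₂.num 11 0 0 - A k l| ≤ 1 + (l + 1 : ℕ) := by
      have := abs_sub (s₂.num 11 0 0) (A k l)
      have := hA k hk l hl
      push_cast
      linarith
    have hlN : ((l + 1 : ℕ) : K) ≤ N := by exact_mod_cast hl
    refine Runs.setNum ?_ ?_
    · rw [e]
      exact κ.size_le _ hg' (by linarith)
    · rw [e]
      simp only [IdxExpr.eval, State.setNum_num_self, upd_self]
      refine ⟨?_, hg', hb'⟩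
      rw [h1, sum_range_succ]
      ring
  · rintro s₂ ha₂ ⟨h1, h2, h3⟩
    have e6 : s₂.num 6 = s₁.num 6 := by rw [ha₂.num 6 rfl]; rfl
    have e11 : s₂.idx 11 0 0 = k := by rw [ha₂.idx 11 rfl]; exact h11
    refine Runs.setNum ?_ ?_
    · simp only [NumExpr.eval, IdxExpr.eval]
      exact κ.size_le _ h2 (by linarith)
    · intro r c
      simp only [NumExpr.eval, IdxExpr.eval, State.setNum_num_self, e11, e6, h1, upd_apply, hI]
      by_cases hrc : r = k ∧ c = k
      · simp [hrc, complete]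
      · rw [if_neg hrc]
        by_cases hr : r < k
        · simp [hr, hr.trans (Nat.lt_succ_self k)]
        · rw [if_neg hr]
          split_ifs with hr'
          · obtain rfl : r = k := by omega
            rw [complete, if_neg fun h => hrc ⟨rfl, h.symm⟩]
          · rfl

/-- The diagonal weights of the items are the positive parts of the largest virtual values, and
`best` points to bidders who attain them. -/
structure BestVirtual (n m : ℕ) (w C : ℕ → ℕ → K) (best : ℕ → ℕ) : Prop where
  nonneg : ∀ j < m, 0 ≤ C j j
  ge : ∀ j < m, ∀ i < n, w i j ≤ C j j
  attained : ∀ j < m, (best j = 0 ∧ C j j = 0) ∨ ∃ i < n, best j = i + 1 ∧ C j j = w i j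

variable {n m : ℕ} {mu v w x : ℕ → ℕ → K} {cmax : K}

/-- The running maximum starts from the zero already stored on the diagonal. Pointers are shifted by
one so that zero can mean that the item stays unassigned. -/
theorem runs_fillWeights {C : ℕ → ℕ → K} (hκ : DataBounds κ n m mu v w x cmax)
    (h0 : s.idx 0 0 0 = n) (h1 : s.idx 1 0 0 = m) (hw : s.num 3 = w) (h7 : s.num 7 = C)
    (hC : ∀ j < m, C j j = 0) (h4 : ∀ j, s.idx 4 j 0 = 0) :
    Runs κ fillWeights s fun s' => (∀ r c, r ≠ c ∨ m ≤ r → s'.num 7 r c = C r c) ∧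
      BestVirtual n m w (s'.num 7) (fun j => s'.idx 4 j 0) := by
  have hL := κ.L_le
  have hloop := hκ.loop_le
  have hmL : m ≤ κ.L := by nlinarith
  have hbig : cmax ≤ κ.big := by
    refine le_trans ?_ hκ.wt_le_big
    refine le_mul_of_one_le_left hκ.cmax_nonneg ?_
    have : (0 : K) ≤ (m + n * m : ℕ) := Nat.cast_nonneg _
    linarith
  let Inv (j i : ℕ) (s' : State K) : Prop :=
    (∀ r c, r ≠ c ∨ m ≤ r → s'.num 7 r c = C r c) ∧
    (∀ q < m, 0 ≤ s'.num 7 q q) ∧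
    (∀ q < m, ∀ p < n, (q < j ∨ q = j ∧ p < i) → w p q ≤ s'.num 7 q q) ∧
    ∀ q < m, (s'.idx 4 q 0 = 0 ∧ s'.num 7 q q = 0) ∨
      ∃ p < n, s'.idx 4 q 0 = p + 1 ∧ s'.num 7 q q = w p q
  refine Runs.forLoop (N := m) (fun j => Inv j 0) hmL rfl ?_ ?_ ?_ ?_ ?_
  · intro k s' y h
    simpa [Inv] using h
  · intro s' h
    simp [IdxExpr.eval, h.idx 1 rfl, h1]
  · refine ⟨fun r c _ => by rw [h7], fun q hq => by rw [h7, hC q hq], fun q _ p _ h => by omega,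
      fun q hq => Or.inl ⟨h4 q, by rw [h7, hC q hq]⟩⟩
  · intro j s₁ hj ha₁ h12 hI
    refine Runs.forLoop (N := n) (fun i => Inv j i) (by omega) rfl ?_ ?_ hI ?_ ?_
    · intro k s' y h
      simpa [Inv] using h
    · intro s' h
      simp [IdxExpr.eval, h.idx 0 rfl, ha₁.idx 0 rfl, h0]
    · rintro i s₂ hi ha₂ h11 ⟨I1, I2, I3, I4⟩
      have e12 : s₂.idx 12 0 0 = j := by rw [ha₂.idx 12 rfl, h12]
      have e3 : s₂.num 3 = w := by rw [ha₂.num 3 rfl, ha₁.num 3 rfl, hw]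
      refine Runs.branch (fun h => ?_) (fun h => Runs.skip ?_)
      · have h : s₂.num 7 j j ≤ w i j := by
          simpa [Test.Holds, NumExpr.eval, IdxExpr.eval, e12, e3, h11] using h
        refine Runs.seq (Runs.setNum ?_ (Runs.setIdx ?_ ?_))
        · simp only [NumExpr.eval, IdxExpr.eval, e12, e3, h11]
          exact κ.size_le _ (hκ.virt_grid i hi j hj) ((hκ.virt_le i hi j hj).trans hbig)
        · simp [IdxExpr.eval, h11]
          omega
        · simp only [Inv, NumExpr.eval, IdxExpr.eval, e12, e3, h11, State.setIdx_num,
            State.setNum_num_self, State.setNum_idx, State.setIdx_idx_self, upd_apply, and_self,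
            and_true]
          refine ⟨?_, ?_, ?_, ?_⟩
          · intro r c hrc
            rw [if_neg (by omega)]
            exact I1 r c hrc
          · intro q hq
            split_ifs with hqj
            · exact (I2 j hj).trans h
            · exact I2 q hq
          · intro q hq p hp hpq
            split_ifs with hqj
            · subst hqj
              by_cases hpi : p = i
              · rw [hpi]
              · exact (I3 q hq p hp (by omega)).trans h
            · exact I3 q hq p hp (by omega)
          · intro q hq
            by_cases hqj : q = j
            · subst hqj
              simp only [if_true]
              exact Or.inr ⟨i, hi, rfl, rfl⟩
            · simp only [hqj, if_false]
              exact I4 q hq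
      · have h : ¬ s₂.num 7 j j ≤ w i j := by
          simpa [Test.Holds, NumExpr.eval, IdxExpr.eval, e12, e3, h11] using h
        refine ⟨I1, I2, fun q hq p hp hpq => ?_, I4⟩
        by_cases hpi : q = j ∧ p = i
        · rw [hpi.1, hpi.2]
          exact (not_le.1 h).le
        · exact I3 q hq p hp (by omega)
    · rintro s' - ⟨I1, I2, I3, I4⟩
      exact ⟨I1, I2, fun q hq p hp hpq => I3 q hq p hp (by omega), I4⟩
  · rintro s' - ⟨I1, I2, I3, I4⟩
    exact ⟨I1, I2, fun q hq p hp => I3 q hq p hp (by omega), I4⟩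

/-- Number of slots of bidder `i` that contain item `j`. -/
def barOf (m : ℕ) (A : ℕ → ℕ → K) (i j : ℕ) : ℕ :=
  ∑ q ∈ range m, if 1 ≤ A j (slotIdx m i q) then 1 else 0

theorem runs_readBar {A : ℕ → ℕ → K} (hn : n ≤ κ.L) (hm : m ≤ κ.L) (h0 : s.idx 0 0 0 = n)
    (h1 : s.idx 1 0 0 = m) (h6 : s.num 6 = A) (h2 : ∀ i j, s.idx 2 i j = 0) :
    Runs κ readBar s fun s' => ∀ i < n, ∀ j < m, s'.idx 2 i j = barOf m A i j := by
  have hL := κ.L_le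
  refine Runs.forLoop (N := n) (fun k s' => ∀ i j, s'.idx 2 i j =
    if i < k ∧ j < m then barOf m A i j else 0) hn rfl ?_ ?_ (by simp [h2]) ?_ ?_
  · intro k s' y h
    simpa using h
  · intro s' h
    simp [IdxExpr.eval, h.idx 0 rfl, h0]
  · intro k s₁ hk ha₁ h11 hI
    refine Runs.forLoop (N := m) (fun l s' => ∀ i j, s'.idx 2 i j =
      if (i < k ∨ i = k ∧ j < l) ∧ j < m then barOf m A i j else 0) hm rfl ?_ ?_ (by simpa using hI)
      ?_ ?_
    · intro k s' y h
      simpa using h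
    · intro s' h
      simp [IdxExpr.eval, h.idx 1 rfl, ha₁.idx 1 rfl, h1]
    · intro l s₂ hl ha₂ h12 hI
      refine Runs.forLoop (N := m) (fun t s' => ∀ i j, s'.idx 2 i j =
        if i = k ∧ j = l then ∑ q ∈ range t, (if 1 ≤ A j (slotIdx m i q) then 1 else 0)
          else s₂.idx 2 i j) hm rfl ?_ ?_ ?_ ?_ ?_
      · intro k s' y h
        simpa using h
      · intro s' h
        simp [IdxExpr.eval, h.idx 1 rfl, ha₂.idx 1 rfl, ha₁.idx 1 rfl, h1]
      · intro i j
        split_ifs with h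
        · simp [hI, h.1, h.2]
        · rfl
      · intro t s₃ ht ha₃ h14 hI'
        have e6 : s₃.num 6 = A := by rw [ha₃.num 6 rfl, ha₂.num 6 rfl, ha₁.num 6 rfl, h6]
        have e1 : s₃.idx 1 0 0 = m := by rw [ha₃.idx 1 rfl, ha₂.idx 1 rfl, ha₁.idx 1 rfl, h1]
        have e11 : s₃.idx 11 0 0 = k := by rw [ha₃.idx 11 rfl, ha₂.idx 11 rfl, h11]
        have e12 : s₃.idx 12 0 0 = l := by rw [ha₃.idx 12 rfl, h12]
        -- Needed only to bound the stored counter; that it is at most one follows later from the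
        -- row sums.
        have hle : ∑ q ∈ range t, (if 1 ≤ A l (slotIdx m k q) then 1 else 0) ≤ t := by
          simpa using card_filter_le (range t) fun q => 1 ≤ A l (slotIdx m k q)
        have hkl := hI' k l
        simp only [and_self, if_true] at hkl
        refine Runs.branch (fun h => Runs.setIdx ?_ ?_) (fun h => Runs.skip ?_)
        · simp only [IdxExpr.eval, e11, e12, hkl]
          omega
        · have h : 1 ≤ A l (slotIdx m k t) := by
            simpa [Test.Holds, NumExpr.eval, IdxExpr.eval, e6, e1, e11, e12, h14] using h
          intro i j
          simp only [IdxExpr.eval, e11, e12, hkl, State.setIdx_idx_self, upd_apply, hI']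
          split_ifs with hij
          · rw [hij.1, hij.2, sum_range_succ, if_pos h]
          · rfl
        · have h : ¬ 1 ≤ A l (slotIdx m k t) := by
            simpa [Test.Holds, NumExpr.eval, IdxExpr.eval, e6, e1, e11, e12, h14] using h
          intro i j
          rw [hI']
          split_ifs with hij
          · rw [hij.1, hij.2, sum_range_succ, if_neg h, add_zero]
          · rfl
      · intro s' _ h i j
        rw [h, hI]
        by_cases hij : i = k ∧ j = l
        · simp [hij, hl, barOf]
        · rw [if_neg hij]
          congr 1
          simp only [eq_iff_iff]
          omega
    · intro s' _ h i j
      rw [h]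
      congr 1
      simp only [eq_iff_iff]
      omega
  · intro s' _ h i hi j hj
    rw [h, if_pos ⟨hi, hj⟩]

theorem runs_readHat {A : ℕ → ℕ → K} {best : ℕ → ℕ} (hm : m ≤ κ.L)
    (h1 : s.idx 1 0 0 = m) (h6 : s.num 6 = A) (h4 : ∀ j < m, s.idx 4 j 0 = best j)
    (h3 : ∀ i j, s.idx 3 i j = 0) :
    Runs κ readHat s fun s' => ∀ i, ∀ j < m,
      s'.idx 3 i j = if 1 ≤ A j j ∧ best j = i + 1 then 1 else 0 := by
  have hL := κ.L_le
  refine Runs.forLoop (N := m) (fun l s' => ∀ i j, s'.idx 3 i j =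
    if j < l ∧ 1 ≤ A j j ∧ best j = i + 1 then 1 else 0) hm rfl ?_ ?_ (by simp [h3]) ?_ ?_
  · intro k s' y h
    simpa using h
  · intro s' h
    simp [IdxExpr.eval, h.idx 1 rfl, h1]
  · intro l s₁ hl ha₁ h12 hI
    have e6 : s₁.num 6 = A := by rw [ha₁.num 6 rfl, h6]
    have e4 : s₁.idx 4 l 0 = best l := by rw [ha₁.idx 4 rfl, h4 l hl]
    refine Runs.branch (fun h => Runs.setIdx ?_ ?_) (fun h => Runs.skip ?_)
    · simp only [IdxExpr.eval]
      exact κ.one_le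
    · have h : 1 ≤ A l l ∧ 1 ≤ best l := by
        simpa [Test.Holds, NumExpr.eval, IdxExpr.eval, e6, e4, h12] using h
      intro i j
      simp only [IdxExpr.eval, e4, h12, State.setIdx_idx_self, upd_apply, hI]
      by_cases hij : i = best l - 1 ∧ j = l
      -- The guard `1 ≤ best l` makes the truncated subtraction `best l - 1` exact.
      · rw [if_pos hij, if_pos]
        obtain ⟨rfl, rfl⟩ := hij
        exact ⟨by omega, h.1, by omega⟩
      · rw [if_neg hij]
        congr 1
        simp only [eq_iff_iff]
        constructor
        · rintro ⟨h1, h2⟩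
          exact ⟨by omega, h2⟩
        · rintro ⟨h1, h2, h3⟩
          refine ⟨?_, h2, h3⟩
          rcases Nat.lt_succ_iff_lt_or_eq.1 h1 with h1 | rfl
          · exact h1
          · exact absurd ⟨by omega, rfl⟩ hij
    · have h : ¬ (1 ≤ A l l ∧ 1 ≤ best l) := by
        simpa [Test.Holds, NumExpr.eval, IdxExpr.eval, e6, e4, h12] using h
      intro i j
      rw [hI]
      congr 1
      simp only [eq_iff_iff]
      constructor
      · rintro ⟨h1, h2⟩
        exact ⟨by omega, h2⟩
      · rintro ⟨h1, h2, h3⟩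
        refine ⟨?_, h2, h3⟩
        rcases Nat.lt_succ_iff_lt_or_eq.1 h1 with h1 | rfl
        · exact h1
        · exact absurd ⟨h2, by omega⟩ h
  · intro s' _ h i j hj
    rw [h]
    simp [hj]

end Algorithm

end BAVWM

namespace BAVWM

open Finset

namespace Algorithm

/-! ### Analysis of the algorithm -/

variable {K : Type} [Field K] [LinearOrder K]

theorem sum_range_mul {M : Type} [AddCommMonoid M] (f : ℕ → M) (n m : ℕ) :
    ∑ c ∈ range (n * m), f c = ∑ i ∈ range n, ∑ q ∈ range m, f (i * m + q) := by
  induction n with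
  | zero => simp
  | succ n ih => rw [Nat.succ_mul, sum_range_add, ih, sum_range_succ]

theorem sum_range_slotIdx {M : Type} [AddCommMonoid M] (f : ℕ → M) (n m : ℕ) :
    ∑ c ∈ range (m + n * m), f c =
      ∑ c ∈ range m, f c + ∑ i ∈ range n, ∑ q ∈ range m, f (slotIdx m i q) := by
  rw [sum_range_add, sum_range_mul fun c => f (m + c)]

/-- The diagonal absorbs the deficit of each row; by symmetry the columns have the same deficits.
This is why the fractions are stored in both off-diagonal blocks. -/
theorem complete_stochastic [IsStrictOrderedRing K] {N : ℕ} {A : ℕ → ℕ → K}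
    (h0 : ∀ r < N, ∀ c < N, 0 ≤ A r c) (hd : ∀ r < N, A r r = 0)
    (hs : ∀ r < N, ∀ c < N, A r c = A c r) (hr : ∀ r < N, ∑ c ∈ range N, A r c ≤ 1) :
    DoublyStochastic N (complete N A) := by
  have hrow : ∀ r < N, ∑ c ∈ range N, complete N A r c = 1 := by
    intro r hrN
    have : ∀ c ∈ range N, complete N A r c =
        (if r = c then 1 - ∑ c ∈ range N, A r c else 0) + A r c := by
      intro c _
      rw [complete]
      split_ifs with h
      · rw [← h, hd r hrN, add_zero]
      · rw [zero_add]
    rw [sum_congr rfl this, sum_add_distrib, sum_ite_eq, if_pos (mem_range.2 hrN)]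
    ring
  have hsymm : ∀ r < N, ∀ c < N, complete N A r c = complete N A c r := by
    intro r hr c hc
    by_cases h : r = c
    · rw [h]
    · rw [complete, complete, if_neg h, if_neg (Ne.symm h), hs r hr c hc]
  refine ⟨fun r hrN c hc => ?_, hrow, fun c hc => ?_⟩
  · rw [complete]
    split_ifs
    · exact sub_nonneg.2 (hr r hrN)
    · exact h0 r hrN c hc
  · rw [← hrow c hc]
    exact sum_congr rfl fun r hr => hsymm r (mem_range.1 hr) c hc

theorem _root_.BAVWM.DoublyStochastic.congr {N : ℕ} {A B : ℕ → ℕ → K} (hA : DoublyStochastic N A)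
    (h : ∀ r < N, ∀ c < N, B r c = A r c) : DoublyStochastic N B := by
  refine ⟨fun r hr c hc => ?_, fun r hr => ?_, fun c hc => ?_⟩
  · rw [h r hr c hc]
    exact hA.nonneg r hr c hc
  · rw [← hA.row r hr]
    exact sum_congr rfl fun c hc => h r hr c (mem_range.1 hc)
  · rw [← hA.col c hc]
    exact sum_congr rfl fun r hr => h r (mem_range.1 hr) c hc

variable {κ : CostModel K} {s : State K} {n m : ℕ} {mu v w x : ℕ → ℕ → K} {cmax : K}
  {A C : ℕ → ℕ → K}

variable [IsStrictOrderedRing K]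

/-- Clipping selects one of `t`, `q` and `q + 1`, so cutting into slots introduces no new
denominators. -/
theorem clip_mem_grid {t : K} (ht : t ∈ κ.grid) (q : ℕ) : clip q t ∈ κ.grid := by
  have hq := natCast_mem_grid κ q
  rw [clip]
  rcases min_choice (max t (q : K)) (q + 1) with h | h <;> rw [h]
  · rcases max_choice t (q : K) with h | h <;> rwa [h]
  · exact κ.grid.add_mem hq κ.one_mem

theorem DataBounds.slot_mem_grid (h : DataBounds κ n m mu v w x cmax) {i j : ℕ} (hi : i < n)
    (hj : j < m) (q : ℕ) : slotOf m x v i q j ∈ κ.grid := by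
  have hp : prefixSum (x i) (v i) (range m) j ∈ κ.grid := by
    refine κ.grid.sum_mem fun q hq => ?_
    split_ifs
    · exact h.x_grid i hi q (mem_range.1 hq)
    · exact κ.grid.zero_mem
  exact κ.grid.sub_mem (clip_mem_grid (κ.grid.add_mem hp (h.x_grid i hi j hj)) q)
    (clip_mem_grid hp q)

/-- Entries of the matrix that is filled in completely. -/
theorem Filled.cases (h : Filled m (slotOf m x v) (slotWeight mu v w) n 0 0 A C) {r c : ℕ}
    (hr : r < m + n * m) (hc : c < m + n * m) (P : K → Prop) (h0 : P 0)
    (hz : ∀ i < n, ∀ q < m, ∀ j < m, P (slotOf m x v i q j)) : P (A r c) := by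
  rcases lt_or_ge r m with h1 | h1 <;> rcases lt_or_ge c m with h2 | h2
  · rwa [h.item r h1 c h2]
  · obtain ⟨i, hi, q, hq, rfl⟩ := exists_slotIdx h2 hc
    rw [(h.entry i r q h1 hq (Or.inl hi)).1]
    exact hz i hi q hq r h1
  · obtain ⟨i, hi, q, hq, rfl⟩ := exists_slotIdx h1 hr
    rw [(h.entry i c q h2 hq (Or.inl hi)).2.1]
    exact hz i hi q hq c h2
  · rwa [h.slot r h1 c h2]

theorem Filled.symm (h : Filled m (slotOf m x v) (slotWeight mu v w) n 0 0 A C) {r c : ℕ}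
    (hr : r < m + n * m) (hc : c < m + n * m) : A r c = A c r := by
  rcases lt_or_ge r m with h1 | h1 <;> rcases lt_or_ge c m with h2 | h2
  · rw [h.item r h1 c h2, h.item c h2 r h1]
  · obtain ⟨i, hi, q, hq, rfl⟩ := exists_slotIdx h2 hc
    obtain ⟨h3, h4, -⟩ := h.entry i r q h1 hq (Or.inl hi)
    rw [h3, h4]
  · obtain ⟨i, hi, q, hq, rfl⟩ := exists_slotIdx h1 hr
    obtain ⟨h3, h4, -⟩ := h.entry i c q h2 hq (Or.inl hi)
    rw [h3, h4]
  · rw [h.slot r h1 c h2, h.slot c h2 r h1]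

theorem Filled.diag (h : Filled m (slotOf m x v) (slotWeight mu v w) n 0 0 A C) (r : ℕ) :
    A r r = 0 := by
  rcases lt_or_ge r m with h1 | h1
  · exact h.item r h1 r h1
  · exact h.slot r h1 r h1

theorem Filled.row_item (h : Filled m (slotOf m x v) (slotWeight mu v w) n 0 0 A C)
    (hκ : DataBounds κ n m mu v w x cmax) {j : ℕ} (hj : j < m) :
    ∑ c ∈ range (m + n * m), A j c = ∑ i ∈ range n, x i j := by
  rw [sum_range_slotIdx, sum_eq_zero fun c hc => h.item j hj c (mem_range.1 hc), zero_add]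
  refine sum_congr rfl fun i hi => ?_
  have hi := mem_range.1 hi
  rw [← sum_slot_slots (v := v i) (hκ.x_nonneg i hi) (fun j hj => hκ.x_le_one hi hj) hj]
  exact sum_congr rfl fun q hq => (h.entry i j q hj (mem_range.1 hq) (Or.inl hi)).1

/-- For items this is the constraint of the linear program, for slots it is their unit length. -/
theorem Filled.row_le (h : Filled m (slotOf m x v) (slotWeight mu v w) n 0 0 A C)
    (hκ : DataBounds κ n m mu v w x cmax) {r : ℕ} (hr : r < m + n * m) :
    ∑ c ∈ range (m + n * m), A r c ≤ 1 := by
  rcases lt_or_ge r m with h1 | h1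
  · rw [h.row_item hκ h1]
    exact hκ.item r h1
  · rw [sum_range_slotIdx, sum_eq_zero (s := range n), add_zero]
    · obtain ⟨i, hi, q, hq, rfl⟩ := exists_slotIdx h1 hr
      refine le_trans (le_of_eq ?_) (sum_slot_items_le (x i) (v i) m q)
      exact sum_congr rfl fun j hj => (h.entry i j q (mem_range.1 hj) hq (Or.inl hi)).2.1
    · intro i _
      exact sum_eq_zero fun q _ => h.slot r h1 _ (Nat.le_add_right _ _)

theorem Filled.stochastic (h : Filled m (slotOf m x v) (slotWeight mu v w) n 0 0 A C)
    (hκ : DataBounds κ n m mu v w x cmax) :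
    DoublyStochastic (m + n * m) (complete (m + n * m) A) :=
  complete_stochastic
    (fun _ hr _ hc => h.cases hr hc (fun a => 0 ≤ a) le_rfl fun i hi q _ _ hj =>
      slot_nonneg (hκ.x_nonneg i hi) q hj)
    (fun r _ => h.diag r) (fun _ hr _ hc => h.symm hr hc) fun _ hr => h.row_le hκ hr

theorem Filled.mem_grid (h : Filled m (slotOf m x v) (slotWeight mu v w) n 0 0 A C)
    (hκ : DataBounds κ n m mu v w x cmax) {r c : ℕ} (hr : r < m + n * m) (hc : c < m + n * m) :
    A r c ∈ κ.grid :=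
  h.cases hr hc (fun a => a ∈ κ.grid) κ.grid.zero_mem fun _ hi q _ _ hj =>
    hκ.slot_mem_grid hi hj q

theorem Filled.abs_le_one (h : Filled m (slotOf m x v) (slotWeight mu v w) n 0 0 A C)
    (hκ : DataBounds κ n m mu v w x cmax) {r c : ℕ} (hr : r < m + n * m) (hc : c < m + n * m) :
    |A r c| ≤ 1 :=
  h.cases hr hc (fun a => |a| ≤ 1) (by simp) fun i hi q _ j hj => by
    rw [abs_of_nonneg (slot_nonneg (hκ.x_nonneg i hi) q hj)]
    exact hκ.slot_le_one hi hj

/-- What the algorithm has computed in the end: the doubly stochastic matrix `A`, its rounding `B`, the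
weights `C`, and bidders of largest virtual value. -/
structure Computed (κ : CostModel K) (n m : ℕ) (mu v w x A B C : ℕ → ℕ → K) (best : ℕ → ℕ) :
    Prop where
  entry : ∀ i < n, ∀ q < m, ∀ j < m, A j (slotIdx m i q) = slotOf m x v i q j
  diag : ∀ j < m, A j j = 1 - ∑ i ∈ range n, x i j
  wt_entry : ∀ i < n, ∀ q < m, ∀ j < m, C j (slotIdx m i q) = slotWeight mu v w i j
  wt_item : ∀ j < m, ∀ c < m, j ≠ c → C j c = 0
  wt_slot : ∀ r ≥ m, ∀ c, C r c = 0
  improves : Improves κ (m + n * m) C A B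
  integral : Integral (m + n * m) B
  best : BestVirtual n m w C best

theorem runs_main (hκ : DataBounds κ n m mu v w x cmax) (h0 : s.idx 0 0 0 = n)
    (h1 : s.idx 1 0 0 = m) (hmu : s.num 2 = mu) (hv : s.num 1 = v) (hw : s.num 3 = w)
    (hx : s.num 4 = x) (h6 : ∀ r c, s.num 6 r c = 0) (h7 : ∀ r c, s.num 7 r c = 0)
    (hz : ∀ a, 2 ≤ a → ∀ i j, s.idx a i j = 0) :
    Runs κ main s fun s' => ∃ A B C best, Computed κ n m mu v w x A B C best ∧
      (∀ i < n, ∀ j < m, s'.idx 2 i j = barOf m B i j) ∧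
      ∀ i < n, ∀ j < m, s'.idx 3 i j = if 1 ≤ B j j ∧ best j = i + 1 then 1 else 0 := by
  have hL := κ.L_le
  have hloop := hκ.loop_le
  have hN : m + n * m ≤ κ.L := by nlinarith
  refine Runs.seq (Runs.setIdx (by simp only [IdxExpr.eval, h0, h1]; omega) ?_)
  simp only [IdxExpr.eval, h0, h1]
  refine Runs.seq ((runs_fillAll (s := s.setIdx 10 0 0 (m + n * m)) hκ (by simpa using h0) (by simpa using h1)
    hmu hv hw hx h6 h7).mono_agree ?_)
  intro s₁ ha₁ hF
  have hb : ((m + n * m : ℕ) + 1 : K) ≤ κ.big := by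
    refine le_trans ?_ hκ.le_big
    have : (0 : K) ≤ (m + n * m : ℕ) := Nat.cast_nonneg _
    linarith
  refine Runs.seq ((runs_fillDiagonal (N := m + n * m) hN hb (by rw [ha₁.idx 10 rfl]; simp) rfl
    (fun _ hr _ hc => hF.mem_grid hκ hr hc) (fun _ hr _ hc => hF.abs_le_one hκ hr hc)).mono_agree ?_)
  intro s₂ ha₂ hD
  refine Runs.seq ((runs_fillWeights (C := s₁.num 7) hκ
    (by rw [ha₂.idx 0 rfl, ha₁.idx 0 rfl]; simpa using h0)
    (by rw [ha₂.idx 1 rfl, ha₁.idx 1 rfl]; simpa using h1)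
    (by rw [ha₂.num 3 rfl, ha₁.num 3 rfl]; simpa using hw) (ha₂.num 7 rfl)
    (fun j hj => hF.wt_item j j hj) ?_).mono_agree ?_)
  · intro j
    rw [ha₂.idx 4 rfl, ha₁.idx 4 rfl]
    simp [hz]
  rintro s₃ ha₃ ⟨hC, hbest⟩
  have e6 : s₃.num 6 = s₂.num 6 := ha₃.num 6 rfl
  have hDS : DoublyStochastic (m + n * m) (s₃.num 6) := by
    refine (hF.stochastic hκ).congr fun r hr c _ => ?_
    rw [e6, hD, if_pos hr]
  have hentry : ∀ i < n, ∀ q < m, ∀ j < m, s₃.num 7 j (slotIdx m i q) = slotWeight mu v w i j := by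
    intro i hi q hq j hj
    rw [hC _ _ (Or.inl (by rw [slotIdx]; omega)), (hF.entry i j q hj hq (Or.inl hi)).2.2]
  have hitem : ∀ j < m, ∀ c < m, j ≠ c → s₃.num 7 j c = 0 := by
    intro j hj c hc hne
    rw [hC _ _ (Or.inl hne), hF.wt_item j c hc]
  have hslot : ∀ r ≥ m, ∀ c, s₃.num 7 r c = 0 := by
    intro r hr c
    rw [hC _ _ (Or.inr hr), hF.wt_slot r hr c]
  have hwt : ∀ r < m + n * m, ∀ c < m + n * m,
      s₃.num 7 r c ∈ κ.grid ∧ |s₃.num 7 r c| ≤ cmax := by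
    intro r hr c hc
    rcases lt_or_ge r m with h1 | h1
    · rcases lt_or_ge c m with h2 | h2
      · by_cases hrc : r = c
        · subst hrc
          rcases hbest.attained r h1 with ⟨-, h⟩ | ⟨i, hi, -, h⟩
          · rw [h]
            exact ⟨κ.grid.zero_mem, by simpa using hκ.cmax_nonneg⟩
          · rw [h]
            exact ⟨hκ.virt_grid i hi r h1, hκ.virt_le i hi r h1⟩
        · rw [hitem r h1 c h2 hrc]
          exact ⟨κ.grid.zero_mem, by simpa using hκ.cmax_nonneg⟩
      · obtain ⟨i, hi, q, hq, rfl⟩ := exists_slotIdx h2 hc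
        rw [hentry i hi q hq r h1]
        exact ⟨hκ.slot_grid i hi r h1, hκ.slot_le i hi r h1⟩
    · rw [hslot r h1]
      exact ⟨κ.grid.zero_mem, by simpa using hκ.cmax_nonneg⟩
  have hfits : Fits κ (m + n * m) (s₃.num 7) cmax :=
    ⟨by omega, hκ.le_big, hκ.wt_le_big, fun r hr c hc => (hwt r hr c hc).1,
      fun r hr c hc => (hwt r hr c hc).2⟩
  have hcol : ∀ r < m + n * m, ∀ c < m + n * m, s₃.num 6 r c ∈ κ.grid := by
    intro r hr c hc
    rw [e6, hD, if_pos hr, complete]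
    split_ifs
    · exact κ.grid.sub_mem κ.one_mem (κ.grid.sum_mem fun c hc => hF.mem_grid hκ hr (mem_range.1 hc))
    · exact hF.mem_grid hκ hr hc
  refine Runs.seq ((runs_roundAll hfits rfl rfl ?_ ?_ hDS hcol).mono_agree ?_)
  · rw [ha₃.idx 10 rfl, ha₂.idx 10 rfl, ha₁.idx 10 rfl]
    simp
  · intro i q
    rw [ha₃.idx 5 rfl, ha₂.idx 5 rfl, ha₁.idx 5 rfl]
    simp [hz]
  rintro s₄ ha₄ ⟨himp, hint⟩
  refine Runs.seq ((runs_readBar (n := n) (m := m) (by omega) (by omega) ?_ ?_ rfl ?_).mono_agree ?_)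
  · rw [ha₄.idx 0 rfl, ha₃.idx 0 rfl, ha₂.idx 0 rfl, ha₁.idx 0 rfl]
    simpa using h0
  · rw [ha₄.idx 1 rfl, ha₃.idx 1 rfl, ha₂.idx 1 rfl, ha₁.idx 1 rfl]
    simpa using h1
  · intro i j
    rw [ha₄.idx 2 rfl, ha₃.idx 2 rfl, ha₂.idx 2 rfl, ha₁.idx 2 rfl]
    simp [hz]
  intro s₅ ha₅ hbar
  refine (runs_readHat (m := m) (best := fun j => s₃.idx 4 j 0) (by omega) ?_ (ha₅.num 6 rfl) ?_
    ?_).mono_agree ?_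
  · rw [ha₅.idx 1 rfl, ha₄.idx 1 rfl, ha₃.idx 1 rfl, ha₂.idx 1 rfl, ha₁.idx 1 rfl]
    simpa using h1
  · intro j _
    rw [ha₅.idx 4 rfl, ha₄.idx 4 rfl]
  · intro i j
    rw [ha₅.idx 3 rfl, ha₄.idx 3 rfl, ha₃.idx 3 rfl, ha₂.idx 3 rfl, ha₁.idx 3 rfl]
    simp [hz]
  intro s₆ ha₆ hhat
  -- `s₃` is the memory just before the rounding and `s₄` the one just after it.
  refine ⟨s₃.num 6, s₄.num 6, s₃.num 7, _, ⟨?_, ?_, hentry, hitem, hslot, himp, hint, hbest⟩, ?_,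
    fun i _ j hj => hhat i j hj⟩
  · intro i hi q hq j hj
    have hjN : j < m + n * m := by omega
    rw [e6, hD, if_pos hjN, complete, if_neg (by rw [slotIdx]; omega),
      (hF.entry i j q hj hq (Or.inl hi)).1]
  · intro j hj
    have hjN : j < m + n * m := by omega
    rw [e6, hD, if_pos hjN, complete, if_pos rfl, hF.row_item hκ hj]
  · intro i hi j hj
    rw [ha₆.idx 2 rfl, hbar i hi j hj]

end Algorithm

end BAVWM

/-! ### Value, item and load guarantees of the output -/

namespace BAVWM

open Finset

namespace Algorithm

variable {K : Type} [Field K] [LinearOrder K] [IsStrictOrderedRing K]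
variable {κ : CostModel K} {s : State K} {n m : ℕ} {mu v w x A B C : ℕ → ℕ → K} {best : ℕ → ℕ}
  {cmax : K}

/-- Only item rows carry weight: the mirrored block and the diagonal of the slots merely make the
matrix doubly stochastic. -/
theorem Computed.weight_eq (h : Computed κ n m mu v w x A B C best) (D : ℕ → ℕ → K) :
    weight (m + n * m) C D = ∑ j ∈ range m, (C j j * D j j +
      ∑ i ∈ range n, slotWeight mu v w i j * ∑ q ∈ range m, D j (slotIdx m i q)) := by
  rw [weight, sum_range_slotIdx, sum_eq_zero (s := range n), add_zero]
  · refine sum_congr rfl fun j hj => ?_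
    have hj := mem_range.1 hj
    rw [sum_range_slotIdx]
    congr 1
    · refine sum_eq_single j (fun c hc hne => ?_) fun h' => absurd (mem_range.2 hj) h'
      rw [h.wt_item j hj c (mem_range.1 hc) hne.symm, zero_mul]
    · refine sum_congr rfl fun i hi => ?_
      rw [mul_sum]
      refine sum_congr rfl fun q hq => ?_
      rw [h.wt_entry i (mem_range.1 hi) q (mem_range.1 hq) j hj]
  · intro i _
    refine sum_eq_zero fun q _ => sum_eq_zero fun c _ => ?_
    rw [h.wt_slot _ (Nat.le_add_right _ _), zero_mul]

/-- The hat part of the assignment. -/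
def hatOf (B : ℕ → ℕ → K) (best : ℕ → ℕ) (i j : ℕ) : ℕ :=
  if 1 ≤ B j j ∧ best j = i + 1 then 1 else 0

/-- The hat fractions of item `j` add up to at most `1 - ∑ x i j = A j j`, and each unit of them is
worth at most `C j j`, which is nonnegative. -/
theorem Computed.le_weight (h : Computed κ n m mu v w x A B C best)
    (hκ : DataBounds κ n m mu v w x cmax) {x' : ℕ → ℕ → K} (hx' : ∀ i < n, ∀ j < m, 0 ≤ x' i j)
    (hsum : ∀ j < m, ∑ i ∈ range n, (x i j + x' i j) ≤ 1) :
    ∑ i ∈ range n, ∑ j ∈ range m, (slotWeight mu v w i j * x i j + w i j * x' i j) ≤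
      weight (m + n * m) C A := by
  rw [h.weight_eq, sum_comm]
  refine sum_le_sum fun j hj => ?_
  have hj := mem_range.1 hj
  have h1 : ∀ i ∈ range n, ∑ q ∈ range m, A j (slotIdx m i q) = x i j := by
    intro i hi
    have hi := mem_range.1 hi
    rw [← sum_slot_slots (v := v i) (hκ.x_nonneg i hi) (fun j hj => hκ.x_le_one hi hj) hj]
    exact sum_congr rfl fun q hq => h.entry i hi q (mem_range.1 hq) j hj
  have h2 : ∑ i ∈ range n, w i j * x' i j ≤ C j j * A j j := by
    rw [h.diag j hj]
    have h3 : ∑ i ∈ range n, w i j * x' i j ≤ C j j * ∑ i ∈ range n, x' i j := by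
      rw [mul_sum]
      exact sum_le_sum fun i hi => mul_le_mul_of_nonneg_right (h.best.ge j hj i (mem_range.1 hi))
        (hx' i (mem_range.1 hi) j hj)
    have h4 := hsum j hj
    rw [sum_add_distrib] at h4
    exact h3.trans (mul_le_mul_of_nonneg_left (by linarith) (h.best.nonneg j hj))
  rw [sum_add_distrib, sum_congr rfl fun i hi => by rw [← h1 i hi]]
  linarith

theorem Computed.cast_barOf (h : Computed κ n m mu v w x A B C best) {i j : ℕ} (hi : i < n)
    (hj : j < m) : (barOf m B i j : K) = ∑ q ∈ range m, B j (slotIdx m i q) := by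
  rw [barOf, Nat.cast_sum]
  refine sum_congr rfl fun q hq => ?_
  rcases h.integral j (by omega) _ (slotIdx_lt hi (mem_range.1 hq)) with h' | h'
  · rw [h', if_neg (by simp), Nat.cast_zero]
  · rw [h', if_pos le_rfl, Nat.cast_one]

/-- If `B j j = 1` and `best j = 0`, the item is given to nobody: the first relation is then strict,
but the second is exact since `C j j = 0`. -/
theorem Computed.sum_hatOf (h : Computed κ n m mu v w x A B C best) {j : ℕ} (hj : j < m) :
    ∑ i ∈ range n, (hatOf B best i j : K) ≤ B j j ∧
      ∑ i ∈ range n, w i j * (hatOf B best i j : K) = C j j * B j j := by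
  rcases h.integral j (by omega) j (by omega) with hB | hB
  · simp [hatOf, hB, not_le.2 (zero_lt_one (α := K))]
  · rcases h.best.attained j hj with ⟨h1, h2⟩ | ⟨p, hp, h1, h2⟩
    · simp [hatOf, hB, h1, h2]
    · have e : ∀ i, (hatOf B best i j : K) = if i = p then 1 else 0 := by
        intro i
        simp only [hatOf, hB, le_refl, true_and, h1, add_left_inj, Nat.cast_ite, Nat.cast_one,
          Nat.cast_zero]
        exact if_congr eq_comm rfl rfl
      simp [e, hB, h2, hp]

theorem Computed.weight_eq_objective (h : Computed κ n m mu v w x A B C best) :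
    weight (m + n * m) C B = ∑ i ∈ range n, ∑ j ∈ range m,
      (slotWeight mu v w i j * (barOf m B i j : K) + w i j * (hatOf B best i j : K)) := by
  rw [h.weight_eq, sum_comm]
  refine sum_congr rfl fun j hj => ?_
  have hj := mem_range.1 hj
  rw [sum_add_distrib, (h.sum_hatOf hj).2, add_comm]
  congr 1
  exact sum_congr rfl fun i hi => by rw [h.cast_barOf (mem_range.1 hi) hj]

theorem Computed.item_le (h : Computed κ n m mu v w x A B C best) {j : ℕ} (hj : j < m) :
    ∑ i ∈ range n, ((barOf m B i j : K) + (hatOf B best i j : K)) ≤ 1 := by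
  have hB := h.improves.stochastic
  rw [← hB.row j (by omega), sum_range_slotIdx, sum_add_distrib, add_comm]
  refine add_le_add ((h.sum_hatOf hj).1.trans ?_) (sum_le_sum fun i hi => ?_)
  · exact single_le_sum (f := B j) (fun c hc => hB.nonneg j (by omega) c
      (by have := mem_range.1 hc; omega)) (mem_range.2 hj)
  · exact (h.cast_barOf (mem_range.1 hi) hj).le

/-- Column sums of `B` allow at most one item per slot, and `Improves.pos` keeps items within slots
that fractionally contain them, so `sum_load_le` applies. -/
theorem Computed.load_le (h : Computed κ n m mu v w x A B C best)
    (hκ : DataBounds κ n m mu v w x cmax) {i : ℕ} (hi : i < n) {b : K} (hb : 0 ≤ b)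
    (hv : ∀ j < m, 0 ≤ v i j) (hv' : ∀ j < m, v i j ≤ b) :
    ∑ j ∈ range m, (barOf m B i j : K) * v i j ≤ b + ∑ j ∈ range m, x i j * v i j := by
  have hB := h.improves.stochastic
  rw [sum_congr rfl fun j hj => by rw [h.cast_barOf hi (mem_range.1 hj)]]
  refine sum_load_le (y := fun q j => B j (slotIdx m i q)) (hκ.x_nonneg i hi)
    (fun j hj => hκ.x_le_one hi hj) hb hv hv' ?_ ?_ ?_
  · intro q hq j hj
    exact h.integral j (by omega) _ (slotIdx_lt hi hq)
  · intro q hq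
    have hlt := slotIdx_lt hi hq
    rw [← hB.col _ hlt]
    refine sum_le_sum_of_subset_of_nonneg ?_ fun r hr _ => hB.nonneg r (mem_range.1 hr) _ hlt
    intro r hr
    have := mem_range.1 hr
    exact mem_range.2 (by omega)
  · intro q hq j hj hpos
    rw [← slotOf, ← h.entry i hi q hq j hj]
    exact h.improves.pos j (by omega) _ (slotIdx_lt hi hq) hpos

end Algorithm

open Algorithm

variable {K : Type} [Field K] [LinearOrder K] {n m : ℕ}

theorem padMatrix_val (f : Fin n → Fin m → K) (i : Fin n) (j : Fin m) :
    padMatrix f i j = f i j := by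
  simp [padMatrix]

theorem padMatrix_of_lt (f : Fin n → Fin m → K) {i j : ℕ} (hi : i < n) (hj : j < m) :
    padMatrix f i j = f ⟨i, hi⟩ ⟨j, hj⟩ := by
  simp [padMatrix, hi, hj]

theorem padVector_val (f : Fin n → K) (i : Fin n) : padVector f i 0 = f i := by
  simp [padVector]

theorem padVector_of_lt (f : Fin n → K) {i : ℕ} (hi : i < n) : padVector f i 0 = f ⟨i, hi⟩ := by
  simp [padVector, hi]

theorem objective_eq (I : Input K n m) (y : Assignment K n m) :
    objective I y = ∑ i, ∑ j, ((I.mult i * I.value i j + I.virt i j) * y.bar i j +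
      I.virt i j * y.hat i j) := by
  rw [objective, ← sum_add_distrib]
  refine sum_congr rfl fun i _ => ?_
  rw [← sum_add_distrib]
  exact sum_congr rfl fun j _ => by ring

variable [IsStrictOrderedRing K] {κ : CostModel K} {cmax : K}

theorem Computed.isRounding {I : Input K n m} {x : Assignment K n m} (hx : IsFeasible I x)
    {A B C : ℕ → ℕ → K} {best : ℕ → ℕ}
    (hκ : DataBounds κ n m (padVector I.mult) (padMatrix I.value) (padMatrix I.virt)
      (padMatrix x.bar) cmax)
    (h : Computed κ n m (padVector I.mult) (padMatrix I.value) (padMatrix I.virt)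
      (padMatrix x.bar) A B C best) {s : State K}
    (hbar : ∀ i < n, ∀ j < m, s.idx 2 i j = barOf m B i j)
    (hhat : ∀ i < n, ∀ j < m, s.idx 3 i j = hatOf B best i j) :
    IsRounding I (objective I x) (output s n m) := by
  have eb : ∀ (i : Fin n) (j : Fin m), (output s n m : Assignment K n m).bar i j =
      (barOf m B i j : K) := by
    intro i j
    rw [← hbar i i.2 j j.2]
    rfl
  have eh : ∀ (i : Fin n) (j : Fin m), (output s n m : Assignment K n m).hat i j =
      (hatOf B best i j : K) := by
    intro i j
    rw [← hhat i i.2 j j.2]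
    rfl
  have hitem : ∀ j : Fin m, ∑ i : Fin n, ((barOf m B i j : K) + (hatOf B best i j : K)) ≤ 1 := by
    intro j
    have := h.item_le j.2
    rwa [sum_range] at this
  have hle : ∀ (i : Fin n) (j : Fin m), barOf m B i j + hatOf B best i j ≤ 1 := by
    intro i j
    have := (single_le_sum (f := fun i : Fin n => (barOf m B i j : K) + (hatOf B best i j : K))
      (fun i _ => by positivity) (mem_univ i)).trans (hitem j)
    exact_mod_cast this
  refine ⟨fun i j => ?_, fun j => ?_, fun i => ?_, ?_⟩
  · rw [eb, eh]
    have := hle i j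
    constructor
    · rcases (by omega : barOf m B i j = 0 ∨ barOf m B i j = 1) with h | h <;> simp [h]
    · rcases (by omega : hatOf B best i j = 0 ∨ hatOf B best i j = 1) with h | h <;> simp [h]
  · rw [sum_congr rfl fun i _ => by rw [eb, eh]]
    exact hitem j
  · have := h.load_le hκ i.2 (I.budget_nonneg i)
      (fun j hj => by rw [padMatrix_of_lt _ i.2 hj]; exact I.value_nonneg _ _)
      (fun j hj => by rw [padMatrix_of_lt _ i.2 hj]; exact I.value_le_budget _ _)
    rw [sum_range, sum_range] at this
    simp only [padMatrix_val] at this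
    rw [sum_congr rfl fun j _ => by rw [eb]]
    linarith [hx.load i]
  · have h1 := h.le_weight hκ (x' := padMatrix x.hat)
      (fun i hi j hj => by rw [padMatrix_of_lt _ hi hj]; exact hx.hat_nonneg _ _)
      (fun j hj => by
        rw [sum_range]
        have := hx.item ⟨j, hj⟩
        refine le_trans (le_of_eq ?_) this
        exact sum_congr rfl fun i _ => by rw [padMatrix_of_lt _ i.2 hj, padMatrix_of_lt _ i.2 hj])
    -- The objective of `x` is at most the weight of `A`, hence of `B`, and that is the objective of
    -- the output.
    have h2 := (h1.trans h.improves.weight_le).trans_eq h.weight_eq_objective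
    rw [sum_range, sum_range] at h2
    simp only [sum_range, padMatrix_val, padVector_val, slotWeight] at h2
    rw [objective_eq, objective_eq]
    simp only [eb, eh]
    exact h2

/-- The rounding program is correct and fast, if the data are within the bounds of a cost model. -/
theorem exec_main {I : Input K n m} {x : Assignment K n m} (hx : IsFeasible I x)
    (hκ : DataBounds κ n m (padVector I.mult) (padMatrix I.value) (padMatrix I.virt)
      (padMatrix x.bar) cmax) (hs : κ.Bounded (initialState I x)) :
    ∃ s t, Exec κ.size main (initialState I x) s t ∧ t ≤ main.bound κ.L * κ.σ ∧
      IsRounding I (objective I x) (output s n m) := by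
  obtain ⟨s, t, h1, h2, -, A, B, C, best, h3, h4, h5⟩ := runs_main (s := initialState I x) hκ
    rfl rfl rfl rfl rfl rfl (fun _ _ => rfl) (fun _ _ => rfl) (fun a ha i j => by
      simp only [initialState]
      split_ifs <;> omega) hs
  exact ⟨s, t, h1, h2, Computed.isRounding hx hκ h3 h4 h5⟩

end BAVWM

namespace BAVWM

open Finset Algorithm

/-! ### Cost models of the real numbers and of the rational numbers -/

section Generic

variable {K : Type} [Field K] [LinearOrder K] [IsStrictOrderedRing K] {n m : ℕ}

/-- Bound for the number of iterations of the loops, in terms of the input length. -/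
def loopBound (l : ℕ) : ℕ := (l + 2) ^ 4

/-- Bound for the length of the memory entries, in terms of the input length. -/
def sizeBound (l : ℕ) : ℕ := loopBound l + 8 * l + 13

/-- Number of rows of the matrix. -/
theorem matrixSize_le {l : ℕ} (h : n + m ≤ l) : m + n * m ≤ l * (l + 1) := by nlinarith

/-- The matrix has at most `l * (l + 1)` rows, and the rounds number the square of that, whence the
fourth power. -/
theorem iterations_le_loopBound {l : ℕ} (h : n + m ≤ l) :
    (m + n * m) * (m + n * m) + (m + n * m) + n + 2 ≤ loopBound l := by
  have h1 := matrixSize_le h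
  have h2 := Nat.mul_le_mul h1 h1
  have h3 : loopBound l = l * (l + 1) * (l * (l + 1)) + l * (l + 1) +
    l + 2 + (6 * l ^ 3 + 22 * l ^ 2 + 30 * l + 14) := by
    rw [loopBound]
    ring
  omega

theorem exists_polynomial_main : ∃ p : Polynomial ℕ, ∀ l,
    main.bound (loopBound l) * sizeBound l = p.eval l := by
  obtain ⟨p, hp⟩ := main.exists_polynomial_bound
  refine ⟨p.comp ((Polynomial.X + 2) ^ 4) *
    ((Polynomial.X + 2) ^ 4 + 8 * Polynomial.X + 13), fun l => ?_⟩
  simp [hp, loopBound, sizeBound, Polynomial.eval_comp]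

theorem dataBounds_of_isFeasible {κ : CostModel K} {I : Input K n m} {x : Assignment K n m}
    {cmax : K} (hx : IsFeasible I x)
    (hL : (m + n * m) * (m + n * m) + (m + n * m) + n + 2 ≤ κ.L)
    (hb : (2 * (m + n * m : ℕ) + 2 : K) ≤ κ.big)
    (hb' : (2 * (m + n * m : ℕ) + 2) * cmax ≤ κ.big) (hc : 0 ≤ cmax)
    (hg : ∀ i j, x.bar i j ∈ κ.grid ∧ I.mult i * I.value i j + I.virt i j ∈ κ.grid ∧
      I.virt i j ∈ κ.grid)
    (hle : ∀ i j, |I.mult i * I.value i j + I.virt i j| ≤ cmax ∧ |I.virt i j| ≤ cmax) :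
    DataBounds κ n m (padVector I.mult) (padMatrix I.value) (padMatrix I.virt)
      (padMatrix x.bar) cmax where
  loop_le := hL
  le_big := hb
  wt_le_big := hb'
  cmax_nonneg := hc
  x_nonneg i hi j hj := by
    rw [padMatrix_of_lt _ hi hj]
    exact hx.bar_nonneg _ _
  item j hj := by
    rw [sum_range]
    refine le_trans (sum_le_sum fun i _ => ?_) (hx.item ⟨j, hj⟩)
    rw [padMatrix_of_lt _ i.2 hj]
    exact le_add_of_nonneg_right (hx.hat_nonneg _ _)
  x_grid i hi j hj := by
    rw [padMatrix_of_lt _ hi hj]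
    exact (hg _ _).1
  slot_grid i hi j hj := by
    rw [slotWeight, padVector_of_lt _ hi, padMatrix_of_lt _ hi hj, padMatrix_of_lt _ hi hj]
    exact (hg _ _).2.1
  slot_le i hi j hj := by
    rw [slotWeight, padVector_of_lt _ hi, padMatrix_of_lt _ hi hj, padMatrix_of_lt _ hi hj]
    exact (hle _ _).1
  virt_grid i hi j hj := by
    rw [padMatrix_of_lt _ hi hj]
    exact (hg _ _).2.2
  virt_le i hi j hj := by
    rw [padMatrix_of_lt _ hi hj]
    exact (hle _ _).2

theorem add_le_inputLength (size : K → ℕ) (I : Input K n m) (x : Assignment K n m) :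
    n + m ≤ inputLength size I x := by
  rw [inputLength, add_assoc]
  exact Nat.le_add_right _ _

theorem bounded_initialState {κ : CostModel K} (I : Input K n m) (x : Assignment K n m)
    (hn : n ≤ κ.σ) (hm : m ≤ κ.σ) (h0 : κ.size 0 ≤ κ.σ)
    (h1 : ∀ i, κ.size (I.budget i) ≤ κ.σ ∧ κ.size (I.mult i) ≤ κ.σ)
    (h2 : ∀ i j, κ.size (I.value i j) ≤ κ.σ ∧ κ.size (I.virt i j) ≤ κ.σ ∧
      κ.size (x.bar i j) ≤ κ.σ ∧ κ.size (x.hat i j) ≤ κ.σ) : κ.Bounded (initialState I x) := by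
  have hv : ∀ (f : Fin n → K), (∀ i, κ.size (f i) ≤ κ.σ) → ∀ i j, κ.size (padVector f i j) ≤ κ.σ := by
    intro f hf i j
    rw [padVector]
    split_ifs
    · exact hf _
    · exact h0
  have hM : ∀ (f : Fin n → Fin m → K), (∀ i j, κ.size (f i j) ≤ κ.σ) →
      ∀ i j, κ.size (padMatrix f i j) ≤ κ.σ := by
    intro f hf i j
    rw [padMatrix]
    split_ifs
    · exact hf _ _
    · exact h0
  refine ⟨fun a i j => (natSize_le_self _).trans ?_, fun a i j => ?_⟩
  · simp only [initialState]
    split_ifs <;> omega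
  · match a with
    | 0 => exact hv _ (fun i => (h1 i).1) i j
    | 1 => exact hM _ (fun i j => (h2 i j).1) i j
    | 2 => exact hv _ (fun i => (h1 i).2) i j
    | 3 => exact hM _ (fun i j => (h2 i j).2.1) i j
    | 4 => exact hM _ (fun i j => (h2 i j).2.2.1) i j
    | 5 => exact hM _ (fun i j => (h2 i j).2.2.2) i j
    | _ + 6 => exact h0

end Generic

/-- The unit cost model of the real numbers. -/
noncomputable def unitCost (l : ℕ) (big : ℝ) : CostModel ℝ where
  size := unitSize
  σ := sizeBound l
  L := loopBound l
  -- All lengths are one, so the grid is no restriction and `big` may be chosen freely.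
  grid := ⊤
  big := big
  laws := ⟨fun _ => by simp [unitSize], fun _ _ => by simp [unitSize], fun _ _ => by simp [unitSize],
    fun _ _ => by simp [unitSize], fun _ _ => by simp [unitSize]⟩
  one_le := by rw [sizeBound]; omega
  L_le := by rw [sizeBound]; omega
  size_le _ _ _ := by rw [unitSize, sizeBound]; omega
  one_mem := AddSubgroup.mem_top _

theorem exec_main_real {n m : ℕ} {I : Input ℝ n m} {x : Assignment ℝ n m} (hx : IsFeasible I x) :
    ∃ s t, Exec unitSize main (initialState I x) s t ∧
      t ≤ main.bound (loopBound (inputLength unitSize I x)) *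
        sizeBound (inputLength unitSize I x) ∧
      IsRounding I (objective I x) (output s n m) := by
  set l := inputLength unitSize I x
  have hl : n + m ≤ l := add_le_inputLength unitSize I x
  set cmax : ℝ := ∑ i, ∑ j, (|I.mult i * I.value i j + I.virt i j| + |I.virt i j|) with hcmax
  have hle : ∀ i j, |I.mult i * I.value i j + I.virt i j| + |I.virt i j| ≤ cmax := by
    intro i j
    refine (single_le_sum (f := fun j => |I.mult i * I.value i j + I.virt i j| + |I.virt i j|)
      (fun j _ => by positivity) (mem_univ j)).trans ?_
    exact single_le_sum (f := fun i => ∑ j, (|I.mult i * I.value i j + I.virt i j| + |I.virt i j|))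
      (fun i _ => by positivity) (mem_univ i)
  have hc0 : 0 ≤ cmax := by positivity
  have h1 : (1 : ℕ) ≤ sizeBound l := by rw [sizeBound]; omega
  have hσ : l ≤ sizeBound l := by rw [sizeBound]; omega
  -- The factor `cmax + 1` makes `big` exceed both `2 * N + 2` and its product with `cmax`.
  refine exec_main (κ := unitCost l ((2 * (m + n * m : ℕ) + 2) * (cmax + 1))) (cmax := cmax) hx
    (dataBounds_of_isFeasible hx (iterations_le_loopBound hl) ?_ ?_ hc0
      (fun i j => ⟨trivial, trivial, trivial⟩) fun i j => ⟨?_, ?_⟩)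
    (bounded_initialState I x (by change n ≤ sizeBound l; omega) (by change m ≤ sizeBound l; omega)
      h1 (fun i => ⟨h1, h1⟩) fun i j => ⟨h1, h1, h1, h1⟩)
  · exact le_mul_of_one_le_right (by positivity) (by linarith)
  · exact mul_le_mul_of_nonneg_left (by linarith) (by positivity)
  · linarith [hle i j, abs_nonneg (I.virt i j)]
  · linarith [hle i j, abs_nonneg (I.mult i * I.value i j + I.virt i j)]

/-- Reduction to lowest terms only replaces numerator and denominator by divisors. -/
theorem bitSize_div_le (a b : ℤ) (hb : b ≠ 0) :
    bitSize ((a : ℚ) / b) ≤ 1 + Nat.size a.natAbs + Nat.size b.natAbs := by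
  have h1 : ((a : ℚ) / b).num ∣ a := by
    rw [← Rat.divInt_eq_div]
    exact Rat.num_dvd a hb
  have h2 : (((a : ℚ) / b).den : ℤ) ∣ b := by
    rw [← Rat.divInt_eq_div]
    exact Rat.den_dvd a b
  have h3 : ((a : ℚ) / b).den ≤ b.natAbs :=
    Nat.le_of_dvd (Int.natAbs_pos.2 hb) (by simpa using Int.natAbs_dvd_natAbs.2 h2)
  have h4 : ((a : ℚ) / b).num.natAbs ≤ a.natAbs := by
    rcases eq_or_ne a 0 with rfl | ha
    · simp
    · exact Nat.le_of_dvd (Int.natAbs_pos.2 ha) (Int.natAbs_dvd_natAbs.2 h1)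
  rw [bitSize]
  have := natSize_mono h3
  have := natSize_mono h4
  omega

theorem natSize_natAbs_add_le (a b : ℤ) :
    Nat.size (a + b).natAbs ≤ Nat.size a.natAbs + Nat.size b.natAbs + 1 :=
  (natSize_mono (Int.natAbs_add_le a b)).trans (natSize_add_le _ _)

theorem natSize_natAbs_mul_le (a b : ℤ) :
    Nat.size (a * b).natAbs ≤ Nat.size a.natAbs + Nat.size b.natAbs := by
  rw [Int.natAbs_mul]
  exact natSize_mul_le _ _

/-- In a sum each denominator enters both the new numerator and the new denominator, which accounts
for the factor two. -/
theorem bitSize_laws : SizeLaws bitSize := by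
  have hadd : ∀ a b : ℚ, bitSize (a + b) ≤ 2 * bitSize a + 2 * bitSize b + 3 := by
    intro a b
    have ha0 : (a.den : ℚ) ≠ 0 := by exact_mod_cast a.den_ne_zero
    have hb0 : (b.den : ℚ) ≠ 0 := by exact_mod_cast b.den_ne_zero
    have e : a + b = ((a.num * b.den + b.num * a.den : ℤ) : ℚ) / ((a.den * b.den : ℤ) : ℚ) := by
      push_cast
      rw [eq_div_iff (mul_ne_zero ha0 hb0), ← Rat.mul_den_eq_num a, ← Rat.mul_den_eq_num b]
      ring
    have h := bitSize_div_le (a.num * b.den + b.num * a.den) (a.den * b.den)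
      (by exact_mod_cast mul_ne_zero a.den_ne_zero b.den_ne_zero)
    rw [← e] at h
    have h1 := natSize_natAbs_add_le (a.num * b.den) (b.num * a.den)
    have h2 := natSize_natAbs_mul_le a.num b.den
    have h3 := natSize_natAbs_mul_le b.num a.den
    have h4 := natSize_natAbs_mul_le a.den b.den
    simp only [Int.natAbs_natCast] at h1 h2 h3 h4
    simp only [bitSize] at h ⊢
    omega
  have hneg : ∀ b : ℚ, bitSize (-b) = bitSize b := by
    intro b
    simp [bitSize]
  refine ⟨fun k => ?_, hadd, fun a b => ?_, fun a b => ?_, fun a b => ?_⟩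
  · simp [bitSize]
    omega
  · have := hadd a (-b)
    rwa [← sub_eq_add_neg, hneg] at this
  · have ha0 : (a.den : ℚ) ≠ 0 := by exact_mod_cast a.den_ne_zero
    have hb0 : (b.den : ℚ) ≠ 0 := by exact_mod_cast b.den_ne_zero
    have e : a * b = ((a.num * b.num : ℤ) : ℚ) / ((a.den * b.den : ℤ) : ℚ) := by
      push_cast
      rw [eq_div_iff (mul_ne_zero ha0 hb0), ← Rat.mul_den_eq_num a, ← Rat.mul_den_eq_num b]
      ring
    have h := bitSize_div_le (a.num * b.num) (a.den * b.den)
      (by exact_mod_cast mul_ne_zero a.den_ne_zero b.den_ne_zero)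
    rw [← e] at h
    have h2 := natSize_natAbs_mul_le a.num b.num
    have h4 := natSize_natAbs_mul_le a.den b.den
    simp only [Int.natAbs_natCast] at h4
    simp only [bitSize] at h ⊢
    omega
  · rcases eq_or_ne b 0 with rfl | hb
    · simp [bitSize]
    have ha0 : (a.den : ℚ) ≠ 0 := by exact_mod_cast a.den_ne_zero
    have hb0 : (b.den : ℚ) ≠ 0 := by exact_mod_cast b.den_ne_zero
    have e : a / b = ((a.num * b.den : ℤ) : ℚ) / ((a.den * b.num : ℤ) : ℚ) := by
      push_cast
      rw [← Rat.mul_den_eq_num a, ← Rat.mul_den_eq_num b]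
      field_simp
    have h := bitSize_div_le (a.num * b.den) (a.den * b.num)
      (mul_ne_zero (by exact_mod_cast a.den_ne_zero) (Rat.num_ne_zero.2 hb))
    rw [← e] at h
    have h2 := natSize_natAbs_mul_le a.num b.den
    have h4 := natSize_natAbs_mul_le a.den b.num
    simp only [Int.natAbs_natCast] at h2 h4
    simp only [bitSize] at h ⊢
    omega

/-- The rational numbers with denominator dividing `D`. -/
def denGrid (D : ℕ) : AddSubgroup ℚ := AddSubgroup.zmultiples ((D : ℚ)⁻¹)

theorem mem_denGrid {D : ℕ} (hD : D ≠ 0) {q : ℚ} (h : q.den ∣ D) : q ∈ denGrid D := by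
  obtain ⟨k, hk⟩ := h
  have hD' : (D : ℚ) ≠ 0 := by exact_mod_cast hD
  refine AddSubgroup.mem_zmultiples_iff.2 ⟨q.num * k, ?_⟩
  rw [zsmul_eq_mul, ← div_eq_mul_inv, div_eq_iff hD', hk]
  push_cast
  rw [← Rat.mul_den_eq_num q]
  ring

/-- Write `q = a / D` with `|a| ≤ 2 ^ e * D`. The bound does not depend on how `q` was computed, so
lengths cannot accumulate over the rounds. -/
theorem bitSize_le_of_mem_denGrid {D e : ℕ} (hD : D ≠ 0) {q : ℚ} (h : q ∈ denGrid D)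
    (hq : |q| ≤ 2 ^ e) : bitSize q ≤ e + 2 * Nat.size D + 2 := by
  obtain ⟨a, rfl⟩ := AddSubgroup.mem_zmultiples_iff.1 h
  have hD' : (0 : ℚ) < D := by exact_mod_cast Nat.pos_of_ne_zero hD
  rw [zsmul_eq_mul, ← div_eq_mul_inv] at hq ⊢
  rw [abs_div, abs_of_pos hD', div_le_iff₀ hD'] at hq
  have ha : a.natAbs ≤ 2 ^ e * D := by
    have h1 : ((a.natAbs : ℕ) : ℚ) = |(a : ℚ)| := by rw [Nat.cast_natAbs, Int.cast_abs]
    rw [← h1] at hq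
    exact_mod_cast hq
  have h1 := bitSize_div_le a D (by exact_mod_cast hD)
  have h2 := natSize_mono ha
  have h3 := natSize_mul_le (2 ^ e) D
  rw [Nat.size_pow] at h3
  simp only [Int.natAbs_natCast, Int.cast_natCast] at h1
  omega

/-- The logarithmic cost model of the rational numbers. -/
def logCost (l D : ℕ) (hD : D ≠ 0) (hDl : Nat.size D ≤ 2 * l + 4) : CostModel ℚ where
  size := bitSize
  σ := sizeBound l
  L := loopBound l
  grid := denGrid D
  big := 2 ^ (4 * l + 3)
  laws := bitSize_laws
  one_le := by rw [sizeBound]; omega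
  L_le := by rw [sizeBound]; omega
  -- `(4 * l + 3) + 2 * (2 * l + 4) + 2 = 8 * l + 13`, the linear part of `sizeBound`.
  size_le q hq hb := by
    have := bitSize_le_of_mem_denGrid hD hq hb
    rw [sizeBound]
    omega
  one_mem := mem_denGrid hD (by simp)

theorem natSize_prod_le {ι : Type} (A : Finset ι) (f : ι → ℕ) :
    Nat.size (∏ i ∈ A, f i) ≤ (∑ i ∈ A, Nat.size (f i)) + 1 := by
  classical
  induction A using Finset.induction_on with
  | empty => simp
  | insert a A ha ih =>
    rw [prod_insert ha, sum_insert ha]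
    have := natSize_mul_le (f a) (∏ i ∈ A, f i)
    omega

theorem abs_le_two_pow_bitSize (q : ℚ) : |q| ≤ 2 ^ bitSize q := by
  have h1 : |q| ≤ (q.num.natAbs : ℚ) := by
    rw [Nat.cast_natAbs, Int.cast_abs, ← Rat.mul_den_eq_num q, abs_mul, Nat.abs_cast]
    exact le_mul_of_one_le_right (abs_nonneg q) (by exact_mod_cast q.den_pos)
  have h2 : q.num.natAbs ≤ 2 ^ bitSize q :=
    (Nat.lt_size_self _).le.trans (Nat.pow_le_pow_right (by norm_num) (by rw [bitSize]; omega))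
  exact h1.trans (by exact_mod_cast h2)

/-- A common denominator of the numbers on which the algorithm operates. -/
def commonDen {n m : ℕ} (I : Input ℚ n m) (x : Assignment ℚ n m) : ℕ :=
  (∏ i, (I.mult i).den) * ∏ i, ∏ j, (I.value i j).den * (I.virt i j).den * (x.bar i j).den

section Rational

variable {n m : ℕ} (I : Input ℚ n m) (x : Assignment ℚ n m)

theorem commonDen_ne_zero : commonDen I x ≠ 0 := by
  refine mul_ne_zero (prod_ne_zero_iff.2 fun i _ => (I.mult i).den_ne_zero)
    (prod_ne_zero_iff.2 fun i _ => prod_ne_zero_iff.2 fun j _ => ?_)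
  exact mul_ne_zero (mul_ne_zero (I.value i j).den_ne_zero (I.virt i j).den_ne_zero)
    (x.bar i j).den_ne_zero

theorem den_mult_dvd (i : Fin n) : (I.mult i).den ∣ commonDen I x :=
  (dvd_prod_of_mem (fun i => (I.mult i).den) (mem_univ i)).mul_right _

theorem den_dvd (i : Fin n) (j : Fin m) :
    (I.value i j).den * (I.virt i j).den * (x.bar i j).den ∣ commonDen I x :=
  ((dvd_prod_of_mem (fun j => (I.value i j).den * (I.virt i j).den * (x.bar i j).den)
    (mem_univ j)).trans (dvd_prod_of_mem
      (fun i => ∏ j, (I.value i j).den * (I.virt i j).den * (x.bar i j).den)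
      (mem_univ i))).mul_left _

theorem natSize_commonDen_le : Nat.size (commonDen I x) ≤ inputLength bitSize I x + 2 := by
  have h1 := natSize_mul_le (∏ i, (I.mult i).den)
    (∏ i, ∏ j, (I.value i j).den * (I.virt i j).den * (x.bar i j).den)
  have h2 := natSize_prod_le univ fun i => (I.mult i).den
  have h3 := natSize_prod_le (univ : Finset (Fin n × Fin m))
    fun p => (I.value p.1 p.2).den * (I.virt p.1 p.2).den * (x.bar p.1 p.2).den
  rw [Fintype.prod_prod_type, Fintype.sum_prod_type] at h3
  dsimp only at h3
  have h4 : ∑ i, Nat.size (I.mult i).den ≤ ∑ i, (bitSize (I.budget i) + bitSize (I.mult i)) :=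
    sum_le_sum fun i _ => by simp only [bitSize]; omega
  have h5 : ∑ i, ∑ j, Nat.size ((I.value i j).den * (I.virt i j).den * (x.bar i j).den) ≤
      ∑ i, ∑ j, (bitSize (I.value i j) + bitSize (I.virt i j) + bitSize (x.bar i j) +
        bitSize (x.hat i j)) := by
    refine sum_le_sum fun i _ => sum_le_sum fun j _ => ?_
    have h6 := natSize_mul_le ((I.value i j).den * (I.virt i j).den) (x.bar i j).den
    have h7 := natSize_mul_le (I.value i j).den (I.virt i j).den
    simp only [bitSize]
    omega
  rw [inputLength, commonDen]
  omega

theorem bitSize_vector_le (i : Fin n) :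
    bitSize (I.budget i) + bitSize (I.mult i) ≤ inputLength bitSize I x := by
  have := single_le_sum (f := fun i => bitSize (I.budget i) + bitSize (I.mult i))
    (fun i _ => Nat.zero_le _) (mem_univ i)
  rw [inputLength]
  omega

theorem bitSize_matrix_le (i : Fin n) (j : Fin m) :
    bitSize (I.value i j) + bitSize (I.virt i j) + bitSize (x.bar i j) + bitSize (x.hat i j) ≤
      inputLength bitSize I x := by
  have h1 := single_le_sum (f := fun j => bitSize (I.value i j) + bitSize (I.virt i j) +
    bitSize (x.bar i j) + bitSize (x.hat i j)) (fun j _ => Nat.zero_le _) (mem_univ j)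
  have h2 := single_le_sum (f := fun i => ∑ j, (bitSize (I.value i j) + bitSize (I.virt i j) +
    bitSize (x.bar i j) + bitSize (x.hat i j))) (fun i _ => Nat.zero_le _) (mem_univ i)
  rw [inputLength]
  omega

variable {I x}

theorem exec_main_rat (hx : IsFeasible I x) :
    ∃ s t, Exec bitSize main (initialState I x) s t ∧
      t ≤ main.bound (loopBound (inputLength bitSize I x)) *
        sizeBound (inputLength bitSize I x) ∧
      IsRounding I (objective I x) (output s n m) := by
  set l := inputLength bitSize I x
  have hl : n + m ≤ l := add_le_inputLength bitSize I x
  set d := commonDen I x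
  have hd : d ≠ 0 := commonDen_ne_zero I x
  have hdl : Nat.size d ≤ l + 2 := natSize_commonDen_le I x
  -- The grid needs the square of `d` because the weights contain products `mult i * value i j`.
  have hD : d * d ≠ 0 := mul_ne_zero hd hd
  have hDl : Nat.size (d * d) ≤ 2 * l + 4 := (natSize_mul_le d d).trans (by omega)
  have hσ : l + 2 ≤ sizeBound l := by rw [sizeBound]; omega
  have habs : ∀ q : ℚ, bitSize q ≤ l → |q| ≤ 2 ^ l := fun q hq =>
    (abs_le_two_pow_bitSize q).trans (pow_le_pow_right₀ one_le_two hq)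
  have h1l : (1 : ℚ) ≤ 2 ^ l := one_le_pow₀ one_le_two
  have hN : (2 * (m + n * m : ℕ) + 2 : ℚ) ≤ 2 ^ (2 * l + 2) := by
    have h1 := matrixSize_le hl
    have h2 : l + 1 ≤ 2 ^ l := Nat.lt_two_pow_self
    have h3 : 2 * (m + n * m) + 2 ≤ 2 ^ (2 * l + 2) := by
      rw [pow_add, two_mul l, pow_add]
      nlinarith
    exact_mod_cast h3
  have hv := bitSize_vector_le I x
  have hM := bitSize_matrix_le I x
  -- A product of two inputs plus a third is at most `2 ^ l * 2 ^ l + 2 ^ l`, which gives `cmax`.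
  -- Times `2 * N + 2`, which is at most `2 ^ (2 * l + 2)`, it gives the exponent `4 * l + 3` of
  -- `big`.
  refine exec_main (κ := logCost l (d * d) hD hDl) (cmax := 2 ^ (2 * l + 1)) hx
    (dataBounds_of_isFeasible hx (iterations_le_loopBound hl) ?_ ?_ (by positivity)
      (fun i j => ⟨?_, ?_, ?_⟩) fun i j => ⟨?_, ?_⟩)
    (bounded_initialState I x (by change n ≤ sizeBound l; omega) (by change m ≤ sizeBound l; omega)
      (by change bitSize 0 ≤ sizeBound l; simp [bitSize]; omega)
      (fun i => ?_) fun i j => ?_)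
  · exact hN.trans (pow_le_pow_right₀ one_le_two (by omega))
  · refine (mul_le_mul_of_nonneg_right hN (by positivity)).trans ?_
    rw [← pow_add]
    exact pow_le_pow_right₀ one_le_two (by omega)
  · exact mem_denGrid hD (((Dvd.intro_left _ rfl).trans (den_dvd I x i j)).mul_right d)
  · refine AddSubgroup.add_mem _ (mem_denGrid hD ?_) (mem_denGrid hD ?_)
    · refine (Rat.mul_den_dvd _ _).trans (mul_dvd_mul (den_mult_dvd I x i) ?_)
      exact ((Dvd.intro _ rfl).trans (Dvd.intro _ rfl)).trans (den_dvd I x i j)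
    · exact (((Dvd.intro_left _ rfl).trans (Dvd.intro _ rfl)).trans (den_dvd I x i j)).mul_right d
  · exact mem_denGrid hD
      ((((Dvd.intro_left _ rfl).trans (Dvd.intro _ rfl)).trans (den_dvd I x i j)).mul_right d)
  · refine (abs_add_le _ _).trans ?_
    have h1 := habs (I.mult i) (by have := hv i; omega)
    have h2 := habs (I.value i j) (by have := hM i j; omega)
    have h3 := habs (I.virt i j) (by have := hM i j; omega)
    have h4 := mul_le_mul h1 h2 (abs_nonneg _) (by positivity)
    rw [abs_mul, pow_succ, two_mul l, pow_add]
    nlinarith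
  · exact (habs _ (by have := hM i j; omega)).trans (pow_le_pow_right₀ one_le_two (by omega))
  · have := hv i
    change bitSize _ ≤ sizeBound l ∧ bitSize _ ≤ sizeBound l
    omega
  · have := hM i j
    change bitSize _ ≤ sizeBound l ∧ bitSize _ ≤ sizeBound l ∧ bitSize _ ≤ sizeBound l ∧
      bitSize _ ≤ sizeBound l
    omega

end Rational

end BAVWM

theorem theorem3p1 :
    ∃ P : BAVWM.Prog,
      (∃ p : Polynomial ℕ, ∀ (n m : ℕ) (I : BAVWM.Input ℝ n m) (x : BAVWM.Assignment ℝ n m),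
        BAVWM.IsOptimal I x →
          ∃ (s : BAVWM.State ℝ) (t : ℕ),
            BAVWM.Exec BAVWM.unitSize P (BAVWM.initialState I x) s t ∧
            t ≤ p.eval (BAVWM.inputLength BAVWM.unitSize I x) ∧
            BAVWM.IsRounding I (BAVWM.objective I x) (BAVWM.output s n m)) ∧
      (∃ p : Polynomial ℕ, ∀ (n m : ℕ) (I : BAVWM.Input ℚ n m) (x : BAVWM.Assignment ℚ n m),
        BAVWM.IsOptimal I x →
          ∃ (s : BAVWM.State ℚ) (t : ℕ),
            BAVWM.Exec BAVWM.bitSize P (BAVWM.initialState I x) s t ∧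
            t ≤ p.eval (BAVWM.inputLength BAVWM.bitSize I x) ∧
            BAVWM.IsRounding I (BAVWM.objective I x) (BAVWM.output s n m)) := by
  -- Both cost models use the same `loopBound` and `sizeBound`, so one polynomial serves twice. With
  -- unit cost the input length is `n + m + 2 * n + 4 * n * m`, a polynomial in `n` and `m`.
  obtain ⟨p, hp⟩ := BAVWM.exists_polynomial_main
  refine ⟨BAVWM.Algorithm.main, ⟨p, fun n m I x hx => ?_⟩, ⟨p, fun n m I x hx => ?_⟩⟩
  · obtain ⟨s, t, h1, h2, h3⟩ := BAVWM.exec_main_real hx.1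
    exact ⟨s, t, h1, h2.trans_eq (hp _), h3⟩
  · obtain ⟨s, t, h1, h2, h3⟩ := BAVWM.exec_main_rat hx.1
    exact ⟨s, t, h1, h2.trans_eq (hp _), h3⟩
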